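/- Let $m\ge 0$ and let $\pi:M\to Y$ be a smooth fiber bundle with compact fibers $Z$ of dimension $n\in\{8m+1,8m+2,8m+3\}$ and connected base $Y$. Let $TZ=\ker d\pi$ carry a Euclidean metric $g^Z$, let $TM=T^HM\oplus TZ$ with $T^HM$ a smooth subbundle, and let $g^Y$ be a Riemannian metric on $Y$. Let $\nabla^L$ be the Levi-Civita connection of $g^Y\oplus g^Z$ on $TM$ (with $g^Y$ lifted to $T^HM$ and $T^HM\perp TZ$), let $P_Z:TM\to TZ$ be the orthogonal projection, and let $\nabla^Z=P_Z\nabla^L$ be the induced connection on $TZ$, with curvature $R^Z$. Put $$\widehat A(TZ)={\det}^{1/2}\left(\frac{\frac{\sqrt{-1}}{4\pi}R^Z}{\sinh\left(\frac{\sqrt{-1}}{4\pi}R^Z\right)}\right),\qquad \widehat L(TZ)={\det}^{1/2}\left(\frac{\frac{\sqrt{-1}}{2\pi}R^Z}{\tanh\left(\frac{\sqrt{-1}}{4\pi}R^Z\right)}\right),$$ where the degree-zero part of each square root is positive. With $q=e^{2\pi\sqrt{-1}\tau}$, $\tau$ in the upper half plane $\mathbf H$, and $\widetilde E=E-\mathbf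 C^{\mathrm{rk}E}$, put $$\Theta_1(T_{\mathbf C}Z)=\bigotimes_{j\ge1}S_{q^j}(\widetilde{T_{\mathbf C}Z})\otimes\bigotimes_{j\ge1}\Lambda_{q^j}(\widetilde{T_{\mathbf C}Z}),\qquad \Theta_2(T_{\mathbf C}Z)=\bigotimes_{j\ge1}S_{q^j}(\widetilde{T_{\mathbf C}Z})\otimes\bigotimes_{j\ge1}\Lambda_{-q^{j-1/2}}(\widetilde{T_{\mathbf C}Z}).$$ Here $T_{\mathbf C}Z=TZ\otimes\mathbf C$, $S_t(E)=\sum_k t^kS^k(E)$, $\Lambda_t(E)=\sum_k t^k\Lambda^k(E)$, $S_t(E-F)=S_t(E)/S_t(F)$, $\Lambda_t(E-F)=\Lambda_t(E)/\Lambda_t(F)$. These are series in $q^{1/2}$ of virtual bundles with the connections induced by $\nabla^Z$, and $\mathrm{ch}$, given by $\mathrm{tr}\exp\left(\frac{\sqrt{-1}}{2\pi}R\right)$ on bundles with curvature $R$, is applied coefficientwise. Then the series in $q^{1/2}$ of the components of degree $8m+4$ $$P_1(\tau)=\left\{\widehat L(TZ)\,\mathrm{ch}(\Theta_1(T_{\mathbf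 C}Z))\right\}^{(8m+4)},\qquad P_2(\tau)=\left\{\widehat A(TZ)\,\mathrm{ch}(\Theta_2(T_{\mathbf C}Z))\right\}^{(8m+4)}$$ converge at every point of $M$ for every $\tau\in\mathbf H$. At every point of $M$, $P_1$ is a modular form of weight $4m+2$ over $\Gamma_0(2)=\{\left(\begin{smallmatrix}a&b\\c&d\end{smallmatrix}\right)\in SL_2(\mathbf Z): c \text{ even}\}$ and $P_2$ is a modular form of weight $4m+2$ over $\Gamma^0(2)=\{\left(\begin{smallmatrix}a&b\\c&d\end{smallmatrix}\right)\in SL_2(\mathbf Z): b \text{ even}\}$, with values in the complex exterior forms of degree $8m+4$ at that point; that is, their coordinates are holomorphic on $\mathbf H$, invariant under the weight-$(4m+2)$ action (with trivial character), and bounded at the cusps. Moreover, for all $\tau\in\mathbf H$, $$P_1(-1/\tau)=2^{n/2}\,\tau^{4m+2}\,P_2(\tau).$$ -/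

import Mathlib

open scoped Manifold ContDiff MatrixGroups
open Bundle UpperHalfPlane

/-! ## Even differential forms at a point -/

section EvenForms

/-- Complex-valued exterior forms at a point: `Λ(T* ⊗ ℂ)`, for a real vector space `T`. -/
abbrev Forms (T : Type*) [AddCommGroup T] [Module ℝ T] : Type _ :=
  ExteriorAlgebra ℂ (T →ₗ[ℝ] ℂ)

/-- The exterior forms of even degree, `Λ^{even}(T* ⊗ ℂ)`. -/
def EvenForms (T : Type*) [AddCommGroup T] [Module ℝ T] : Type _ :=
  CliffordAlgebra.even (0 : QuadraticForm ℂ (T →ₗ[ℝ] ℂ))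

/-- Products of two 1-forms are central in the exterior algebra. -/
theorem ExteriorAlgebra.ι_mul_ι_central {V : Type*} [AddCommGroup V] [Module ℂ V] (a b : V)
    (y : ExteriorAlgebra ℂ V) :
    ExteriorAlgebra.ι ℂ a * ExteriorAlgebra.ι ℂ b * y =
      y * (ExteriorAlgebra.ι ℂ a * ExteriorAlgebra.ι ℂ b) := by
  induction y using ExteriorAlgebra.induction with
  | algebraMap r => exact (Algebra.commutes r _).symm
  | ι c =>
    have h1 := eq_neg_of_add_eq_zero_left (ExteriorAlgebra.ι_add_mul_swap (R := ℂ) b c)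
    have h2 := eq_neg_of_add_eq_zero_left (ExteriorAlgebra.ι_add_mul_swap (R := ℂ) a c)
    rw [mul_assoc, h1, mul_neg, ← mul_assoc, h2, neg_mul, neg_neg, mul_assoc]
  | mul x y hx hy => rw [← mul_assoc, hx, mul_assoc, hy, mul_assoc]
  | add x y hx hy => rw [mul_add, add_mul, hx, hy]

/-- Even forms commute. -/
theorem even_mul_comm {V : Type*} [AddCommGroup V] [Module ℂ V]
    (x y : CliffordAlgebra.even (0 : QuadraticForm ℂ V)) : x * y = y * x := by
  apply Subtype.ext
  obtain ⟨x, hx⟩ := x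
  change x * (y : CliffordAlgebra (0 : QuadraticForm ℂ V)) = y * x
  induction x, hx using CliffordAlgebra.even_induction with
  | algebraMap r => exact Algebra.commutes r _
  | add x x' hx hx' h h' => rw [add_mul, mul_add, h, h']
  | ι_mul_ι_mul a b x hx h =>
    have hc := ExteriorAlgebra.ι_mul_ι_central a b
      (y : CliffordAlgebra (0 : QuadraticForm ℂ V))
    change CliffordAlgebra.ι 0 a * CliffordAlgebra.ι 0 b * _ =
      _ * (CliffordAlgebra.ι 0 a * CliffordAlgebra.ι 0 b) at hc
    rw [mul_assoc, h, ← mul_assoc, hc, mul_assoc]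

variable (T : Type*) [AddCommGroup T] [Module ℝ T]

noncomputable instance EvenForms.instCommRing : CommRing (EvenForms T) :=
  { (inferInstance : Ring (CliffordAlgebra.even (0 : QuadraticForm ℂ (T →ₗ[ℝ] ℂ)))) with
    mul_comm := even_mul_comm }

noncomputable instance EvenForms.instAlgebra : Algebra ℂ (EvenForms T) :=
  (inferInstance : Algebra ℂ (CliffordAlgebra.even (0 : QuadraticForm ℂ (T →ₗ[ℝ] ℂ))))

variable {T}

/-- The inclusion of even forms into all forms. -/
noncomputable def EvenForms.toForms : EvenForms T →ₐ[ℂ] Forms T :=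
  (CliffordAlgebra.even (0 : QuadraticForm ℂ (T →ₗ[ℝ] ℂ))).val

/-- The component `η^{(k)}` of degree `k` of a form. -/
noncomputable def EvenForms.component (k : ℕ) (η : EvenForms T) : Forms T :=
  DirectSum.decompose (fun i : ℕ => ⋀[ℂ]^i (T →ₗ[ℝ] ℂ)) η.toForms k

/-- The component of degree zero, as a number. -/
noncomputable def EvenForms.scalarPart (η : EvenForms T) : ℂ :=
  ExteriorAlgebra.algebraMapInv η.toForms

/-- The 2-form `½ ∑ η(e_a, e_b) e^a ∧ e^b` of an alternating bilinear function `η` on `T`, for a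
basis `e` of `T` with dual basis `e^a`. -/
noncomputable def EvenForms.ofTwoForm [FiniteDimensional ℝ T] (η : T → T → ℝ) : EvenForms T :=
  let e := Module.finBasis ℝ T
  let dual (a : Fin (Module.finrank ℝ T)) : T →ₗ[ℝ] ℂ := Complex.ofRealCLM.toLinearMap ∘ₗ e.coord a
  (1 / 2 : ℂ) • ∑ a, ∑ b, (η (e a) (e b) : ℂ) •
    ((CliffordAlgebra.even.ι (0 : QuadraticForm ℂ (T →ₗ[ℝ] ℂ))).bilin (dual a) (dual b) :
      EvenForms T)

end EvenForms

/-! ## Chern-Weil calculus for a curvature matrix with entries in the even forms -/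

section ChernWeil

open PowerSeries

/-- The value `∑ f_k a^k` (a finite sum) of a power series at a nilpotent element. -/
noncomputable def evalNilpotent {A : Type*} [Ring A] [Algebra ℂ A] (f : ℂ⟦X⟧) (a : A) : A :=
  ∑ k ∈ Finset.range (nilpotencyClass a), coeff k f • a ^ k

/-- The Taylor series of `sinh z / z`. -/
noncomputable def sinhDivSeries : ℂ⟦X⟧ :=
  mk fun k => if Even k then ((k + 1).factorial : ℂ)⁻¹ else 0

/-- The Taylor series of `cosh z`. -/
noncomputable def coshSeries : ℂ⟦X⟧ :=
  mk fun k => if Even k then (k.factorial : ℂ)⁻¹ else 0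

variable {T : Type*} [AddCommGroup T] [Module ℝ T]

/-- The square root of an even form `η` whose degree-zero component `c` is nonzero:
`√c · (1 + (c⁻¹η - 1))^{1/2}`, through the binomial series. -/
noncomputable def EvenForms.sqrt (η : EvenForms T) : EvenForms T :=
  (η.scalarPart ^ (1 / 2 : ℂ)) •
    evalNilpotent (binomialSeries ℂ (1 / 2 : ℚ)) (η.scalarPart⁻¹ • η - 1)

variable {ι : Type*} [Fintype ι] [DecidableEq ι]

/-- `Â = det^{1/2}( (√-1/4π) R / sinh((√-1/4π) R) )`. -/
noncomputable def aHatForm (R : Matrix ι ι (EvenForms T)) : EvenForms T :=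
  (evalNilpotent sinhDivSeries⁻¹ ((Complex.I / (4 * Real.pi)) • R)).det.sqrt

/-- `L̂ = det^{1/2}( (√-1/2π) R / tanh((√-1/4π) R) )`; with `z = (√-1/4π) R` the function inside is
`2z / tanh z = 2 · cosh z / (sinh z / z)`. -/
noncomputable def lHatForm (R : Matrix ι ι (EvenForms T)) : EvenForms T :=
  (evalNilpotent ((2 : ℂ) • (coshSeries * sinhDivSeries⁻¹))
    ((Complex.I / (4 * Real.pi)) • R)).det.sqrt

/-- `exp((√-1/2π) R)`. -/
noncomputable def chernExp (R : Matrix ι ι (EvenForms T)) : Matrix ι ι (EvenForms T) :=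
  evalNilpotent (PowerSeries.exp ℂ) ((Complex.I / (2 * Real.pi)) • R)

/-- The curvature `∑ᵢ 1 ⊗ ⋯ ⊗ R ⊗ ⋯ ⊗ 1` of the connection induced on the tensor power `E^{⊗k}`. -/
noncomputable def tensorCurvature (k : ℕ) (R : Matrix ι ι (EvenForms T)) :
    Matrix (Fin k → ι) (Fin k → ι) (EvenForms T) :=
  Matrix.of fun f g => ∑ i, if ∀ j, j ≠ i → f j = g j then R (f i) (g i) else 0

/-- The projection of `E^{⊗k}` onto the symmetric tensors `S^k(E)`. -/
noncomputable def symmetrizer (T ι : Type*) [AddCommGroup T] [Module ℝ T] [Fintype ι]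
    [DecidableEq ι] (k : ℕ) : Matrix (Fin k → ι) (Fin k → ι) (EvenForms T) :=
  Matrix.of fun f g => (k.factorial : ℂ)⁻¹ •
    ∑ σ : Equiv.Perm (Fin k), if f ∘ σ = g then (1 : EvenForms T) else 0

/-- The projection of `E^{⊗k}` onto the antisymmetric tensors `Λ^k(E)`. -/
noncomputable def antisymmetrizer (T ι : Type*) [AddCommGroup T] [Module ℝ T] [Fintype ι]
    [DecidableEq ι] (k : ℕ) : Matrix (Fin k → ι) (Fin k → ι) (EvenForms T) :=
  Matrix.of fun f g => (k.factorial : ℂ)⁻¹ •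
    ∑ σ : Equiv.Perm (Fin k),
      if f ∘ σ = g then (((Equiv.Perm.sign σ : ℤˣ) : ℤ) : EvenForms T) else 0

/-- `ch(S_t(E)) = ∑_k ch(S^k(E)) t^k`, where `S^k(E) ⊆ E^{⊗k}` carries the induced connection and
`ch = tr exp((√-1/2π) · curvature)`, the trace being that of the restriction to `S^k(E)`. -/
noncomputable def chSym (R : Matrix ι ι (EvenForms T)) : (EvenForms T)⟦X⟧ :=
  mk fun k => (symmetrizer T ι k * chernExp (tensorCurvature k R)).trace

/-- `ch(Λ_t(E)) = ∑_k ch(Λ^k(E)) t^k`, with the induced connection on `Λ^k(E) ⊆ E^{⊗k}`. -/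
noncomputable def chExt (R : Matrix ι ι (EvenForms T)) : (EvenForms T)⟦X⟧ :=
  mk fun k => (antisymmetrizer T ι k * chernExp (tensorCurvature k R)).trace

/-- `ch(S_t(Ẽ)) = ch(S_t(E)) / ch(S_t(ℂ^{rk E}))`, where `Ẽ = E - ℂ^{rk E}`; the trivial bundle
has curvature zero. -/
noncomputable def chSymReduced (R : Matrix ι ι (EvenForms T)) : (EvenForms T)⟦X⟧ :=
  chSym R * invOfUnit (chSym (0 : Matrix ι ι (EvenForms T))) 1

/-- `ch(Λ_t(Ẽ)) = ch(Λ_t(E)) / ch(Λ_t(ℂ^{rk E}))`, where `Ẽ = E - ℂ^{rk E}`. -/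
noncomputable def chExtReduced (R : Matrix ι ι (EvenForms T)) : (EvenForms T)⟦X⟧ :=
  chExt R * invOfUnit (chExt (0 : Matrix ι ι (EvenForms T))) 1

/-- The infinite product `∏_{j ≥ 0} F j` of power series with `F j = 1 + O(X^{j+1})`: its
coefficient of `X^N` is that of the finite product over `j ≤ N`. -/
noncomputable def formalProd {A : Type*} [CommRing A] (F : ℕ → A⟦X⟧) : A⟦X⟧ :=
  mk fun N => coeff N (∏ j ∈ Finset.range (N + 1), F j)

/-- `ch(Θ₁(E))`, `Θ₁(E) = ⨂_{n≥1} S_{q^n}(Ẽ) ⊗ ⨂_{n≥1} Λ_{q^n}(Ẽ)`, as a power series in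
`X = q^{1/2}`. -/
noncomputable def chTheta₁ (R : Matrix ι ι (EvenForms T)) : (EvenForms T)⟦X⟧ :=
  formalProd (fun j => (chSymReduced R).subst (X ^ (2 * (j + 1)) : (EvenForms T)⟦X⟧)) *
  formalProd (fun j => (chExtReduced R).subst (X ^ (2 * (j + 1)) : (EvenForms T)⟦X⟧))

/-- `ch(Θ₂(E))`, `Θ₂(E) = ⨂_{n≥1} S_{q^n}(Ẽ) ⊗ ⨂_{n≥1} Λ_{-q^{n-1/2}}(Ẽ)`, as a power series in
`X = q^{1/2}`. -/
noncomputable def chTheta₂ (R : Matrix ι ι (EvenForms T)) : (EvenForms T)⟦X⟧ :=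
  formalProd (fun j => (chSymReduced R).subst (X ^ (2 * (j + 1)) : (EvenForms T)⟦X⟧)) *
  formalProd (fun j => (chExtReduced R).subst (-X ^ (2 * j + 1) : (EvenForms T)⟦X⟧))

/-- The coefficient of `q^{N/2}` in the degree-`k` component of `L̂ · ch(Θ₁)`. -/
noncomputable def P₁Coeff (k : ℕ) (R : Matrix ι ι (EvenForms T)) (N : ℕ) : Forms T :=
  (lHatForm R * coeff N (chTheta₁ R)).component k

/-- The coefficient of `q^{N/2}` in the degree-`k` component of `Â · ch(Θ₂)`. -/
noncomputable def P₂Coeff (k : ℕ) (R : Matrix ι ι (EvenForms T)) (N : ℕ) : Forms T :=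
  (aHatForm R * coeff N (chTheta₂ R)).component k

end ChernWeil

/-! ## Modularity -/

section Modular

/-- `Γ⁰(2)`: the matrices in `SL₂(ℤ)` whose upper right entry is even. -/
def GammaUpper0Two : Subgroup SL(2, ℤ) where
  carrier := {g | ((g 0 1 : ℤ) : ZMod 2) = 0}
  one_mem' := by simp
  mul_mem' {a} {b} ha hb := by
    have h := (Matrix.two_mul_expl a.1 b.1).2.1
    simp only [Matrix.SpecialLinearGroup.coe_mul, Set.mem_ofPred_eq] at *
    simp [h, ha, hb]
  inv_mem' {a} ha := by
    have h : (a⁻¹ : SL(2, ℤ)) 0 1 = -a 0 1 := by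
      rw [Matrix.SpecialLinearGroup.SL2_inv_expl a]; rfl
    have ha' : ((a 0 1 : ℤ) : ZMod 2) = 0 := ha
    change (((a⁻¹ : SL(2, ℤ)) 0 1 : ℤ) : ZMod 2) = 0
    rw [h, Int.cast_neg, ha', neg_zero]

/-- `∑_N a_N q^{N/2}`, `q = e^{2πiτ}`, converges to `s`. In a vector space `W` of finite dimension
this is tested with linear functionals, that is, on coordinates. -/
def HasQSum {W : Type*} [AddCommGroup W] [Module ℂ W] (a : ℕ → W) (τ : ℍ) (s : W) : Prop :=
  ∀ l : W →ₗ[ℂ] ℂ,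
    HasSum (fun N : ℕ => l (a N) * Complex.exp (Real.pi * Complex.I * N * τ)) (l s)

/-- `P`, with values in a vector space `W` of finite dimension, is a modular form of weight `k` over
`Γ`: so is every coordinate of `P`. (Holomorphic on `ℍ`, invariant with trivial character, bounded
at every cusp.) -/
def IsModularFormValued {W : Type*} [AddCommGroup W] [Module ℂ W] (Γ : Subgroup SL(2, ℤ)) (k : ℤ)
    (P : ℍ → W) : Prop :=
  ∀ l : W →ₗ[ℂ] ℂ, ∃ F : ModularForm (Γ : Subgroup (GL (Fin 2) ℝ)) k, ∀ τ, F τ = l (P τ)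

end Modular

/-! ## Families of manifolds -/

section Geometry

/-- `cov` is the Levi-Civita connection of the metric `g` on `TM`: it is smooth (on every open
set), compatible with `g`, and without torsion. -/
structure IsLeviCivita {d : ℕ} {M : Type*} [TopologicalSpace M]
    [ChartedSpace (EuclideanSpace ℝ (Fin d)) M] [IsManifold (𝓡 d) ∞ M]
    (g : (x : M) → TangentSpace (𝓡 d) x → TangentSpace (𝓡 d) x → ℝ)
    (cov : CovariantDerivative (𝓡 d) (EuclideanSpace ℝ (Fin d))
      (TangentSpace (𝓡 d) : M → Type _)) : Prop where
  smooth (u : Set M) (hu : IsOpen u) :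
    haveI : IsManifold (𝓡 d) 1 M := .of_le (n := ∞) (by norm_num)
    ContMDiffCovariantDerivativeOn (EuclideanSpace ℝ (Fin d)) ∞ cov.toFun u
  metric (X W : (x : M) → TangentSpace (𝓡 d) x) (x : M)
    (hX : MDifferentiableAt (𝓡 d) (𝓡 d).tangent
      (fun y => (⟨y, X y⟩ : TangentBundle (𝓡 d) M)) x)
    (hW : MDifferentiableAt (𝓡 d) (𝓡 d).tangent
      (fun y => (⟨y, W y⟩ : TangentBundle (𝓡 d) M)) x)
    (v : TangentSpace (𝓡 d) x) :
    mvfderiv (𝓡 d) (fun y => g y (X y) (W y)) x v =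
      g x (cov X x v) (W x) + g x (X x) (cov W x v)
  torsion_free (X W : (x : M) → TangentSpace (𝓡 d) x) (x : M)
    (hX : MDifferentiableAt (𝓡 d) (𝓡 d).tangent
      (fun y => (⟨y, X y⟩ : TangentBundle (𝓡 d) M)) x)
    (hW : MDifferentiableAt (𝓡 d) (𝓡 d).tangent
      (fun y => (⟨y, W y⟩ : TangentBundle (𝓡 d) M)) x) :
    cov W x (X x) - cov X x (W x) = VectorField.mlieBracket (𝓡 d) X W x

variable {p n d : ℕ}
  {Y : Type*} [TopologicalSpace Y] [ChartedSpace (EuclideanSpace ℝ (Fin p)) Y]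
  {Z : Type*} [TopologicalSpace Z] [ChartedSpace (EuclideanSpace ℝ (Fin n)) Z]
  {M : Type*} [TopologicalSpace M] [ChartedSpace (EuclideanSpace ℝ (Fin d)) M]

/-- `pr : M → Y` is a smooth fiber bundle with fiber `Z`: it is locally, over open sets of `Y`,
diffeomorphic to the projection `U × Z → U`. -/
def IsSmoothFiberBundle (p n d : ℕ) {Y : Type*} [TopologicalSpace Y]
    [ChartedSpace (EuclideanSpace ℝ (Fin p)) Y] {M : Type*} [TopologicalSpace M]
    [ChartedSpace (EuclideanSpace ℝ (Fin d)) M]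
    (Z : Type*) [TopologicalSpace Z] [ChartedSpace (EuclideanSpace ℝ (Fin n)) Z]
    (pr : M → Y) : Prop :=
  ∀ y : Y, ∃ (U : Set Y) (φ : OpenPartialHomeomorph M (Y × Z)), IsOpen U ∧ y ∈ U ∧
    φ.source = pr ⁻¹' U ∧ φ.target = U ×ˢ Set.univ ∧ (∀ x ∈ φ.source, (φ x).1 = pr x) ∧
    ContMDiffOn (𝓡 d) ((𝓡 p).prod (𝓡 n)) ∞ φ φ.source ∧
    ContMDiffOn ((𝓡 p).prod (𝓡 n)) (𝓡 d) ∞ φ.symm φ.target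

/-- The fiber `ker d(pr)` at `x` of the vertical tangent bundle `TZ`. -/
noncomputable def verticalSpace (p d : ℕ) {Y : Type*} [TopologicalSpace Y]
    [ChartedSpace (EuclideanSpace ℝ (Fin p)) Y] {M : Type*} [TopologicalSpace M]
    [ChartedSpace (EuclideanSpace ℝ (Fin d)) M]
    (pr : M → Y) (x : M) : Submodule ℝ (TangentSpace (𝓡 d) x) :=
  LinearMap.ker (mfderiv (𝓡 d) (𝓡 p) pr x).toLinearMap

instance finiteDimensional_tangent (x : M) : FiniteDimensional ℝ (TangentSpace (𝓡 d) x) :=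
  inferInstanceAs (FiniteDimensional ℝ (EuclideanSpace ℝ (Fin d)))

instance t2Space_tangent (x : M) : T2Space (TangentSpace (𝓡 d) x) :=
  inferInstanceAs (T2Space (EuclideanSpace ℝ (Fin d)))

variable [IsManifold (𝓡 p) ∞ Y] [IsManifold (𝓡 d) ∞ M]

/-- The geometric data on a family `pr : M → Y`: a smooth horizontal subbundle `T^H M` of `TM`
complementary to `TZ`, a Riemannian metric on `Y`, and a Euclidean metric on `TZ`. -/
structure FamilyGeometry (p d : ℕ) {Y : Type*} [TopologicalSpace Y]
    [ChartedSpace (EuclideanSpace ℝ (Fin p)) Y] [IsManifold (𝓡 p) ∞ Y]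
    {M : Type*} [TopologicalSpace M] [ChartedSpace (EuclideanSpace ℝ (Fin d)) M]
    [IsManifold (𝓡 d) ∞ M] (pr : M → Y) where
  /-- The horizontal subbundle `T^H M`. -/
  hor (x : M) : Submodule ℝ (TangentSpace (𝓡 d) x)
  isCompl (x : M) : IsCompl (verticalSpace p d pr x) (hor x)
  /-- Smoothness of `T^H M`, through the projection of `TM` onto `TZ` along it. -/
  contMDiff_hor : ContMDiff (𝓡 d)
    ((𝓡 d).prod
      𝓘(ℝ, EuclideanSpace ℝ (Fin d) →L[ℝ] EuclideanSpace ℝ (Fin d))) ∞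
    (fun x : M => TotalSpace.mk'
      (E := fun x : M => TangentSpace (𝓡 d) x →L[ℝ] TangentSpace (𝓡 d) x)
      (EuclideanSpace ℝ (Fin d) →L[ℝ] EuclideanSpace ℝ (Fin d)) x
      (LinearMap.toContinuousLinearMap ((verticalSpace p d pr x).projection (hor x) (isCompl x))))
  /-- The metric `g^Y` on `Y`. -/
  baseMetric : ContMDiffRiemannianMetric (𝓡 p) ∞ (EuclideanSpace ℝ (Fin p))
    (TangentSpace (𝓡 p) : Y → Type _)
  /-- The metric `g^Z` on `TZ`, extended by zero to `T^H M`. -/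
  vertMetric (x : M) :
    TangentSpace (𝓡 d) x →L[ℝ] TangentSpace (𝓡 d) x →L[ℝ] ℝ
  vertMetric_symm (x : M) (u v) : vertMetric x u v = vertMetric x v u
  vertMetric_hor (x : M) (u v) (hu : u ∈ hor x) : vertMetric x u v = 0
  vertMetric_pos (x : M) (v) (hv : v ∈ verticalSpace p d pr x) (hv0 : v ≠ 0) : 0 < vertMetric x v v
  contMDiff_vertMetric : ContMDiff (𝓡 d)
    ((𝓡 d).prod 𝓘(ℝ, EuclideanSpace ℝ (Fin d) →L[ℝ]
      EuclideanSpace ℝ (Fin d) →L[ℝ] ℝ)) ∞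
    (fun x : M => TotalSpace.mk'
      (E := fun x : M =>
        TangentSpace (𝓡 d) x →L[ℝ] TangentSpace (𝓡 d) x →L[ℝ] ℝ)
      (EuclideanSpace ℝ (Fin d) →L[ℝ] EuclideanSpace ℝ (Fin d) →L[ℝ] ℝ) x
      (vertMetric x))

variable {pr : M → Y}

/-- The projection `P_Z : TM → TZ` along `T^H M`, with values in `TZ`. -/
noncomputable def FamilyGeometry.projZ (G : FamilyGeometry p d pr) (x : M) :
    TangentSpace (𝓡 d) x →ₗ[ℝ] verticalSpace p d pr x :=
  (verticalSpace p d pr x).projectionOnto (G.hor x) (G.isCompl x)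

/-- The metric `g^Y ⊕ g^Z` on `TM = T^H M ⊕ TZ`, the metric of `Y` being lifted to `T^H M`. -/
noncomputable def FamilyGeometry.metric (G : FamilyGeometry p d pr) (x : M)
    (u v : TangentSpace (𝓡 d) x) : ℝ :=
  G.baseMetric.inner (pr x) (mfderiv (𝓡 d) (𝓡 p) pr x u) (mfderiv (𝓡 d) (𝓡 p) pr x v)
    + G.vertMetric x u v

variable (G : FamilyGeometry p d pr)
  (cov : CovariantDerivative (𝓡 d) (EuclideanSpace ℝ (Fin d))
    (TangentSpace (𝓡 d) : M → Type _))

/-- The connection `∇^Z_u V = P_Z ∇_u V` on `TZ`; here `V` is a section of `TZ`. -/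
noncomputable def FamilyGeometry.connZ (V : (x : M) → verticalSpace p d pr x) (x : M)
    (u : TangentSpace (𝓡 d) x) : verticalSpace p d pr x :=
  G.projZ x (cov (fun y => (V y : TangentSpace (𝓡 d) y)) x u)

/-- The curvature `R^Z(u, v) w = ∇^Z_U ∇^Z_V W - ∇^Z_V ∇^Z_U W - ∇^Z_{[U,V]} W` of `∇^Z`, computed
with extensions `U`, `V` of the tangent vectors `u`, `v` to vector fields that are smooth near `x`
and an extension `W` of the vertical vector `w` to a section of `TZ` that is smooth near `x`. -/
noncomputable def FamilyGeometry.curvZ (x : M) (u v : TangentSpace (𝓡 d) x)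
    (w : verticalSpace p d pr x) : verticalSpace p d pr x :=
  let U := FiberBundle.extend (EuclideanSpace ℝ (Fin d)) u
  let V := FiberBundle.extend (EuclideanSpace ℝ (Fin d)) v
  let W := fun y => G.projZ y
    (FiberBundle.extend (EuclideanSpace ℝ (Fin d)) (w : TangentSpace (𝓡 d) x) y)
  G.connZ cov (fun y => G.connZ cov W y (V y)) x u
    - G.connZ cov (fun y => G.connZ cov W y (U y)) x v
    - G.connZ cov W x (VectorField.mlieBracket (𝓡 d) U V x)

/-- The matrix of 2-forms of the curvature `R^Z` at `x` in a basis of the fiber of `TZ`; it is also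
the matrix of the curvature of the complexification of `TZ`. -/
noncomputable def FamilyGeometry.curvatureMatrix (x : M) :
    Matrix (Fin (Module.finrank ℝ (verticalSpace p d pr x)))
      (Fin (Module.finrank ℝ (verticalSpace p d pr x)))
      (EvenForms (TangentSpace (𝓡 d) x)) :=
  let b := Module.finBasis ℝ (verticalSpace p d pr x)
  Matrix.of fun i j => EvenForms.ofTwoForm fun u v => b.repr (G.curvZ cov x u v (b j)) i

end Geometry

/-!
At a point `x` the curvature matrix `R` of `∇^Z` has entries in the commutative ring of even forms,
and the statement is about power series in `q^{1/2}` over this ring. The proof does not introduce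
Chern roots or theta functions. It uses the Euler derivation `δ` of the even forms, multiplication
by `i` on forms of degree `2i` (`EvenForms.euler`), applied to the coefficients of the two series
`Φ = L̂ · ch(Θ₁)` and `Ψ = Â · ch(Θ₂)`.

With `U = (√-1/2π) R` one has `δ(e^U) = U e^U`. Newton's identity for the traces of symmetric and
exterior powers (`permSum_cons`), applied to `e^U`, expresses the logarithmic derivatives of
`ch(S_t)` and `ch(Λ_t)` through the traces `tr(U e^{rU})`, and summation over the factors of the
infinite products turns these into divisor sums. The logarithmic derivatives of `L̂` and `Â`, which
are Bernoulli series in `U`, supply the constant terms. Altogether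
`δΦ = Φ · ∑_k E_k · tr(U^{2k+2})` and `δΨ = Ψ · ∑_k E'_k · tr(U^{2k+2})`
(`hasLogDeriv_lHatForm_mul_chTheta₁`, `hasLogDeriv_aHatForm_mul_chTheta₂`), where `E_k` and `E'_k`
are, up to `(2k+1)!`, the series `2(G(τ) - 2^{2k+1} G(2τ))` and `2G(τ) - G(τ/2)` for the Eisenstein
series `G` of weight `2k+2`. The traces of the odd powers of `U` vanish, since `∇^Z` is a metric
connection and its curvature is skew.

The pair `(E_k, E'_k)` consists of modular forms of weight `2k+2` over `Γ₀(2)` and `Γ⁰(2)` exchanged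
by `S`; for `k = 0` this holds although `G` is only quasimodular, as the anomalies in the two
combinations cancel (`exists_isModularPair_eisenstein`). Comparing components of degree `2w` in the
equations for `δΦ` and `δΨ` expresses `w` times such a component through products of Eisenstein
series with components of lower degree (`HasLogDeriv.smul_part`). Hence, by induction on `w`, the
components of `Φ` and `Ψ` converge and are modular of weight `w`, and they are exchanged by `S` up
to the ratio `2^{n/2}` of the components of degree zero (`exists_modular_coeffs`).

The geometric input is that `∇^Z` preserves `g^Z`, whence `R^Z` is skew
(`FamilyGeometry.curvZ_skew`), and that `TZ` has rank `n`
(`IsSmoothFiberBundle.finrank_verticalSpace`).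
-/

set_option linter.unusedSectionVars false

/-! ### The grading of the even forms -/

section Grading

open Polynomial

variable {T : Type*} [AddCommGroup T] [Module ℝ T]

namespace EvenForms

/-- The product `a ∧ b` of two complex-valued 1-forms, as an even form. -/
noncomputable def wedge (a b : T →ₗ[ℝ] ℂ) : EvenForms T :=
  (CliffordAlgebra.even.ι (0 : QuadraticForm ℂ (T →ₗ[ℝ] ℂ))).bilin a b

theorem toForms_wedge (a b : T →ₗ[ℝ] ℂ) :
    toForms (wedge a b) = ExteriorAlgebra.ι ℂ a * ExteriorAlgebra.ι ℂ b := rfl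

theorem toForms_injective : Function.Injective (toForms : EvenForms T → Forms T) :=
  Subtype.val_injective

/-- Even forms are generated by the constants under addition and multiplication by products of two
1-forms. -/
@[elab_as_elim]
theorem induction {P : EvenForms T → Prop} (hC : ∀ r : ℂ, P (algebraMap ℂ (EvenForms T) r))
    (hadd : ∀ x y, P x → P y → P (x + y)) (hmul : ∀ a b x, P x → P (wedge a b * x))
    (x : EvenForms T) : P x := by
  obtain ⟨x, hx⟩ := x
  induction x, hx using CliffordAlgebra.even_induction with
  | algebraMap r => exact hC r
  | add x y hx hy h h' => exact hadd ⟨_, _⟩ ⟨_, _⟩ h h'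
  | ι_mul_ι_mul a b x hx h => exact hmul a b ⟨x, hx⟩ h

theorem wedge_add_left (a a' b : T →ₗ[ℝ] ℂ) : wedge (a + a') b = wedge a b + wedge a' b :=
  LinearMap.map_add₂ _ _ _ _

theorem wedge_add_right (a b b' : T →ₗ[ℝ] ℂ) : wedge a (b + b') = wedge a b + wedge a b' :=
  map_add _ _ _

theorem wedge_smul_left (c : ℂ) (a b : T →ₗ[ℝ] ℂ) : wedge (c • a) b = c • wedge a b :=
  LinearMap.map_smul₂ _ _ _ _

theorem wedge_smul_right (c : ℂ) (a b : T →ₗ[ℝ] ℂ) : wedge a (c • b) = c • wedge a b :=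
  map_smul _ _ _

theorem wedge_self (a : T →ₗ[ℝ] ℂ) : wedge a a = 0 := by
  refine toForms_injective ?_
  rw [toForms_wedge, map_zero, ExteriorAlgebra.ι_sq_zero]

theorem wedge_mul_wedge (a b c : T →ₗ[ℝ] ℂ) : wedge a b * wedge b c = 0 := by
  refine toForms_injective ?_
  rw [map_mul, toForms_wedge, toForms_wedge, map_zero, mul_assoc,
    ← mul_assoc (ExteriorAlgebra.ι ℂ b), ExteriorAlgebra.ι_sq_zero, zero_mul, mul_zero]

/-- The grading of the even forms, encoded as the coaction `η ↦ ∑ η^{(2i)} X^i`, an algebra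
homomorphism into polynomials. -/
noncomputable def grading : EvenForms T →ₐ[ℂ] (EvenForms T)[X] :=
  CliffordAlgebra.even.lift (0 : QuadraticForm ℂ (T →ₗ[ℝ] ℂ))
    { bilin := LinearMap.mk₂ ℂ (fun a b => C (wedge a b) * X)
        (fun a a' b => by rw [wedge_add_left, C_add, add_mul])
        (fun c a b => by rw [wedge_smul_left, ← smul_C, smul_mul_assoc])
        (fun a b b' => by rw [wedge_add_right, C_add, add_mul])
        (fun c a b => by rw [wedge_smul_right, ← smul_C, smul_mul_assoc])
      contract := fun a => by simp [wedge_self]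
      contract_mid := fun a b c => by
        rw [LinearMap.mk₂_apply, LinearMap.mk₂_apply,
          show C (wedge a b) * X * (C (wedge b c) * X) = C (wedge a b * wedge b c) * X ^ 2 by
            rw [C_mul]; ring, wedge_mul_wedge]
        simp }

theorem grading_wedge (a b : T →ₗ[ℝ] ℂ) : grading (wedge a b) = C (wedge a b) * X :=
  CliffordAlgebra.even.lift_ι _ _ _ _

/-- The component of degree `2 i` of an even form, as an even form. -/
noncomputable def part (i : ℕ) (η : EvenForms T) : EvenForms T := (grading η).coeff i

theorem part_add (i : ℕ) (x y : EvenForms T) : part i (x + y) = part i x + part i y := by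
  simp [part]

theorem part_smul (i : ℕ) (c : ℂ) (x : EvenForms T) : part i (c • x) = c • part i x := by
  simp [part]

theorem part_sum {κ : Type*} (i : ℕ) (s : Finset κ) (f : κ → EvenForms T) :
    part i (∑ j ∈ s, f j) = ∑ j ∈ s, part i (f j) := by
  simp [part]

theorem part_mul (k : ℕ) (x y : EvenForms T) :
    part k (x * y) = ∑ ij ∈ Finset.HasAntidiagonal.antidiagonal k, part ij.1 x * part ij.2 y := by
  simp [part, coeff_mul]

theorem part_algebraMap (i : ℕ) (r : ℂ) :
    part i (algebraMap ℂ (EvenForms T) r) = if i = 0 then algebraMap ℂ _ r else 0 := by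
  rw [part, AlgHom.commutes, IsScalarTower.algebraMap_apply ℂ (EvenForms T) (EvenForms T)[X],
    algebraMap_eq, coeff_C]

theorem part_wedge_mul_zero (a b : T →ₗ[ℝ] ℂ) (x : EvenForms T) :
    part 0 (wedge a b * x) = 0 := by
  simp [part, grading_wedge]

theorem part_wedge_mul_succ (i : ℕ) (a b : T →ₗ[ℝ] ℂ) (x : EvenForms T) :
    part (i + 1) (wedge a b * x) = wedge a b * part i x := by
  rw [part, map_mul, grading_wedge, mul_assoc, coeff_C_mul, coeff_X_mul, part]

/-- `η` is homogeneous of degree `2 i`. -/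
def IsHomogeneous (i : ℕ) (η : EvenForms T) : Prop := grading η = monomial i η

namespace IsHomogeneous

theorem mul {i j : ℕ} {x y : EvenForms T} (hx : IsHomogeneous i x) (hy : IsHomogeneous j y) :
    IsHomogeneous (i + j) (x * y) := by
  rw [IsHomogeneous] at hx hy ⊢
  rw [map_mul, hx, hy, monomial_mul_monomial]

theorem zero (i : ℕ) : IsHomogeneous i (0 : EvenForms T) := by simp [IsHomogeneous]

theorem add {i : ℕ} {x y : EvenForms T} (hx : IsHomogeneous i x) (hy : IsHomogeneous i y) :
    IsHomogeneous i (x + y) := by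
  rw [IsHomogeneous] at hx hy ⊢
  rw [map_add, hx, hy, map_add]

theorem smul {i : ℕ} {x : EvenForms T} (c : ℂ) (hx : IsHomogeneous i x) :
    IsHomogeneous i (c • x) := by
  rw [IsHomogeneous] at hx ⊢
  rw [map_smul, hx, smul_monomial]

theorem sum {κ : Type*} {i : ℕ} {s : Finset κ} {f : κ → EvenForms T}
    (h : ∀ j ∈ s, IsHomogeneous i (f j)) : IsHomogeneous i (∑ j ∈ s, f j) :=
  Finset.sum_induction f (IsHomogeneous i) (fun _ _ => add) (zero i) h

theorem of_algebraMap (r : ℂ) : IsHomogeneous 0 (algebraMap ℂ (EvenForms T) r) := by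
  rw [IsHomogeneous, AlgHom.commutes,
    IsScalarTower.algebraMap_apply ℂ (EvenForms T) (EvenForms T)[X], algebraMap_eq,
    monomial_zero_left]

theorem of_wedge (a b : T →ₗ[ℝ] ℂ) : IsHomogeneous 1 (wedge a b) := by
  rw [IsHomogeneous, grading_wedge, ← C_mul_X_pow_eq_monomial, pow_one]

theorem part_self {i : ℕ} {x : EvenForms T} (h : IsHomogeneous i x) : part i x = x := by
  rw [part, h, coeff_monomial_same]

theorem part_of_ne {i j : ℕ} {x : EvenForms T} (h : IsHomogeneous i x) (hj : j ≠ i) :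
    part j x = 0 := by
  rw [part, h, coeff_monomial_of_ne _ hj]

theorem of_part (i : ℕ) (η : EvenForms T) : IsHomogeneous i (part i η) := by
  induction η using EvenForms.induction generalizing i with
  | hC r =>
    rw [part_algebraMap]
    split_ifs with h
    · subst h; exact of_algebraMap r
    · exact zero i
  | hadd x y hx hy => rw [part_add]; exact (hx i).add (hy i)
  | hmul a b x hx =>
    cases i with
    | zero => rw [part_wedge_mul_zero]; exact zero 0
    | succ i => rw [part_wedge_mul_succ, add_comm]; exact (of_wedge a b).mul (hx i)

end IsHomogeneous

theorem isHomogeneous_ofTwoForm [FiniteDimensional ℝ T] (η : T → T → ℝ) :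
    IsHomogeneous 1 (ofTwoForm η) :=
  .smul _ <| .sum fun _ _ => .sum fun _ _ => .smul _ <| .of_wedge _ _

theorem eval_one_grading (η : EvenForms T) : (grading η).eval 1 = η := by
  induction η using EvenForms.induction with
  | hC r =>
    rw [AlgHom.commutes, IsScalarTower.algebraMap_apply ℂ (EvenForms T) (EvenForms T)[X],
      algebraMap_eq, eval_C]
  | hadd x y hx hy => rw [map_add, eval_add, hx, hy]
  | hmul a b x hx => rw [map_mul, eval_mul, hx, grading_wedge]; simp

theorem part_eq_zero_of_natDegree_lt {i : ℕ} {η : EvenForms T} (h : (grading η).natDegree < i) :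
    part i η = 0 := coeff_eq_zero_of_natDegree_lt h

theorem sum_part (η : EvenForms T) :
    ∑ i ∈ Finset.range ((grading η).natDegree + 1), part i η = η := by
  conv_rhs => rw [← eval_one_grading η, eval_eq_sum_range]
  simp [part]

theorem ext_part {x y : EvenForms T} (h : ∀ i, part i x = part i y) : x = y := by
  rw [← eval_one_grading x, ← eval_one_grading y, Polynomial.ext h]

theorem toForms_part_mem (i : ℕ) (η : EvenForms T) :
    toForms (part i η) ∈ ⋀[ℂ]^(2 * i) (T →ₗ[ℝ] ℂ) := by
  induction η using EvenForms.induction generalizing i with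
  | hC r =>
    rw [part_algebraMap]
    split_ifs with h
    · subst h
      rw [AlgHom.commutes]
      exact SetLike.algebraMap_mem_graded (fun i : ℕ => ⋀[ℂ]^i (T →ₗ[ℝ] ℂ)) r
    · rw [map_zero]; exact zero_mem _
  | hadd x y hx hy => rw [part_add, map_add]; exact add_mem (hx i) (hy i)
  | hmul a b x hx =>
    cases i with
    | zero => rw [part_wedge_mul_zero, map_zero]; exact zero_mem _
    | succ i =>
      rw [part_wedge_mul_succ, map_mul, toForms_wedge, mul_assoc,
        show 2 * (i + 1) = 1 + (1 + 2 * i) by ring]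
      have h1 (c : T →ₗ[ℝ] ℂ) : ExteriorAlgebra.ι ℂ c ∈ ⋀[ℂ]^1 (T →ₗ[ℝ] ℂ) := by
        change _ ∈ LinearMap.range _ ^ 1
        rw [pow_one]; exact LinearMap.mem_range_self _ c
      exact SetLike.mul_mem_graded (A := fun i : ℕ => ⋀[ℂ]^i (T →ₗ[ℝ] ℂ)) (h1 a)
        (SetLike.mul_mem_graded (A := fun i : ℕ => ⋀[ℂ]^i (T →ₗ[ℝ] ℂ)) (h1 b) (hx i))

/-- The components taken by the two gradings, by exterior degree and by powers of `X`, agree. -/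
theorem component_two_mul (i : ℕ) (η : EvenForms T) :
    component (2 * i) η = toForms (part i η) := by
  conv_lhs => rw [component, ← sum_part η]
  rw [map_sum, DirectSum.decompose_sum, DFinsupp.finsetSum_apply, AddSubmonoidClass.coe_finsetSum]
  have h (j : ℕ) : (DirectSum.decompose (fun i : ℕ => ⋀[ℂ]^i (T →ₗ[ℝ] ℂ)) (toForms (part j η))
      (2 * i) : Forms T) = if j = i then toForms (part i η) else 0 := by
    split_ifs with hj
    · subst hj; exact DirectSum.decompose_of_mem_same _ (toForms_part_mem j η)
    · exact DirectSum.decompose_of_mem_ne _ (toForms_part_mem j η) (by omega)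
  simp_rw [h]
  rw [Finset.sum_ite_eq']
  split_ifs with hi
  · rfl
  · rw [part_eq_zero_of_natDegree_lt (by simpa using hi), map_zero]

theorem part_zero_eq (η : EvenForms T) : part 0 η = algebraMap ℂ _ η.scalarPart := by
  induction η using EvenForms.induction with
  | hC r => simp [part_algebraMap, scalarPart]
  | hadd x y hx hy => rw [part_add, hx, hy, scalarPart, scalarPart, scalarPart]; simp
  | hmul a b x hx => simp [part_wedge_mul_zero, scalarPart, toForms_wedge,
      ExteriorAlgebra.algebraMapInv]

/-- The component of degree zero, as an algebra homomorphism. -/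
noncomputable def scalarHom : EvenForms T →ₐ[ℂ] ℂ :=
  (ExteriorAlgebra.algebraMapInv).comp toForms

theorem scalarHom_apply (η : EvenForms T) : scalarHom η = η.scalarPart := rfl

instance : Nontrivial (EvenForms T) := (scalarHom (T := T)).toRingHom.domain_nontrivial

theorem IsHomogeneous.scalarPart_eq_zero {i : ℕ} {η : EvenForms T} (h : IsHomogeneous (i + 1) η) :
    η.scalarPart = 0 := by
  have h0 := h.part_of_ne (j := 0) (by omega)
  rw [part_zero_eq] at h0
  exact (algebraMap ℂ (EvenForms T)).injective (h0.trans (map_zero _).symm)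

theorem IsHomogeneous.eq_zero [FiniteDimensional ℝ T] {i : ℕ} {η : EvenForms T}
    (h : IsHomogeneous i η) (hi : Module.finrank ℂ (T →ₗ[ℝ] ℂ) < 2 * i) : η = 0 := by
  have hm := toForms_part_mem i η
  rw [h.part_self] at hm
  have hb : ⋀[ℂ]^(2 * i) (T →ₗ[ℝ] ℂ) = ⊥ := by
    apply Submodule.finrank_eq_zero.mp
    rw [exteriorPower.finrank_eq, Nat.choose_eq_zero_of_lt hi]
  rw [hb, Submodule.mem_bot] at hm
  exact toForms_injective (hm.trans (map_zero _).symm)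

/-- There are no forms of degree above the dimension, so forms without component of degree zero are
nilpotent. -/
theorem exists_forall_isHomogeneous_eq_zero (T : Type*) [AddCommGroup T] [Module ℝ T]
    [FiniteDimensional ℝ T] :
    ∃ N, ∀ i, N ≤ i → ∀ η : EvenForms T, IsHomogeneous i η → η = 0 :=
  ⟨Module.finrank ℂ (T →ₗ[ℝ] ℂ) + 1, fun _ hi _ h => h.eq_zero (by omega)⟩

theorem isNilpotent_of_scalarPart_eq_zero [FiniteDimensional ℝ T] {η : EvenForms T}
    (h : η.scalarPart = 0) : IsNilpotent η := by
  obtain ⟨N, hN⟩ := exists_forall_isHomogeneous_eq_zero T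
  refine ⟨N, ext_part fun i => ?_⟩
  have hX : (X : (EvenForms T)[X]) ∣ grading η := by
    rw [X_dvd_iff]
    change part 0 η = 0
    rw [part_zero_eq, h, map_zero]
  rcases lt_or_ge i N with hi | hi
  · rw [show part i (0 : EvenForms T) = 0 by simp [part], part, map_pow]
    exact X_pow_dvd_iff.mp (pow_dvd_pow_of_dvd hX N) i hi
  · rw [hN i hi _ (.of_part i _), hN i hi _ (.of_part i _)]

/-- The Euler derivation: multiplication by `i` on forms of degree `2 i`. -/
noncomputable def euler : Derivation ℂ (EvenForms T) (EvenForms T) where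
  toFun x := (derivative (grading x)).eval 1
  map_add' x y := by simp
  map_smul' c x := by simp
  map_one_eq_zero' := by
    change (derivative (grading (1 : EvenForms T))).eval 1 = 0
    simp
  leibniz' x y := by
    have hx := eval_one_grading x
    have hy := eval_one_grading y
    change (derivative (grading (x * y))).eval 1 =
      x * (derivative (grading y)).eval 1 + y * (derivative (grading x)).eval 1
    rw [map_mul, derivative_mul, eval_add, eval_mul, eval_mul, hx, hy]
    ring

theorem euler_apply (x : EvenForms T) : euler x = (derivative (grading x)).eval 1 := rfl

theorem IsHomogeneous.euler_eq {i : ℕ} {x : EvenForms T} (h : IsHomogeneous i x) :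
    euler x = (i : ℂ) • x := by
  rw [euler_apply, h, derivative_monomial, eval_monomial, one_pow, mul_one, mul_comm,
    ← nsmul_eq_mul, Nat.cast_smul_eq_nsmul]

theorem part_euler (i : ℕ) (x : EvenForms T) : part i (euler x) = (i : ℂ) • part i x := by
  conv_lhs => rw [← sum_part x]
  rw [map_sum, part_sum]
  simp_rw [(IsHomogeneous.of_part _ x).euler_eq, part_smul]
  have h (j : ℕ) : part i (part j x) = if j = i then part i x else 0 := by
    split_ifs with hj
    · subst hj; exact (IsHomogeneous.of_part j x).part_self
    · exact (IsHomogeneous.of_part j x).part_of_ne (Ne.symm hj)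
  simp_rw [h, smul_ite, smul_zero]
  rw [Finset.sum_ite_eq']
  split_ifs with hi
  · rfl
  · rw [part_eq_zero_of_natDegree_lt (by simpa using hi), smul_zero]

end EvenForms

end Grading

/-! ### Power series at nilpotent elements -/

section EvalNilpotent

open PowerSeries

variable {B : Type*} [Ring B] [Algebra ℂ B]

theorem evalNilpotent_eq_sum (f : ℂ⟦X⟧) {a : B} {N : ℕ} (h : a ^ N = 0) :
    evalNilpotent f a = ∑ k ∈ Finset.range N, coeff k f • a ^ k := by
  refine Finset.sum_subset (Finset.range_mono (Nat.sInf_le h)) fun k _ hk => ?_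
  have h0 := pow_nilpotencyClass (x := a) ⟨N, h⟩
  rw [pow_eq_zero_of_le (by simpa using hk) h0, smul_zero]

theorem evalNilpotent_eq_aeval_trunc (f : ℂ⟦X⟧) {a : B} {N : ℕ} (h : a ^ N = 0) :
    evalNilpotent f a = Polynomial.aeval a (trunc N f) := by
  cases N with
  | zero =>
    rw [pow_zero] at h
    exact eq_of_zero_eq_one h.symm _ _
  | succ N =>
    rw [evalNilpotent_eq_sum f h, Polynomial.aeval_eq_sum_range' (natDegree_trunc_lt f N)]
    refine Finset.sum_congr rfl fun k hk => ?_
    rw [coeff_trunc, if_pos (by simpa using hk)]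

theorem aeval_eq_evalNilpotent (p : Polynomial ℂ) {a : B} (h : IsNilpotent a) :
    Polynomial.aeval a p = evalNilpotent (p : ℂ⟦X⟧) a := by
  obtain ⟨N, hN⟩ := h
  have h1 : a ^ (N + p.natDegree + 1) = 0 := pow_eq_zero_of_le (by omega) hN
  rw [evalNilpotent_eq_sum _ h1,
    Polynomial.aeval_eq_sum_range' (n := N + p.natDegree + 1) (by omega)]
  simp

/-- Evaluation at a nilpotent element is multiplicative in the power series. -/
theorem evalNilpotent_mul (f g : ℂ⟦X⟧) {a : B} (h : IsNilpotent a) :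
    evalNilpotent (f * g) a = evalNilpotent f a * evalNilpotent g a := by
  obtain ⟨N, hN⟩ := h
  rw [evalNilpotent_eq_aeval_trunc (f * g) hN, evalNilpotent_eq_aeval_trunc f hN,
    evalNilpotent_eq_aeval_trunc g hN, ← map_mul, aeval_eq_evalNilpotent (trunc N f * trunc N g) ⟨N, hN⟩,
    evalNilpotent_eq_aeval_trunc _ hN, Polynomial.coe_mul,
    trunc_trunc_mul_trunc]

theorem evalNilpotent_one_add_X {a : B} (h : IsNilpotent a) :
    evalNilpotent (1 + X) a = 1 + a := by
  have := aeval_eq_evalNilpotent (1 + Polynomial.X) h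
  simpa using this.symm

theorem map_evalNilpotent {B' : Type*} [Ring B'] [Algebra ℂ B'] (φ : B →ₐ[ℂ] B') (f : ℂ⟦X⟧) {a : B}
    (h : IsNilpotent a) : φ (evalNilpotent f a) = evalNilpotent f (φ a) := by
  obtain ⟨N, hN⟩ := h
  rw [evalNilpotent_eq_sum f hN, evalNilpotent_eq_sum f (N := N) (by rw [← map_pow, hN, map_zero])]
  simp

theorem evalNilpotent_zero (f : ℂ⟦X⟧) : evalNilpotent f (0 : B) = coeff 0 f • 1 := by
  rw [evalNilpotent_eq_sum f (N := 1) (by simp)]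
  simp

theorem evalNilpotent_exp_add {a b : B} (hab : Commute a b) (ha : IsNilpotent a)
    (hb : IsNilpotent b) :
    evalNilpotent (PowerSeries.exp ℂ) (a + b) =
      evalNilpotent (PowerSeries.exp ℂ) a * evalNilpotent (PowerSeries.exp ℂ) b := by
  let _ : Module ℚ B := Module.compHom B (algebraMap ℚ ℂ)
  have key (x : B) : evalNilpotent (PowerSeries.exp ℂ) x = IsNilpotent.exp x := by
    refine Finset.sum_congr rfl fun i _ => ?_
    rw [PowerSeries.coeff_exp, one_div]
    rfl
  rw [key, key, key, IsNilpotent.exp_add_of_commute hab ha hb]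

end EvalNilpotent

/-! ### Derivations of matrices -/

section DerivationMatrix

open PowerSeries

variable {A : Type*} [CommRing A] [Algebra ℂ A] (δ : Derivation ℂ A A)
variable {ι : Type*} [Fintype ι] [DecidableEq ι]

theorem Derivation.map_finset_prod {κ : Type*} [DecidableEq κ] (s : Finset κ) (g : κ → A) :
    δ (∏ i ∈ s, g i) = ∑ i ∈ s, ∏ j ∈ s, Function.update g i (δ (g i)) j := by
  induction s using Finset.induction_on with
  | empty => simp
  | insert a s ha ih =>
    rw [Finset.prod_insert ha, Derivation.leibniz, Finset.sum_insert ha, Finset.prod_insert ha,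
      Function.update_self, ih, smul_eq_mul, smul_eq_mul, add_comm, Finset.mul_sum]
    congr 1
    · rw [mul_comm]
      congr 1
      refine Finset.prod_congr rfl fun j hj => ?_
      rw [Function.update_of_ne]
      rintro rfl; exact ha hj
    · refine Finset.sum_congr rfl fun i hi => ?_
      rw [Finset.prod_insert ha, Function.update_of_ne]
      rintro rfl; exact ha hi

theorem Derivation.map_matrix_mul {κ ν : Type*} (M : Matrix ν ι A) (N : Matrix ι κ A) :
    (M * N).map δ = M.map δ * N + M * N.map δ := by
  ext i j
  simp only [Matrix.map_apply, Matrix.mul_apply, Matrix.add_apply, map_sum, Derivation.leibniz,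
    smul_eq_mul, Finset.sum_add_distrib]
  rw [add_comm]
  congr 1
  exact Finset.sum_congr rfl fun _ _ => mul_comm _ _

/-- The hypothesis `δZ = Z` on the entries makes `δ` the Euler derivation on the powers of `Z`: no
commutator terms occur, since `δZ` commutes with `Z`. -/
theorem Derivation.map_matrix_pow {Z : Matrix ι ι A} (hZ : Z.map δ = Z) (k : ℕ) :
    (Z ^ k).map δ = (k : ℂ) • Z ^ k := by
  induction k with
  | zero =>
    ext i j
    rw [pow_zero, Matrix.map_apply, Matrix.one_apply]
    split_ifs <;> simp
  | succ k ih =>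
    rw [pow_succ, Derivation.map_matrix_mul, ih, hZ, smul_mul_assoc]
    push_cast
    rw [add_smul, one_smul]

theorem Derivation.map_matrix_smul (c : ℂ) (M : Matrix ι ι A) : (c • M).map δ = c • M.map δ := by
  ext i j; simp

theorem Derivation.map_matrix_sum {κ : Type*} (s : Finset κ) (M : κ → Matrix ι ι A) :
    (∑ i ∈ s, M i).map δ = ∑ i ∈ s, (M i).map δ := by
  ext i j; simp [Matrix.sum_apply]

theorem Derivation.map_evalNilpotent {Z : Matrix ι ι A} (hZ : Z.map δ = Z) (hn : IsNilpotent Z)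
    (f : ℂ⟦X⟧) : (evalNilpotent f Z).map δ = evalNilpotent (X * d⁄dX ℂ f) Z := by
  obtain ⟨N, hN⟩ := hn
  rw [evalNilpotent_eq_sum f hN, evalNilpotent_eq_sum _ hN, Derivation.map_matrix_sum]
  refine Finset.sum_congr rfl fun k _ => ?_
  rw [Derivation.map_matrix_smul, Derivation.map_matrix_pow δ hZ, smul_smul]
  congr 1
  cases k with
  | zero => simp
  | succ k => rw [coeff_succ_X_mul, coeff_derivative]; push_cast; ring

/-- Jacobi's formula. -/
theorem Derivation.map_det (M : Matrix ι ι A) :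
    δ M.det = (M.adjugate * M.map δ).trace := by
  have h (i : ι) : (M.adjugate * M.map δ) i i = (M.updateCol i fun r => δ (M r i)).det := by
    rw [← Matrix.cramer_apply, Matrix.cramer_eq_adjugate_mulVec]
    rfl
  rw [Matrix.trace]
  simp_rw [Matrix.diag_apply, h, Matrix.det_apply']
  rw [map_sum, Finset.sum_comm]
  refine Finset.sum_congr rfl fun σ _ => ?_
  rw [Derivation.leibniz, Derivation.map_intCast, smul_zero, add_zero, Derivation.map_finset_prod,
    smul_eq_mul, Finset.mul_sum]
  refine Finset.sum_congr rfl fun i _ => ?_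
  congr 1
  refine Finset.prod_congr rfl fun j _ => ?_
  rw [Matrix.updateCol_apply, Function.update_apply]
  split_ifs with hj
  · subst hj; rfl
  · rfl

/-- If `f` has the logarithmic derivative `l` with respect to `z d/dz`, then `det f(Z)` has the
logarithmic derivative `tr l(Z)` with respect to a derivation with `δZ = Z`. -/
theorem Derivation.map_det_evalNilpotent {Z : Matrix ι ι A} (hZ : Z.map δ = Z)
    (hn : IsNilpotent Z) {f l : ℂ⟦X⟧} (hf : X * d⁄dX ℂ f = f * l) :
    δ (evalNilpotent f Z).det = (evalNilpotent f Z).det * (evalNilpotent l Z).trace := by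
  rw [Derivation.map_det, Derivation.map_evalNilpotent δ hZ hn, hf, evalNilpotent_mul _ _ hn,
    ← mul_assoc, Matrix.adjugate_mul, smul_mul_assoc, one_mul, Matrix.trace_smul, smul_eq_mul]

end DerivationMatrix

/-! ### Traces over symmetric and exterior powers -/

section PermSum

variable {A : Type*} [CommRing A] [Algebra ℂ A]
variable {ι : Type*} [Fintype ι] [DecidableEq ι]

/-- The matrix `M₀ ⊗ ⋯ ⊗ M_{k-1}`. -/
def tensorMatrix {k : ℕ} (M : Fin k → Matrix ι ι A) : Matrix (Fin k → ι) (Fin k → ι) A :=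
  Matrix.of fun f g => ∏ i, M i (f i) (g i)

theorem tensorMatrix_mul {k : ℕ} (M N : Fin k → Matrix ι ι A) :
    tensorMatrix M * tensorMatrix N = tensorMatrix (M * N) := by
  ext f g
  simp only [tensorMatrix, Matrix.mul_apply, Matrix.of_apply, Pi.mul_apply]
  rw [Finset.prod_univ_sum, Fintype.piFinset_univ]
  exact Finset.sum_congr rfl fun h _ => Finset.prod_mul_distrib.symm

theorem tensorMatrix_one (k : ℕ) : tensorMatrix (1 : Fin k → Matrix ι ι A) = 1 := by
  ext f g
  simp only [tensorMatrix, Matrix.of_apply, Pi.one_apply, Matrix.one_apply]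
  by_cases h : f = g
  · simp [h]
  · rw [if_neg h]
    obtain ⟨i, hi⟩ := Function.ne_iff.mp h
    exact Finset.prod_eq_zero (Finset.mem_univ i) (if_neg hi)

theorem tensorMatrix_update_apply {k : ℕ} (i : Fin k) (M : Matrix ι ι A) (f g : Fin k → ι) :
    tensorMatrix (Function.update 1 i M) f g =
      if ∀ j, j ≠ i → f j = g j then M (f i) (g i) else 0 := by
  rw [tensorMatrix, Matrix.of_apply, ← Finset.mul_prod_erase _ _ (Finset.mem_univ i)]
  rw [Function.update_self]
  split_ifs with h
  · rw [Finset.prod_eq_one, mul_one]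
    intro j hj
    rw [Function.update_of_ne (Finset.ne_of_mem_erase hj), h j (Finset.ne_of_mem_erase hj)]
    simp
  · push Not at h
    obtain ⟨j, hj, hfg⟩ := h
    rw [Finset.prod_eq_zero (Finset.mem_erase.mpr ⟨hj, Finset.mem_univ j⟩), mul_zero]
    rw [Function.update_of_ne hj, Pi.one_apply, Matrix.one_apply_ne hfg]

/-- The algebra homomorphism `M ↦ 1 ⊗ ⋯ ⊗ M ⊗ ⋯ ⊗ 1`, with `M` in position `i`. -/
def tensorPosition {k : ℕ} (i : Fin k) :
    Matrix ι ι A →ₐ[ℂ] Matrix (Fin k → ι) (Fin k → ι) A :=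
  AlgHom.ofLinearMap
    { toFun := fun M => tensorMatrix (Function.update 1 i M)
      map_add' := fun M N => by
        ext f g
        simp only [tensorMatrix_update_apply, Matrix.add_apply]
        split_ifs <;> simp
      map_smul' := fun c M => by
        ext f g
        simp only [tensorMatrix_update_apply, Matrix.smul_apply, RingHom.id_apply]
        split_ifs <;> simp }
    (by
      change tensorMatrix (Function.update 1 i 1) = 1
      rw [← Pi.one_apply (M := fun _ : Fin k => Matrix ι ι A) i, Function.update_eq_self,
        tensorMatrix_one])
    fun M N => by
      change tensorMatrix (Function.update 1 i (M * N)) =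
        tensorMatrix (Function.update 1 i M) * tensorMatrix (Function.update 1 i N)
      rw [tensorMatrix_mul]
      congr 1
      ext1 j
      by_cases h : j = i
      · subst h; simp
      · simp [h]

theorem tensorPosition_apply {k : ℕ} (i : Fin k) (M : Matrix ι ι A) :
    tensorPosition i M = tensorMatrix (Function.update 1 i M) := rfl

theorem tensorPosition_commute {k : ℕ} {i j : Fin k} (M : Matrix ι ι A) :
    Commute (tensorPosition i M) (tensorPosition j M) := by
  rw [Commute, SemiconjBy, tensorPosition_apply, tensorPosition_apply, tensorMatrix_mul,
    tensorMatrix_mul]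
  congr 1
  ext1 l
  by_cases hi : l = i <;> by_cases hj : l = j <;>
    simp only [Pi.mul_apply, Function.update_apply, hi, hj, if_true, if_false, Pi.one_apply,
      mul_one] <;> split_ifs <;> simp

/-- The exponential of the curvature of a tensor power is the tensor power of the exponential of the
curvature. -/
theorem evalNilpotent_exp_sum_tensorPosition {k : ℕ} {U : Matrix ι ι A} (hU : IsNilpotent U) :
    evalNilpotent (PowerSeries.exp ℂ) (∑ i : Fin k, tensorPosition i U) =
      tensorMatrix fun _ => evalNilpotent (PowerSeries.exp ℂ) U := by
  have key (s : Finset (Fin k)) :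
      evalNilpotent (PowerSeries.exp ℂ) (∑ i ∈ s, tensorPosition i U) =
        tensorMatrix fun i => if i ∈ s then evalNilpotent (PowerSeries.exp ℂ) U else 1 := by
    induction s using Finset.induction_on with
    | empty =>
      rw [Finset.sum_empty, evalNilpotent_zero]
      rw [PowerSeries.coeff_exp]
      simpa using! (tensorMatrix_one (A := A) (ι := ι) k).symm
    | insert i s hi ih =>
      rw [Finset.sum_insert hi, evalNilpotent_exp_add
        (Commute.sum_right _ _ _ fun j _ => tensorPosition_commute U) (hU.map _)
        (Commute.isNilpotent_sum (fun _ _ => hU.map _) fun _ _ _ _ => tensorPosition_commute U), ih,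
        ← map_evalNilpotent _ _ hU, tensorPosition_apply, tensorMatrix_mul]
      congr 1
      ext1 j
      by_cases h : j = i
      · subst h; simp [hi]
      · simp [h]
  simpa using key Finset.univ

/-- `∑_σ χ(sign σ) ∑_f ∏_i (M_i)_{f(σ i), f(i)}`: for trivial `χ` and constant `M` this is `k!` times
the trace of `M` on the symmetric power, for the identity `χ` that on the exterior power. -/
def permSum (χ : ℤˣ →* ℤˣ) {k : ℕ} (M : Fin k → Matrix ι ι A) : A :=
  ∑ σ : Equiv.Perm (Fin k), (((χ (Equiv.Perm.sign σ) : ℤˣ) : ℤ) : A) *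
    ∑ f : Fin k → ι, ∏ i, M i (f (σ i)) (f i)

/-- `permSum` does not depend on the order of the matrices: conjugate the permutations by `ρ`. -/
theorem permSum_comp (χ : ℤˣ →* ℤˣ) {k : ℕ} (M : Fin k → Matrix ι ι A) (ρ : Equiv.Perm (Fin k)) :
    permSum χ (M ∘ ρ) = permSum χ M := by
  unfold permSum
  refine Fintype.sum_equiv (MulAut.conj ρ).toEquiv _ _ fun σ => ?_
  congr 1
  · have h : Equiv.Perm.sign (ρ * σ * ρ⁻¹) = Equiv.Perm.sign σ := by
      rw [map_mul, map_mul, map_inv, mul_right_comm, mul_inv_cancel, one_mul]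
    rw [MulEquiv.toEquiv_eq_coe, MulEquiv.coe_toEquiv, MulAut.conj_apply, h]
  · refine Fintype.sum_equiv (Equiv.arrowCongr ρ (Equiv.refl ι)) _ _ fun f => ?_
    refine Fintype.prod_equiv ρ _ _ fun i => ?_
    simp

/-- A permutation of `k + 1` positions that fixes the first one. -/
theorem sum_prod_decomposeFin_zero {k : ℕ} (M : Fin (k + 1) → Matrix ι ι A)
    (e : Equiv.Perm (Fin k)) :
    ∑ f : Fin (k + 1) → ι, ∏ i, M i (f (Equiv.Perm.decomposeFin.symm (0, e) i)) (f i) =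
      (M 0).trace * ∑ g : Fin k → ι, ∏ i, M i.succ (g (e i)) (g i) := by
  rw [← (Fin.consEquiv fun _ => ι).sum_comp, Fintype.sum_prod_type, Matrix.trace, Finset.sum_mul]
  refine Finset.sum_congr rfl fun a _ => ?_
  rw [Finset.mul_sum]
  refine Finset.sum_congr rfl fun g _ => ?_
  rw [Fin.prod_univ_succ]
  simp [Fin.consEquiv]

/-- A permutation of `k + 1` positions that does not fix the first one: summing over the value of `f`
there multiplies the first matrix with that of its predecessor on the cycle. -/
theorem sum_prod_decomposeFin_succ {k : ℕ} (M : Fin (k + 1) → Matrix ι ι A)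
    (e : Equiv.Perm (Fin k)) (x : Fin k) :
    ∑ f : Fin (k + 1) → ι, ∏ i, M i (f (Equiv.Perm.decomposeFin.symm ((e x).succ, e) i)) (f i) =
      ∑ g : Fin k → ι, ∏ i, Function.update (fun j => M j.succ) x (M 0 * M x.succ) i
        (g (e i)) (g i) := by
  rw [← (Fin.consEquiv fun _ => ι).sum_comp, Fintype.sum_prod_type, Finset.sum_comm]
  refine Finset.sum_congr rfl fun g _ => ?_
  rw [← Finset.mul_prod_erase _ _ (Finset.mem_univ x), Function.update_self, Matrix.mul_apply,
    Finset.sum_mul]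
  refine Finset.sum_congr rfl fun a _ => ?_
  rw [Fin.prod_univ_succ, ← Finset.mul_prod_erase _ _ (Finset.mem_univ x), ← mul_assoc]
  congr 1
  · simp [Fin.consEquiv]
  · refine Finset.prod_congr rfl fun j hj => ?_
    have hj' := Finset.ne_of_mem_erase hj
    rw [Function.update_of_ne hj', Equiv.Perm.decomposeFin_symm_apply_succ,
      Equiv.swap_apply_of_ne_of_ne (Fin.succ_ne_zero _)
        (by rw [Ne, Fin.succ_inj, e.injective.eq_iff]; exact hj')]
    simp [Fin.consEquiv]

/-- Expansion of `permSum` along the cycle through the first position: either this position is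
fixed, or it can be merged with its predecessor `x` on the cycle. -/
theorem permSum_succ (χ : ℤˣ →* ℤˣ) {k : ℕ} (M : Fin (k + 1) → Matrix ι ι A) :
    permSum χ M = (M 0).trace * permSum χ (fun i => M i.succ) +
      (((χ (-1) : ℤˣ) : ℤ) : A) *
        ∑ x, permSum χ (Function.update (fun j => M j.succ) x (M 0 * M x.succ)) := by
  unfold permSum
  rw [← Equiv.Perm.decomposeFin.symm.sum_comp, Fintype.sum_prod_type, Fin.sum_univ_succ]
  congr 1
  · rw [Finset.mul_sum]
    refine Finset.sum_congr rfl fun e _ => ?_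
    rw [sum_prod_decomposeFin_zero, Equiv.Perm.decomposeFin.symm_sign, if_pos rfl, one_mul]
    ring
  · rw [Finset.sum_comm]
    conv_rhs => rw [Finset.sum_comm, Finset.mul_sum]
    refine Finset.sum_congr rfl fun e _ => ?_
    rw [← Equiv.sum_comp e, Finset.mul_sum]
    refine Finset.sum_congr rfl fun x _ => ?_
    rw [sum_prod_decomposeFin_succ, Equiv.Perm.decomposeFin.symm_sign,
      if_neg (Fin.succ_ne_zero _), map_mul]
    push_cast
    ring

theorem permSum_update_const (χ : ℤˣ →* ℤˣ) {k : ℕ} (E N : Matrix ι ι A) (x : Fin (k + 1)) :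
    permSum χ (Function.update (fun _ : Fin (k + 1) => E) x N) =
      permSum χ (Fin.cons N fun _ : Fin k => E) := by
  rw [← permSum_comp χ _ (Equiv.swap 0 x)]
  congr 1
  ext1 j
  rw [Function.comp_apply, Function.update_apply]
  by_cases h : j = 0
  · subst h; simp
  · obtain ⟨i, rfl⟩ := Fin.exists_succ_eq.mpr h
    rw [Fin.cons_succ, if_neg]
    rw [Equiv.swap_apply_eq_iff, Equiv.swap_apply_right]
    exact h

theorem permSum_cons_succ (χ : ℤˣ →* ℤˣ) {k : ℕ} (E N : Matrix ι ι A) :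
    permSum χ (Fin.cons N fun _ : Fin (k + 1) => E) =
      N.trace * permSum χ (fun _ : Fin (k + 1) => E) +
        (((χ (-1) : ℤˣ) : ℤ) : A) * ((k + 1 : ℕ) *
          permSum χ (Fin.cons (N * E) fun _ : Fin k => E)) := by
  rw [permSum_succ]
  simp only [Fin.cons_zero, Fin.cons_succ, permSum_update_const, Finset.sum_const,
    Finset.card_univ, Fintype.card_fin, nsmul_eq_mul]

theorem permSum_cons_zero (χ : ℤˣ →* ℤˣ) (E N : Matrix ι ι A) :
    permSum χ (Fin.cons N fun _ : Fin 0 => E) = N.trace * permSum χ (fun _ : Fin 0 => E) := by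
  rw [permSum_succ]
  simp

/-- With one distinguished matrix `N` among copies of `E`, summation over the length of the cycle
through `N`. This is Newton's identity for the traces of symmetric and exterior powers. -/
theorem permSum_cons (χ : ℤˣ →* ℤˣ) (k : ℕ) (E N : Matrix ι ι A) :
    (k.factorial : ℂ)⁻¹ • permSum χ (Fin.cons N fun _ : Fin k => E) =
      ∑ rs ∈ Finset.HasAntidiagonal.antidiagonal k,
        ((((χ (-1) : ℤˣ) : ℤ) : A) ^ rs.1 * (N * E ^ rs.1).trace) *
          ((rs.2.factorial : ℂ)⁻¹ • permSum χ (fun _ : Fin rs.2 => E)) := by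
  induction k generalizing N with
  | zero => simp [permSum_cons_zero]
  | succ k ih =>
    rw [permSum_cons_succ, Finset.Nat.antidiagonal_succ, Finset.sum_cons, Finset.sum_map, smul_add]
    congr 1
    · simp
    · have hk : ((k + 1).factorial : ℂ)⁻¹ • ((((χ (-1) : ℤˣ) : ℤ) : A) * ((k + 1 : ℕ) *
          permSum χ (Fin.cons (N * E) fun _ : Fin k => E))) = (((χ (-1) : ℤˣ) : ℤ) : A) *
          ((k.factorial : ℂ)⁻¹ • permSum χ (Fin.cons (N * E) fun _ : Fin k => E)) := by
        rw [← nsmul_eq_mul (k + 1), ← Nat.cast_smul_eq_nsmul ℂ, mul_smul_comm, mul_smul_comm,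
          smul_smul, Nat.factorial_succ]
        congr 1
        have : ((k + 1 : ℕ) : ℂ) ≠ 0 := Nat.cast_ne_zero.mpr (Nat.succ_ne_zero k)
        push_cast at this ⊢
        field_simp
      rw [hk, ih, Finset.mul_sum]
      refine Finset.sum_congr rfl fun rs _ => ?_
      change _ = _ ^ (rs.1 + 1) * (N * E ^ (rs.1 + 1)).trace * _
      rw [pow_succ', pow_succ' E, mul_assoc N, mul_assoc, mul_assoc, mul_assoc]
      rfl

theorem Derivation.map_permSum (δ : Derivation ℂ A A) (χ : ℤˣ →* ℤˣ) {k : ℕ}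
    (M : Fin k → Matrix ι ι A) :
    δ (permSum χ M) = ∑ x, permSum χ (Function.update M x ((M x).map δ)) := by
  unfold permSum
  rw [Finset.sum_comm, map_sum]
  refine Finset.sum_congr rfl fun σ _ => ?_
  rw [Derivation.leibniz, Derivation.map_intCast, smul_zero, add_zero, smul_eq_mul, map_sum,
    ← Finset.mul_sum, Finset.sum_comm]
  congr 1
  refine Finset.sum_congr rfl fun f _ => ?_
  rw [Derivation.map_finset_prod]
  refine Finset.sum_congr rfl fun x _ => ?_
  refine Finset.prod_congr rfl fun j _ => ?_
  by_cases h : j = x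
  · subst h; simp
  · simp [h]

theorem Derivation.map_permSum_const (δ : Derivation ℂ A A) (χ : ℤˣ →* ℤˣ) (k : ℕ)
    {E U : Matrix ι ι A} (hE : E.map δ = U * E) :
    δ (((k + 1).factorial : ℂ)⁻¹ • permSum χ (fun _ : Fin (k + 1) => E)) =
      ∑ rs ∈ Finset.HasAntidiagonal.antidiagonal k,
        ((((χ (-1) : ℤˣ) : ℤ) : A) ^ rs.1 * (U * E ^ (rs.1 + 1)).trace) *
          ((rs.2.factorial : ℂ)⁻¹ • permSum χ (fun _ : Fin rs.2 => E)) := by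
  rw [map_smul, Derivation.map_permSum]
  simp only [hE, permSum_update_const, Finset.sum_const, Finset.card_univ, Fintype.card_fin]
  have hk : ((k + 1).factorial : ℂ)⁻¹ • ((k + 1) • permSum χ (Fin.cons (U * E) fun _ : Fin k => E))
      = (k.factorial : ℂ)⁻¹ • permSum χ (Fin.cons (U * E) fun _ : Fin k => E) := by
    rw [← Nat.cast_smul_eq_nsmul ℂ, smul_smul, Nat.factorial_succ]
    congr 1
    have : ((k + 1 : ℕ) : ℂ) ≠ 0 := Nat.cast_ne_zero.mpr (Nat.succ_ne_zero k)
    push_cast at this ⊢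
    field_simp
  rw [hk, permSum_cons]
  refine Finset.sum_congr rfl fun rs _ => ?_
  rw [mul_assoc U, ← pow_succ']

end PermSum

/-! ### Hyperbolic power series -/

section Hyperbolic

open PowerSeries

theorem exp_eq_cosh_add : PowerSeries.exp ℂ = coshSeries + X * sinhDivSeries := by
  ext k
  rw [map_add, PowerSeries.coeff_exp, coshSeries, sinhDivSeries, coeff_mk]
  cases k with
  | zero => simp
  | succ k =>
    rw [coeff_succ_X_mul, coeff_mk]
    rcases Nat.even_or_odd k with h | h
    · rw [if_neg (by simpa [Nat.even_add_one] using h), if_pos h]; simp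
    · rw [if_pos (by simpa [Nat.even_add_one] using h), if_neg (by simpa using h)]; simp

theorem rescale_neg_exp_eq_cosh_sub :
    rescale (-1 : ℂ) (PowerSeries.exp ℂ) = coshSeries - X * sinhDivSeries := by
  ext k
  rw [map_sub, coeff_rescale, PowerSeries.coeff_exp, coshSeries, sinhDivSeries, coeff_mk]
  cases k with
  | zero => simp
  | succ k =>
    rw [coeff_succ_X_mul, coeff_mk]
    rcases Nat.even_or_odd k with h | h
    · rw [if_neg (by simpa [Nat.even_add_one] using h), if_pos h, pow_succ, h.neg_one_pow]; simp
    · rw [if_pos (by simpa [Nat.even_add_one] using h), if_neg (by simpa using h), pow_succ,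
        h.neg_one_pow]
      simp

theorem powerSeries_two_ne_zero : (2 : ℂ⟦X⟧) ≠ 0 := fun h => by
  have h' := congrArg constantCoeff h
  rw [map_ofNat, map_zero] at h'
  exact two_ne_zero h'

theorem rescale_two_cosh :
    rescale (2 : ℂ) coshSeries = coshSeries ^ 2 + X ^ 2 * sinhDivSeries ^ 2 ∧
      rescale (2 : ℂ) sinhDivSeries = coshSeries * sinhDivSeries := by
  have h1 := exp_pow_eq_rescale_exp (A := ℂ) 2
  have h2 : rescale (-1 : ℂ) (PowerSeries.exp ℂ) ^ 2 =
      rescale (2 : ℂ) (rescale (-1 : ℂ) (PowerSeries.exp ℂ)) := by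
    rw [← map_pow, h1, rescale_rescale, rescale_rescale, mul_comm]
    simp
  rw [rescale_neg_exp_eq_cosh_sub] at h2
  rw [exp_eq_cosh_add] at h1
  simp only [map_add, map_sub, map_mul, rescale_X, Nat.cast_ofNat, map_ofNat] at h1 h2
  have hX : (4 * X : ℂ⟦X⟧) ≠ 0 := by
    rw [show (4 * X : ℂ⟦X⟧) = 2 * (2 * X) by ring]
    exact mul_ne_zero powerSeries_two_ne_zero (mul_ne_zero powerSeries_two_ne_zero X_ne_zero)
  constructor
  · refine mul_left_cancel₀ powerSeries_two_ne_zero ?_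
    linear_combination -h1 - h2
  · refine mul_left_cancel₀ hX ?_
    linear_combination -h1 + h2

theorem X_mul_derivative_sinhDiv :
    X * d⁄dX ℂ sinhDivSeries = coshSeries - sinhDivSeries := by
  ext k
  cases k with
  | zero => simp [coshSeries, sinhDivSeries]
  | succ k =>
    rw [coeff_succ_X_mul, coeff_derivative, map_sub, sinhDivSeries, coshSeries, coeff_mk, coeff_mk]
    split_ifs
    · rw [Nat.factorial_succ (k + 1)]
      have h1 : ((k + 1 + 1 : ℕ) : ℂ) ≠ 0 := Nat.cast_ne_zero.mpr (by omega)
      have h2 : ((k + 1).factorial : ℂ) ≠ 0 := Nat.cast_ne_zero.mpr (Nat.factorial_ne_zero _)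
      push_cast at h1 ⊢
      field_simp
      ring
    · simp

theorem derivative_cosh : d⁄dX ℂ coshSeries = X * sinhDivSeries := by
  ext k
  rw [coeff_derivative, coshSeries, sinhDivSeries, coeff_mk]
  cases k with
  | zero => simp
  | succ k =>
    rw [coeff_succ_X_mul, coeff_mk]
    by_cases h : Even k
    · rw [if_pos h, if_pos (by simpa [Nat.even_add_one] using h), Nat.factorial_succ (k + 1)]
      have h1 : ((k + 1 + 1 : ℕ) : ℂ) ≠ 0 := Nat.cast_ne_zero.mpr (by omega)
      have h2 : ((k + 1).factorial : ℂ) ≠ 0 := Nat.cast_ne_zero.mpr (Nat.factorial_ne_zero _)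
      push_cast at h1 ⊢
      field_simp
    · rw [if_neg h, if_neg (by simpa [Nat.even_add_one] using h), zero_mul]

/-- The Taylor series of `z coth z`. -/
noncomputable def cothSeries : ℂ⟦X⟧ := coshSeries * sinhDivSeries⁻¹

theorem sinhDiv_mul_inv : sinhDivSeries * sinhDivSeries⁻¹ = 1 :=
  PowerSeries.mul_inv_cancel _ (by simp [sinhDivSeries, ← coeff_zero_eq_constantCoeff_apply])

theorem cothSeries_mul_sinhDiv : cothSeries * sinhDivSeries = coshSeries := by
  rw [cothSeries]
  linear_combination coshSeries * sinhDiv_mul_inv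

theorem sinhDivSeries_ne_zero : sinhDivSeries ≠ 0 := by
  intro h
  have := sinhDiv_mul_inv
  rw [h, zero_mul] at this
  exact zero_ne_one this

/-- `z coth z = ∑ 4^j B_{2j} z^{2j} / (2j)!`. -/
theorem coeff_cothSeries (k : ℕ) :
    coeff k cothSeries = if Even k then 2 ^ k * (bernoulli k : ℂ) / k.factorial else 0 := by
  suffices h : cothSeries = rescale (2 : ℂ) (bernoulliPowerSeries ℂ) + X by
    rw [h, map_add, coeff_rescale, bernoulliPowerSeries, coeff_mk, coeff_X]
    split_ifs with h1 h2 h2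
    · subst h1; exact absurd h2 (by decide)
    · subst h1; norm_num [bernoulli_one]
    · simp [mul_div_assoc]
    · rw [bernoulli_eq_zero_of_odd (by simpa using h2) (by
        have : k ≠ 0 := by rintro rfl; simp at h2
        omega)]
      simp
  have hB := congrArg (rescale (2 : ℂ)) (bernoulliPowerSeries_mul_exp_sub_one (A := ℂ))
  have h1 := exp_pow_eq_rescale_exp (A := ℂ) 2
  simp only [map_sub, map_mul, rescale_X, Nat.cast_ofNat, map_ofNat, map_one] at hB h1
  rw [← h1] at hB
  have h2 := exp_mul_exp_neg_eq_one (A := ℂ)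
  rw [evalNegHom, rescale_neg_exp_eq_cosh_sub] at h2
  have h3 := exp_eq_cosh_add
  have hX : (2 * X * sinhDivSeries : ℂ⟦X⟧) ≠ 0 :=
    mul_ne_zero (mul_ne_zero powerSeries_two_ne_zero X_ne_zero) sinhDivSeries_ne_zero
  refine mul_left_cancel₀ hX ?_
  have hc := cothSeries_mul_sinhDiv
  set B := rescale (2 : ℂ) (bernoulliPowerSeries ℂ)
  set e := PowerSeries.exp ℂ
  -- multiply the identity for `B` by `e^{-X}`
  have h4 : B * (2 * X * sinhDivSeries) = 2 * X * (coshSeries - X * sinhDivSeries) := by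
    linear_combination (coshSeries - X * sinhDivSeries) * hB - B * e * h2 - B * h3
  linear_combination 2 * X * hc - h4

/-- The duplication formula `2z coth(2z) · z coth z = (z coth z)² + z²`. -/
theorem rescale_two_cothSeries_mul :
    rescale (2 : ℂ) cothSeries * cothSeries = cothSeries ^ 2 + X ^ 2 := by
  have h := congrArg (rescale (2 : ℂ)) cothSeries_mul_sinhDiv
  rw [map_mul, rescale_two_cosh.1, rescale_two_cosh.2] at h
  refine mul_right_cancel₀ (pow_ne_zero 2 sinhDivSeries_ne_zero) ?_
  rw [← cothSeries_mul_sinhDiv] at h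
  linear_combination h

/-- The logarithmic derivative of `z / sinh z`, the function of the Chern roots defining `Â`. -/
theorem X_mul_derivative_inv_sinhDiv :
    X * d⁄dX ℂ sinhDivSeries⁻¹ = sinhDivSeries⁻¹ * (1 - cothSeries) := by
  rw [derivative_inv', cothSeries]
  linear_combination -(sinhDivSeries⁻¹) ^ 2 * X_mul_derivative_sinhDiv +
    sinhDivSeries⁻¹ * sinhDiv_mul_inv

/-- The logarithmic derivative of `z / tanh z`, which defines `L̂`, through the duplication formula. -/
theorem X_mul_derivative_cothSeries :
    X * d⁄dX ℂ cothSeries = cothSeries * (1 + rescale (2 : ℂ) cothSeries - 2 * cothSeries) := by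
  have h : d⁄dX ℂ cothSeries =
      coshSeries * d⁄dX ℂ sinhDivSeries⁻¹ + sinhDivSeries⁻¹ * d⁄dX ℂ coshSeries := by
    rw [cothSeries, Derivation.leibniz, smul_eq_mul, smul_eq_mul]
  rw [h, derivative_cosh]
  have h1 := X_mul_derivative_inv_sinhDiv
  have h2 := rescale_two_cothSeries_mul
  have h3 : coshSeries * sinhDivSeries⁻¹ = cothSeries := rfl
  linear_combination coshSeries * h1 + X ^ 2 * sinhDiv_mul_inv - h2 + (1 - cothSeries) * h3

end Hyperbolic

/-! ### Logarithmic derivatives of power series -/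

section LogDeriv

open PowerSeries

variable {A : Type*} [CommRing A] [Algebra ℂ A] (δ : Derivation ℂ A A)

/-- A derivation of `A`, applied to the coefficients of a power series. -/
noncomputable def coeffDeriv (F : A⟦X⟧) : A⟦X⟧ := mk fun n => δ (coeff n F)

theorem coeff_coeffDeriv (F : A⟦X⟧) (n : ℕ) : coeff n (coeffDeriv δ F) = δ (coeff n F) :=
  coeff_mk _ _

theorem coeffDeriv_mul (F G : A⟦X⟧) :
    coeffDeriv δ (F * G) = coeffDeriv δ F * G + F * coeffDeriv δ G := by
  ext n
  rw [coeff_coeffDeriv, map_add, coeff_mul, coeff_mul, coeff_mul, map_sum,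
    ← Finset.sum_add_distrib]
  refine Finset.sum_congr rfl fun ij _ => ?_
  rw [Derivation.leibniz, coeff_coeffDeriv, coeff_coeffDeriv, smul_eq_mul, smul_eq_mul]
  ring

/-- `L` is a logarithmic derivative of `F`, for a derivation acting on the coefficients. -/
def HasLogDeriv (F L : A⟦X⟧) : Prop := coeffDeriv δ F = F * L

variable {δ}

namespace HasLogDeriv

theorem mul {F G L K : A⟦X⟧} (hF : HasLogDeriv δ F L) (hG : HasLogDeriv δ G K) :
    HasLogDeriv δ (F * G) (L + K) := by
  rw [HasLogDeriv] at hF hG ⊢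
  rw [coeffDeriv_mul, hF, hG]
  ring

theorem one : HasLogDeriv δ (1 : A⟦X⟧) 0 := by
  ext n
  rw [coeff_coeffDeriv, coeff_one]
  split_ifs <;> simp

theorem const {a l : A} (h : δ a = a * l) : HasLogDeriv δ (C a : A⟦X⟧) (C l) := by
  ext n
  rw [coeff_coeffDeriv, ← map_mul, coeff_C, coeff_C]
  split_ifs <;> simp [h]

theorem prod {F L : ℕ → A⟦X⟧} (h : ∀ j, HasLogDeriv δ (F j) (L j)) (J : ℕ) :
    HasLogDeriv δ (∏ j ∈ Finset.range J, F j) (∑ j ∈ Finset.range J, L j) := by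
  induction J with
  | zero => simpa using one
  | succ J ih => rw [Finset.prod_range_succ, Finset.sum_range_succ]; exact ih.mul (h J)

theorem invOfUnit {F : A⟦X⟧} (h : HasLogDeriv δ F 0) (hF : constantCoeff F = 1) :
    HasLogDeriv δ (invOfUnit F 1) 0 := by
  have h1 : F * PowerSeries.invOfUnit F 1 = 1 := mul_invOfUnit F 1 (by simpa using hF)
  have h2 := congrArg (coeffDeriv δ) h1
  have h3 : coeffDeriv δ (1 : A⟦X⟧) = 0 := by simpa [HasLogDeriv] using one (δ := δ)
  rw [HasLogDeriv, mul_zero] at h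
  rw [coeffDeriv_mul, h, zero_mul, zero_add, h3] at h2
  rw [HasLogDeriv, mul_zero]
  linear_combination PowerSeries.invOfUnit F 1 * h2 - coeffDeriv δ (PowerSeries.invOfUnit F 1) * h1

end HasLogDeriv

theorem coeff_subst_neg_X_pow {m : ℕ} (hm : m ≠ 0) (F : A⟦X⟧) (n : ℕ) :
    coeff n (F.subst (-X ^ m : A⟦X⟧)) = if m ∣ n then (-1) ^ (n / m) * coeff (n / m) F else 0 := by
  have hs : HasSubst (-X ^ m : A⟦X⟧) := HasSubst.of_constantCoeff_zero' (by simp [hm])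
  have hc (d : ℕ) : coeff n ((-X ^ m : A⟦X⟧) ^ d) = if n = m * d then (-1) ^ d else 0 := by
    rw [neg_pow, ← pow_mul, show ((-1 : A⟦X⟧) ^ d) = C ((-1 : A) ^ d) by simp, coeff_C_mul,
      coeff_X_pow]
    simp
  rw [coeff_subst' hs]
  split_ifs with h
  · obtain ⟨d, rfl⟩ := h
    rw [Nat.mul_div_cancel_left _ (Nat.pos_of_ne_zero hm), finsum_eq_single _ d]
    · rw [hc, if_pos rfl, smul_eq_mul, mul_comm]
    · intro e he
      rw [hc, if_neg, smul_zero]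
      intro h'
      exact he (Nat.eq_of_mul_eq_mul_left (Nat.pos_of_ne_zero hm) h').symm
  · refine finsum_eq_zero_of_forall_eq_zero fun d => ?_
    rw [hc, if_neg, smul_zero]
    rintro rfl
    exact h (dvd_mul_right _ _)

theorem HasLogDeriv.subst_X_pow {m : ℕ} (hm : m ≠ 0) {F L : A⟦X⟧} (h : HasLogDeriv δ F L) :
    HasLogDeriv δ (F.subst (X ^ m : A⟦X⟧)) (L.subst (X ^ m : A⟦X⟧)) := by
  rw [HasLogDeriv] at h ⊢
  rw [← subst_mul (HasSubst.X_pow hm), ← h]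
  ext n
  rw [coeff_coeffDeriv, coeff_subst_X_pow hm, coeff_subst_X_pow hm, coeff_coeffDeriv]
  split_ifs <;> simp

theorem HasLogDeriv.subst_neg_X_pow {m : ℕ} (hm : m ≠ 0) {F L : A⟦X⟧} (h : HasLogDeriv δ F L) :
    HasLogDeriv δ (F.subst (-X ^ m : A⟦X⟧)) (L.subst (-X ^ m : A⟦X⟧)) := by
  rw [HasLogDeriv] at h ⊢
  rw [← subst_mul (HasSubst.of_constantCoeff_zero' (by simp [hm])), ← h]
  ext n
  rw [coeff_coeffDeriv, coeff_subst_neg_X_pow hm, coeff_subst_neg_X_pow hm, coeff_coeffDeriv]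
  split_ifs
  · rcases neg_one_pow_eq_or A (n / m) with h1 | h1 <;> simp [h1]
  · simp

theorem coeff_mul_of_coeff_eq_one {P F : A⟦X⟧} {J n : ℕ} (hn : n ≤ J)
    (hF : ∀ i, i ≤ J → coeff i F = coeff i (1 : A⟦X⟧)) : coeff n (P * F) = coeff n P := by
  conv_rhs => rw [← mul_one P]
  rw [coeff_mul, coeff_mul]
  refine Finset.sum_congr rfl fun ij h => ?_
  have h' := Finset.HasAntidiagonal.mem_antidiagonal.mp h
  rw [hF ij.2 (by omega)]

theorem coeff_prod_range_eq {F : ℕ → A⟦X⟧}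
    (hF : ∀ j n, n ≤ j → coeff n (F j) = coeff n (1 : A⟦X⟧)) {n J : ℕ} (h : n < J) :
    coeff n (∏ j ∈ Finset.range J, F j) = coeff n (formalProd F) := by
  rw [formalProd, coeff_mk]
  induction J, h using Nat.le_induction with
  | base => rfl
  | succ J hJ ih =>
    rw [Finset.prod_range_succ, coeff_mul_of_coeff_eq_one (J := J) (by omega) (hF J), ih]

/-- The hypotheses say that the `j`-th factor is `1 + O(X^{j+1})`, so that each coefficient only
involves finitely many factors. -/
theorem HasLogDeriv.formalProd {F L : ℕ → A⟦X⟧} (h : ∀ j, HasLogDeriv δ (F j) (L j))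
    (hF : ∀ j n, n ≤ j → coeff n (F j) = coeff n (1 : A⟦X⟧))
    (hL : ∀ j n, n ≤ j → coeff n (L j) = 0) :
    HasLogDeriv δ (formalProd F) (mk fun N => ∑ j ∈ Finset.range (N + 1), coeff N (L j)) := by
  ext N
  rw [coeff_coeffDeriv, ← coeff_prod_range_eq hF (Nat.lt_succ_self N)]
  have h1 := congrArg (coeff N) (HasLogDeriv.prod h (N + 1))
  rw [coeff_coeffDeriv] at h1
  rw [Nat.succ_eq_add_one, h1, coeff_mul, coeff_mul]
  refine Finset.sum_congr rfl fun ij hij => ?_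
  have h3 := Finset.HasAntidiagonal.mem_antidiagonal.mp hij
  rw [coeff_prod_range_eq hF (by omega), coeff_mk, map_sum]
  congr 1
  refine (Finset.sum_subset (Finset.range_mono (by omega)) fun j _ hj => ?_).symm
  exact hL j ij.2 (by simp at hj; omega)

end LogDeriv

/-! ### Chern characters of symmetric and exterior powers -/

section PermSeries

open PowerSeries

variable {A : Type*} [CommRing A] [Algebra ℂ A]
variable {ι : Type*} [Fintype ι] [DecidableEq ι]

/-- The generating series of the traces of the symmetric (for trivial `χ`) or exterior (for the
identity `χ`) powers of `E`. -/
noncomputable def permSeries (χ : ℤˣ →* ℤˣ) (E : Matrix ι ι A) : A⟦X⟧ :=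
  mk fun k => (k.factorial : ℂ)⁻¹ • permSum χ fun _ : Fin k => E

theorem constantCoeff_permSeries (χ : ℤˣ →* ℤˣ) (E : Matrix ι ι A) :
    constantCoeff (permSeries χ E) = 1 := by
  rw [← coeff_zero_eq_constantCoeff_apply, permSeries, coeff_mk]
  simp [permSum]

/-- The logarithmic derivative of `permSeries χ E` for a derivation with `δE = U E`. -/
noncomputable def permLogDeriv (χ : ℤˣ →* ℤˣ) (U E : Matrix ι ι A) : A⟦X⟧ :=
  mk fun k => if k = 0 then 0 else (((χ (-1) : ℤˣ) : ℤ) : A) ^ (k - 1) * (U * E ^ k).trace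

/-- The generating series form of Newton's identity `permSum_cons`. -/
theorem hasLogDeriv_permSeries {δ : Derivation ℂ A A} (χ : ℤˣ →* ℤˣ) {U E : Matrix ι ι A}
    (hE : E.map δ = U * E) : HasLogDeriv δ (permSeries χ E) (permLogDeriv χ U E) := by
  ext k
  rw [coeff_coeffDeriv, mul_comm, coeff_mul]
  cases k with
  | zero => simp [permSeries, permLogDeriv, permSum]
  | succ k =>
    rw [permSeries, coeff_mk, Derivation.map_permSum_const δ χ k hE,
      Finset.Nat.antidiagonal_succ, Finset.sum_cons, Finset.sum_map]
    rw [permLogDeriv, coeff_mk, if_pos rfl, zero_mul, zero_add]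
    refine Finset.sum_congr rfl fun rs _ => ?_
    change _ = coeff (rs.1 + 1) _ * coeff rs.2 _
    rw [coeff_mk, coeff_mk, if_neg (Nat.succ_ne_zero _), Nat.add_sub_cancel]

theorem map_permSeries {A' : Type*} [CommRing A'] [Algebra ℂ A'] (s : A →ₐ[ℂ] A') (χ : ℤˣ →* ℤˣ)
    (E : Matrix ι ι A) :
    PowerSeries.map (s : A →+* A') (permSeries χ E) = permSeries χ (E.map s) := by
  ext k
  rw [coeff_map, permSeries, permSeries, coeff_mk, coeff_mk, AlgHom.coe_toRingHom, map_smul]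
  simp [permSum]

/-- The series `permSeries χ E`, divided by the one of the identity matrix of the same size, that is,
of the trivial bundle. -/
noncomputable def permSeriesReduced (χ : ℤˣ →* ℤˣ) (E : Matrix ι ι A) : A⟦X⟧ :=
  permSeries χ E * invOfUnit (permSeries χ (1 : Matrix ι ι A)) 1

/-- The normalising factor has constant coefficients and does not contribute. -/
theorem hasLogDeriv_permSeriesReduced {δ : Derivation ℂ A A} (χ : ℤˣ →* ℤˣ) {U E : Matrix ι ι A}
    (hE : E.map δ = U * E) : HasLogDeriv δ (permSeriesReduced χ E) (permLogDeriv χ U E) := by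
  have h1 : HasLogDeriv δ (permSeries χ (1 : Matrix ι ι A)) 0 := by
    have h : (1 : Matrix ι ι A).map δ = 0 * 1 := by
      ext i j
      rw [Matrix.map_apply, Matrix.one_apply]
      split_ifs <;> simp
    have h' := hasLogDeriv_permSeries (δ := δ) χ h
    have h0 : permLogDeriv χ (0 : Matrix ι ι A) 1 = 0 := by
      ext k; simp [permLogDeriv]
    rwa [h0] at h'
  have := (hasLogDeriv_permSeries χ hE).mul (h1.invOfUnit (constantCoeff_permSeries χ _))
  rwa [add_zero] at this

theorem map_permSeriesReduced (s : A →ₐ[ℂ] ℂ) (χ : ℤˣ →* ℤˣ) {E : Matrix ι ι A}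
    (hE : E.map s = 1) : PowerSeries.map (s : A →+* ℂ) (permSeriesReduced χ E) = 1 := by
  have h1 : permSeries χ (1 : Matrix ι ι A) * invOfUnit (permSeries χ (1 : Matrix ι ι A)) 1 = 1 :=
    mul_invOfUnit _ 1 (by simpa using constantCoeff_permSeries χ (1 : Matrix ι ι A))
  have h2 : (1 : Matrix ι ι A).map s = 1 := Matrix.map_one _ (map_zero s) (map_one s)
  rw [permSeriesReduced, map_mul, map_permSeries, hE, ← h2, ← map_permSeries, ← map_mul, h1,
    map_one]

theorem constantCoeff_permSeriesReduced (χ : ℤˣ →* ℤˣ) (E : Matrix ι ι A) :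
    constantCoeff (permSeriesReduced χ E) = 1 := by
  rw [permSeriesReduced, map_mul, constantCoeff_permSeries, constantCoeff_invOfUnit]
  simp

/-- The trace over a symmetrized tensor power, as a sum over permutations. -/
theorem trace_permutation_mul_tensorMatrix {k : ℕ} (c : ℂ) (w : Equiv.Perm (Fin k) → A)
    (M : Fin k → Matrix ι ι A) :
    ((Matrix.of fun f g : Fin k → ι => c • ∑ σ : Equiv.Perm (Fin k),
      if f ∘ σ = g then w σ else 0) * tensorMatrix M).trace =
      c • ∑ σ, w σ * ∑ f : Fin k → ι, ∏ i, M i (f (σ i)) (f i) := by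
  rw [Matrix.trace]
  simp only [Matrix.diag_apply, Matrix.mul_apply, Matrix.of_apply, smul_mul_assoc,
    Finset.sum_mul, ← Finset.smul_sum]
  congr 1
  rw [Finset.sum_congr rfl fun f _ => Finset.sum_comm, Finset.sum_comm]
  refine Finset.sum_congr rfl fun σ _ => ?_
  rw [Finset.mul_sum]
  refine Finset.sum_congr rfl fun f _ => ?_
  simp [ite_mul, tensorMatrix]

end PermSeries

section ChernCharacter

open PowerSeries

variable {T : Type*} [AddCommGroup T] [Module ℝ T]
variable {ι : Type*} [Fintype ι] [DecidableEq ι]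

theorem chernExp_tensorCurvature {R : Matrix ι ι (EvenForms T)} (hR : IsNilpotent R) (k : ℕ) :
    chernExp (tensorCurvature k R) = tensorMatrix fun _ : Fin k => chernExp R := by
  have hU : IsNilpotent ((Complex.I / (2 * Real.pi)) • R) := hR.smul _
  have h : (Complex.I / (2 * Real.pi)) • tensorCurvature k R =
      ∑ i : Fin k, tensorPosition i ((Complex.I / (2 * Real.pi)) • R) := by
    ext f g
    rw [Matrix.smul_apply, tensorCurvature, Matrix.of_apply, Matrix.sum_apply, Finset.smul_sum]
    refine Finset.sum_congr rfl fun i _ => ?_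
    rw [tensorPosition_apply, tensorMatrix_update_apply]
    split_ifs <;> simp
  rw [chernExp, h, evalNilpotent_exp_sum_tensorPosition hU]
  rfl

/-- The symmetric powers are the case of trivial `χ`. -/
theorem chSym_eq {R : Matrix ι ι (EvenForms T)} (hR : IsNilpotent R) :
    chSym R = permSeries 1 (chernExp R) := by
  ext k
  rw [chSym, permSeries, coeff_mk, coeff_mk, chernExp_tensorCurvature hR, symmetrizer,
    trace_permutation_mul_tensorMatrix _ fun _ => 1, permSum]
  simp

/-- The exterior powers are the case of the identity `χ`. -/
theorem chExt_eq {R : Matrix ι ι (EvenForms T)} (hR : IsNilpotent R) :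
    chExt R = permSeries (MonoidHom.id _) (chernExp R) := by
  ext k
  rw [chExt, permSeries, coeff_mk, coeff_mk, chernExp_tensorCurvature hR, antisymmetrizer,
    trace_permutation_mul_tensorMatrix _ fun σ => (((Equiv.Perm.sign σ : ℤˣ) : ℤ) : EvenForms T),
    permSum]
  rfl

theorem chernExp_zero : chernExp (0 : Matrix ι ι (EvenForms T)) = 1 := by
  rw [chernExp, smul_zero, evalNilpotent_zero, PowerSeries.coeff_exp]
  simp

theorem chSymReduced_eq {R : Matrix ι ι (EvenForms T)} (hR : IsNilpotent R) :
    chSymReduced R = permSeriesReduced 1 (chernExp R) := by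
  rw [chSymReduced, chSym_eq hR, chSym_eq IsNilpotent.zero, chernExp_zero, permSeriesReduced]

theorem chExtReduced_eq {R : Matrix ι ι (EvenForms T)} (hR : IsNilpotent R) :
    chExtReduced R = permSeriesReduced (MonoidHom.id _) (chernExp R) := by
  rw [chExtReduced, chExt_eq hR, chExt_eq IsNilpotent.zero, chernExp_zero, permSeriesReduced]

end ChernCharacter

/-! ### Divisor sums -/

section DivisorSums

variable {A : Type*} [AddCommGroup A]

theorem sum_divisors_even (g : ℕ → A) {N : ℕ} (hN : N ≠ 0) :
    ∑ r ∈ N.divisors with Even r, g r =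
      if 2 ∣ N then ∑ r ∈ (N / 2).divisors, g (2 * r) else 0 := by
  split_ifs with h
  · obtain ⟨M, rfl⟩ := h
    rw [Nat.mul_div_cancel_left _ two_pos]
    symm
    refine Finset.sum_nbij (fun r => 2 * r) ?_ ?_ ?_ fun _ _ => rfl
    · intro r hr
      simp only [Finset.mem_filter, Nat.mem_divisors] at hr ⊢
      exact ⟨⟨mul_dvd_mul_left 2 hr.1, hN⟩, even_two_mul r⟩
    · intro r _ s _ hrs
      simpa using hrs
    · intro r hr
      simp only [Finset.coe_filter, Nat.mem_divisors, Set.mem_ofPred_eq] at hr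
      obtain ⟨⟨h1, _⟩, h2⟩ := hr
      obtain ⟨s, rfl⟩ := h2.two_dvd
      refine ⟨s, ?_, rfl⟩
      simp only [Finset.mem_coe, Nat.mem_divisors]
      exact ⟨(Nat.mul_dvd_mul_iff_left two_pos).mp h1, by omega⟩
  · rw [Finset.filter_false_of_mem, Finset.sum_empty]
    intro r hr he
    exact h (he.two_dvd.trans (Nat.dvd_of_mem_divisors hr))

theorem sum_range_two_mul_dvd (g : ℕ → A) {N : ℕ} (hN : N ≠ 0) :
    ∑ j ∈ Finset.range (N + 1), (if 2 * (j + 1) ∣ N then g (N / (2 * (j + 1))) else 0) =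
      if 2 ∣ N then ∑ r ∈ (N / 2).divisors, g r else 0 := by
  split_ifs with h
  · obtain ⟨M, rfl⟩ := h
    rw [Nat.mul_div_cancel_left _ two_pos, ← Nat.sum_div_divisors, ← Finset.sum_filter]
    refine Finset.sum_nbij (fun j => j + 1) ?_ ?_ ?_ ?_
    · intro j hj
      simp only [Finset.mem_filter, Finset.mem_range, Nat.mem_divisors] at hj ⊢
      exact ⟨(Nat.mul_dvd_mul_iff_left two_pos).mp hj.2, by omega⟩
    · intro i _ j _ hij
      simpa using hij
    · intro d hd
      simp only [Finset.mem_coe, Nat.mem_divisors] at hd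
      have hd0 : d ≠ 0 := by rintro rfl; exact hd.2 (zero_dvd_iff.mp hd.1)
      have hle := Nat.le_of_dvd (Nat.pos_of_ne_zero hd.2) hd.1
      refine ⟨d - 1, ?_, by simp; omega⟩
      simp only [Finset.coe_filter, Finset.mem_range, Set.mem_ofPred_eq]
      rw [show d - 1 + 1 = d by omega]
      exact ⟨by omega, mul_dvd_mul_left 2 hd.1⟩
    · intro j _
      rw [Nat.mul_div_mul_left _ _ two_pos]
  · refine Finset.sum_eq_zero fun j _ => if_neg fun hj => h ((dvd_mul_right 2 _).trans hj)

theorem sum_range_odd_dvd (g : ℕ → A) {N : ℕ} (hN : N ≠ 0) :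
    ∑ j ∈ Finset.range (N + 1), (if 2 * j + 1 ∣ N then g (N / (2 * j + 1)) else 0) =
      ∑ r ∈ N.divisors, g r - if 2 ∣ N then ∑ r ∈ (N / 2).divisors, g r else 0 := by
  rw [← Nat.sum_div_divisors N g, ← Finset.sum_filter_add_sum_filter_not N.divisors (fun r => Even r),
    sum_divisors_even _ hN]
  have h1 : (if 2 ∣ N then ∑ r ∈ (N / 2).divisors, g (N / (2 * r)) else 0) =
      if 2 ∣ N then ∑ r ∈ (N / 2).divisors, g r else 0 := by
    split_ifs with h
    · rw [← Nat.sum_div_divisors (N / 2) g]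
      exact Finset.sum_congr rfl fun r _ => by rw [Nat.div_div_eq_div_mul]
    · rfl
  rw [h1, add_sub_cancel_left, ← Finset.sum_filter]
  refine Finset.sum_nbij (fun j => 2 * j + 1) ?_ ?_ ?_ fun _ _ => rfl
  · intro j hj
    simp only [Finset.mem_filter, Finset.mem_range, Nat.mem_divisors, Nat.not_even_iff_odd] at hj ⊢
    exact ⟨⟨hj.2, hN⟩, odd_two_mul_add_one j⟩
  · intro i _ j _ hij
    simpa using hij
  · intro d hd
    simp only [Finset.coe_filter, Nat.mem_divisors, Nat.not_even_iff_odd, Set.mem_ofPred_eq] at hd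
    obtain ⟨⟨hd, _⟩, j, rfl⟩ := hd
    have hle := Nat.le_of_dvd (Nat.pos_of_ne_zero hN) hd
    refine ⟨j, ?_, rfl⟩
    simp only [Finset.coe_filter, Finset.mem_range, Set.mem_ofPred_eq]
    exact ⟨by omega, hd⟩

/-- Re-indexing of `∑ a_M q^M` as a series in `q^{1/2}`; on series in `q^{1/2}`, the substitution
`τ ↦ 2τ`. -/
def doubleIndex (a : ℕ → ℂ) (N : ℕ) : ℂ := if 2 ∣ N then a (N / 2) else 0

/-- The coefficients of the Eisenstein series `-B_{2k+2}/(4k+4) + ∑ σ_{2k+1}(N) q^N` of weight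
`2k+2`. -/
noncomputable def eisensteinCoeff (k N : ℕ) : ℂ :=
  if N = 0 then -(bernoulli (2 * k + 2) : ℂ) / (4 * (k + 1))
  else (ArithmeticFunction.sigma (2 * k + 1) N : ℂ)

/-- The coefficients of the series `2 (G(τ) - 2^{2k+1} G(2τ))` in `q^{1/2}`, divided by `(2k+1)!`,
where `G` is the Eisenstein series of `eisensteinCoeff k`. -/
noncomputable def eisensteinCoeff₁ (k N : ℕ) : ℂ :=
  ((2 * k + 1).factorial : ℂ)⁻¹ * (2 * (doubleIndex (eisensteinCoeff k) N -
    2 ^ (2 * k + 1) * doubleIndex (doubleIndex (eisensteinCoeff k)) N))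

/-- The coefficients of the series `2 G(τ) - G(τ/2)` in `q^{1/2}`, divided by `(2k+1)!`, where `G` is
the Eisenstein series of `eisensteinCoeff k`. -/
noncomputable def eisensteinCoeff₂ (k N : ℕ) : ℂ :=
  ((2 * k + 1).factorial : ℂ)⁻¹ *
    (2 * doubleIndex (eisensteinCoeff k) N - eisensteinCoeff k N)

end DivisorSums

/-! ### Logarithmic derivatives of the two characteristic series -/

section CharacteristicSeries

open PowerSeries

variable {A : Type*} [CommRing A] [Algebra ℂ A]
variable {ι : Type*} [Fintype ι] [DecidableEq ι]

theorem evalNilpotent_X {B : Type*} [Ring B] [Algebra ℂ B] {a : B} (h : IsNilpotent a) :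
    evalNilpotent X a = a := by
  have := aeval_eq_evalNilpotent Polynomial.X h
  simpa using this.symm

theorem evalNilpotent_exp_pow {B : Type*} [Ring B] [Algebra ℂ B] {a : B} (h : IsNilpotent a)
    (r : ℕ) : evalNilpotent (PowerSeries.exp ℂ) a ^ r =
      evalNilpotent (rescale (r : ℂ) (PowerSeries.exp ℂ)) a := by
  rw [← exp_pow_eq_rescale_exp]
  induction r with
  | zero =>
    have := aeval_eq_evalNilpotent 1 h
    simpa using this
  | succ r ih => rw [pow_succ, pow_succ, ih, evalNilpotent_mul _ _ h]

theorem sum_range_two_mul_of_even_eq_zero {M : Type*} [AddCommMonoid M] (f : ℕ → M) (K : ℕ)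
    (h : ∀ k, f (2 * k) = 0) :
    ∑ j ∈ Finset.range (2 * K), f j = ∑ k ∈ Finset.range K, f (2 * k + 1) := by
  induction K with
  | zero => simp
  | succ K ih =>
    rw [show 2 * (K + 1) = 2 * K + 1 + 1 by ring, Finset.sum_range_succ, Finset.sum_range_succ, ih,
      h, add_zero, Finset.sum_range_succ]

/-- `tr(U e^{rU})` in terms of the traces of the even powers of `U`. -/
theorem trace_mul_exp_pow {U : Matrix ι ι A} {K : ℕ} (hK : U ^ (2 * K) = 0)
    (hodd : ∀ k, (U ^ (2 * k + 1)).trace = 0) (r : ℕ) :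
    (U * evalNilpotent (PowerSeries.exp ℂ) U ^ r).trace = ∑ k ∈ Finset.range K,
      ((((2 * k + 1).factorial : ℂ)⁻¹) * (r : ℂ) ^ (2 * k + 1)) • (U ^ (2 * k + 2)).trace := by
  rw [evalNilpotent_exp_pow ⟨_, hK⟩, evalNilpotent_eq_sum _ hK, Finset.mul_sum, Matrix.trace_sum,
    sum_range_two_mul_of_even_eq_zero]
  · refine Finset.sum_congr rfl fun k _ => ?_
    rw [mul_smul_comm, Matrix.trace_smul, ← pow_succ', coeff_rescale, PowerSeries.coeff_exp,
      mul_comm]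
    simp
  · intro k
    rw [mul_smul_comm, Matrix.trace_smul, ← pow_succ', hodd, smul_zero]

theorem sum_divisors_smul_pow (p : ℕ → A) (K M : ℕ) (t : ℕ → A)
    (ht : ∀ r, t r = ∑ k ∈ Finset.range K,
      ((((2 * k + 1).factorial : ℂ)⁻¹) * (r : ℂ) ^ (2 * k + 1)) • p k) :
    ∑ r ∈ M.divisors, t r = ∑ k ∈ Finset.range K,
      ((((2 * k + 1).factorial : ℂ)⁻¹) * (ArithmeticFunction.sigma (2 * k + 1) M : ℂ)) • p k := by
  simp_rw [ht]
  rw [Finset.sum_comm]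
  refine Finset.sum_congr rfl fun k _ => ?_
  rw [← Finset.sum_smul, ← Finset.mul_sum, ArithmeticFunction.sigma_apply]
  push_cast
  rfl

theorem sum_divisors_two_mul_smul_pow (p : ℕ → A) (K M : ℕ) (t : ℕ → A)
    (ht : ∀ r, t r = ∑ k ∈ Finset.range K,
      ((((2 * k + 1).factorial : ℂ)⁻¹) * (r : ℂ) ^ (2 * k + 1)) • p k) :
    ∑ r ∈ M.divisors, t (2 * r) = ∑ k ∈ Finset.range K,
      ((((2 * k + 1).factorial : ℂ)⁻¹) *
        (2 ^ (2 * k + 1) * (ArithmeticFunction.sigma (2 * k + 1) M : ℂ))) • p k := by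
  simp_rw [ht]
  rw [Finset.sum_comm]
  refine Finset.sum_congr rfl fun k _ => ?_
  rw [← Finset.sum_smul, ← Finset.mul_sum, ArithmeticFunction.sigma_apply]
  push_cast
  simp_rw [Finset.mul_sum, mul_pow]

variable (U : Matrix ι ι A)

/-- The logarithmic derivative of `ch(Θ₁)`, for a matrix `U` that plays the role of `(√-1/2π) R`. -/
noncomputable def thetaLogDeriv₁ : A⟦X⟧ :=
  (mk fun N => ∑ j ∈ Finset.range (N + 1), coeff N
    ((permLogDeriv 1 U (evalNilpotent (PowerSeries.exp ℂ) U)).subst (X ^ (2 * (j + 1)) : A⟦X⟧))) +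
  mk fun N => ∑ j ∈ Finset.range (N + 1), coeff N
    ((permLogDeriv (MonoidHom.id _) U (evalNilpotent (PowerSeries.exp ℂ) U)).subst
      (X ^ (2 * (j + 1)) : A⟦X⟧))

/-- The logarithmic derivative of `ch(Θ₂)`, for a matrix `U` that plays the role of `(√-1/2π) R`. -/
noncomputable def thetaLogDeriv₂ : A⟦X⟧ :=
  (mk fun N => ∑ j ∈ Finset.range (N + 1), coeff N
    ((permLogDeriv 1 U (evalNilpotent (PowerSeries.exp ℂ) U)).subst (X ^ (2 * (j + 1)) : A⟦X⟧))) +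
  mk fun N => ∑ j ∈ Finset.range (N + 1), coeff N
    ((permLogDeriv (MonoidHom.id _) U (evalNilpotent (PowerSeries.exp ℂ) U)).subst
      (-X ^ (2 * j + 1) : A⟦X⟧))

theorem coeff_zero_permLogDeriv (χ : ℤˣ →* ℤˣ) (U E : Matrix ι ι A) :
    coeff 0 (permLogDeriv χ U E) = 0 := by
  rw [permLogDeriv, coeff_mk, if_pos rfl]

theorem coeff_zero_thetaLogDeriv₁ : coeff 0 (thetaLogDeriv₁ U) = 0 := by
  rw [thetaLogDeriv₁, map_add, coeff_mk, coeff_mk]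
  simp [coeff_subst_X_pow, coeff_zero_permLogDeriv, -coeff_zero_eq_constantCoeff]

theorem coeff_zero_thetaLogDeriv₂ : coeff 0 (thetaLogDeriv₂ U) = 0 := by
  rw [thetaLogDeriv₂, map_add, coeff_mk, coeff_mk]
  simp [coeff_subst_X_pow, coeff_subst_neg_X_pow, coeff_zero_permLogDeriv,
    -coeff_zero_eq_constantCoeff]

variable {U}

/-- The symmetric and exterior factors contribute `tr(U e^{rU})` with signs `1` and `(-1)^{r-1}` for each
divisor `r`; only odd `r` survive, twice. -/
theorem coeff_thetaLogDeriv₁ {K : ℕ} (hK : U ^ (2 * K) = 0)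
    (hodd : ∀ k, (U ^ (2 * k + 1)).trace = 0) {N : ℕ} (hN : N ≠ 0) :
    coeff N (thetaLogDeriv₁ U) =
      ∑ k ∈ Finset.range K, eisensteinCoeff₁ k N • (U ^ (2 * k + 2)).trace := by
  set p : ℕ → A := fun k => (U ^ (2 * k + 2)).trace
  set t : ℕ → A := fun r => (U * evalNilpotent (PowerSeries.exp ℂ) U ^ r).trace
  have ht := trace_mul_exp_pow hK hodd
  rw [thetaLogDeriv₁, map_add, coeff_mk, coeff_mk, ← Finset.sum_add_distrib]
  have h1 (j : ℕ) : coeff N ((permLogDeriv 1 U (evalNilpotent (PowerSeries.exp ℂ) U)).subst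
        (X ^ (2 * (j + 1)) : A⟦X⟧)) +
      coeff N ((permLogDeriv (MonoidHom.id _) U (evalNilpotent (PowerSeries.exp ℂ) U)).subst
        (X ^ (2 * (j + 1)) : A⟦X⟧)) =
      if 2 * (j + 1) ∣ N then (fun r => if Even r then 0 else (2 : A) * t r) (N / (2 * (j + 1)))
        else 0 := by
    rw [coeff_subst_X_pow (by omega), coeff_subst_X_pow (by omega)]
    split_ifs with h
    · have h0 : N / (2 * (j + 1)) ≠ 0 :=
        Nat.div_ne_zero_iff.mpr ⟨by omega, Nat.le_of_dvd (Nat.pos_of_ne_zero hN) h⟩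
      rw [permLogDeriv, permLogDeriv, coeff_mk, coeff_mk, if_neg h0, if_neg h0]
      obtain ⟨r, hr⟩ := Nat.exists_eq_succ_of_ne_zero h0
      rw [hr]
      change _ = if Even (r + 1) then 0 else 2 * (U * evalNilpotent (PowerSeries.exp ℂ) U ^ (r+1)).trace
      rcases Nat.even_or_odd r with h2 | h2
      · rw [if_neg (by simpa [Nat.even_add_one] using h2)]
        simp [h2.neg_one_pow]
        ring
      · rw [if_pos (by simpa [Nat.even_add_one] using h2)]
        simp [h2.neg_one_pow]
    · simp
  rw [Finset.sum_congr rfl fun j _ => h1 j,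
    sum_range_two_mul_dvd (fun r => if Even r then 0 else (2 : A) * t r) hN]
  simp only [eisensteinCoeff₁, doubleIndex]
  by_cases h : 2 ∣ N
  · simp only [if_pos h]
    have hM : N / 2 ≠ 0 := by omega
    have h2 : ∑ r ∈ (N / 2).divisors, (if Even r then 0 else (2 : A) * t r) =
        2 * (∑ r ∈ (N / 2).divisors, t r - ∑ r ∈ (N / 2).divisors with Even r, t r) := by
      rw [Finset.sum_filter, ← Finset.sum_sub_distrib, Finset.mul_sum]
      refine Finset.sum_congr rfl fun r _ => ?_
      split_ifs <;> simp
    rw [h2, sum_divisors_even _ hM, sum_divisors_smul_pow p K _ t ht]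
    by_cases h4 : 2 ∣ N / 2
    · have hM4 : N / 2 / 2 ≠ 0 := by omega
      rw [if_pos h4, sum_divisors_two_mul_smul_pow p K _ t ht, ← Finset.sum_sub_distrib,
        Finset.mul_sum]
      refine Finset.sum_congr rfl fun k _ => ?_
      rw [if_pos h4, eisensteinCoeff, eisensteinCoeff, if_neg hM, if_neg hM4, ← sub_smul, two_mul, ← two_smul ℂ,
        smul_smul]
      congr 1
      ring
    · rw [if_neg h4, sub_zero, Finset.mul_sum]
      refine Finset.sum_congr rfl fun k _ => ?_
      rw [if_neg h4, eisensteinCoeff, if_neg hM, two_mul, ← two_smul ℂ, smul_smul]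
      congr 1
      ring
  · simp [h]

/-- The exterior factors at `-q^{j-1/2}` contribute `-tr(U e^{rU})` for the divisors `r` with odd
complementary divisor. -/
theorem coeff_thetaLogDeriv₂ {K : ℕ} (hK : U ^ (2 * K) = 0)
    (hodd : ∀ k, (U ^ (2 * k + 1)).trace = 0) {N : ℕ} (hN : N ≠ 0) :
    coeff N (thetaLogDeriv₂ U) =
      ∑ k ∈ Finset.range K, eisensteinCoeff₂ k N • (U ^ (2 * k + 2)).trace := by
  set p : ℕ → A := fun k => (U ^ (2 * k + 2)).trace
  set t : ℕ → A := fun r => (U * evalNilpotent (PowerSeries.exp ℂ) U ^ r).trace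
  have ht := trace_mul_exp_pow hK hodd
  rw [thetaLogDeriv₂, map_add, coeff_mk, coeff_mk]
  have h1 (j : ℕ) : coeff N ((permLogDeriv 1 U (evalNilpotent (PowerSeries.exp ℂ) U)).subst
        (X ^ (2 * (j + 1)) : A⟦X⟧)) =
      if 2 * (j + 1) ∣ N then t (N / (2 * (j + 1))) else 0 := by
    rw [coeff_subst_X_pow (by omega)]
    split_ifs with h
    · have h0 : N / (2 * (j + 1)) ≠ 0 :=
        Nat.div_ne_zero_iff.mpr ⟨by omega, Nat.le_of_dvd (Nat.pos_of_ne_zero hN) h⟩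
      rw [permLogDeriv, coeff_mk, if_neg h0]
      simp [t]
    · simp
  have h2 (j : ℕ) : coeff N ((permLogDeriv (MonoidHom.id _) U
        (evalNilpotent (PowerSeries.exp ℂ) U)).subst (-X ^ (2 * j + 1) : A⟦X⟧)) =
      if 2 * j + 1 ∣ N then (fun r => -t r) (N / (2 * j + 1)) else 0 := by
    rw [coeff_subst_neg_X_pow (by omega)]
    split_ifs with h
    · have h0 : N / (2 * j + 1) ≠ 0 :=
        Nat.div_ne_zero_iff.mpr ⟨by omega, Nat.le_of_dvd (Nat.pos_of_ne_zero hN) h⟩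
      rw [permLogDeriv, coeff_mk, if_neg h0]
      obtain ⟨r, hr⟩ := Nat.exists_eq_succ_of_ne_zero h0
      rw [hr]
      change _ = -(U * evalNilpotent (PowerSeries.exp ℂ) U ^ (r+1)).trace
      rcases neg_one_pow_eq_or A r with h3 | h3 <;> simp [pow_succ (-1 : A), h3]
    · rfl
  rw [Finset.sum_congr rfl fun j _ => h1 j, Finset.sum_congr rfl fun j _ => h2 j,
    sum_range_two_mul_dvd t hN, sum_range_odd_dvd (fun r => -t r) hN]
  simp only [Finset.sum_neg_distrib, sum_divisors_smul_pow p K _ t ht, eisensteinCoeff₂,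
    doubleIndex, eisensteinCoeff, if_neg hN]
  by_cases h : 2 ∣ N
  · have hM : N / 2 ≠ 0 := by omega
    simp only [if_pos h, if_neg hM]
    rw [← Finset.sum_neg_distrib, ← Finset.sum_neg_distrib, ← Finset.sum_sub_distrib,
      ← Finset.sum_add_distrib]
    refine Finset.sum_congr rfl fun k _ => ?_
    rw [← _root_.neg_smul, ← _root_.neg_smul, ← sub_smul, ← add_smul]
    congr 1
    ring
  · simp only [if_neg h]
    rw [zero_add, sub_zero, ← Finset.sum_neg_distrib]
    refine Finset.sum_congr rfl fun k _ => ?_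
    rw [← _root_.neg_smul]
    congr 1
    ring

end CharacteristicSeries

/-! ### The characteristic forms `Â` and `L̂` -/

section CharacteristicForms

open PowerSeries

variable {T : Type*} [AddCommGroup T] [Module ℝ T] [FiniteDimensional ℝ T]

namespace EvenForms

theorem scalarPart_mul (x y : EvenForms T) :
    (x * y).scalarPart = x.scalarPart * y.scalarPart := map_mul scalarHom x y

theorem scalarPart_smul (c : ℂ) (x : EvenForms T) :
    (c • x).scalarPart = c * x.scalarPart := map_smul scalarHom c x

theorem scalarPart_evalNilpotent (f : ℂ⟦X⟧) {x : EvenForms T} (h : x.scalarPart = 0) :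
    (evalNilpotent f x).scalarPart = coeff 0 f := by
  rw [← scalarHom_apply, map_evalNilpotent _ _ (isNilpotent_of_scalarPart_eq_zero h),
    scalarHom_apply, h, evalNilpotent_zero, smul_eq_mul, mul_one]

theorem isUnit_of_scalarPart_ne_zero {x : EvenForms T} (h : x.scalarPart ≠ 0) : IsUnit x := by
  have h1 : (x - algebraMap ℂ _ x.scalarPart).scalarPart = 0 := by
    rw [← scalarHom_apply, map_sub, AlgHom.commutes, scalarHom_apply]
    simp
  have h2 := (isNilpotent_of_scalarPart_eq_zero h1).isUnit_add_left_of_commute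
    ((IsUnit.mk0 _ h).map (algebraMap ℂ (EvenForms T))) (Commute.all _ _)
  rwa [add_sub_cancel] at h2

theorem scalarPart_inv_smul_sub_one {η : EvenForms T} (h : η.scalarPart ≠ 0) :
    (η.scalarPart⁻¹ • η - 1).scalarPart = 0 := by
  rw [← scalarHom_apply, map_sub, map_smul, map_one, scalarHom_apply, smul_eq_mul,
    inv_mul_cancel₀ h, sub_self]

theorem sqrt_mul_self {η : EvenForms T} (h : η.scalarPart ≠ 0) : η.sqrt * η.sqrt = η := by
  have hn := isNilpotent_of_scalarPart_eq_zero (scalarPart_inv_smul_sub_one h)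
  rw [sqrt, smul_mul_smul_comm, ← evalNilpotent_mul _ _ hn, ← PowerSeries.binomialSeries_add,
    ← Complex.cpow_add _ _ h]
  have h1 : PowerSeries.binomialSeries ℂ (1 / 2 + 1 / 2 : ℚ) = 1 + X := by
    have := PowerSeries.binomialSeries_nat (R := ℚ) (A := ℂ) 1
    rw [pow_one] at this
    rw [← this]
    norm_num
  rw [h1, evalNilpotent_one_add_X hn, add_sub_cancel, smul_smul]
  norm_num
  rw [mul_inv_cancel₀ h, one_smul]

theorem scalarPart_sqrt {η : EvenForms T} (h : η.scalarPart ≠ 0) :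
    η.sqrt.scalarPart = η.scalarPart ^ (1 / 2 : ℂ) := by
  rw [sqrt, scalarPart_smul, scalarPart_evalNilpotent _ (scalarPart_inv_smul_sub_one h)]
  simp

theorem euler_sqrt {η : EvenForms T} (h : η.scalarPart ≠ 0)
    {l : EvenForms T} (hl : euler η = η * l) :
    euler η.sqrt = η.sqrt * ((1 / 2 : ℂ) • l) := by
  have hu : IsUnit η.sqrt := by
    refine isUnit_of_mul_isUnit_left (y := η.sqrt) ?_
    rw [sqrt_mul_self h]
    exact isUnit_of_scalarPart_ne_zero h
  have h1 : euler (η.sqrt * η.sqrt) = η.sqrt * η.sqrt * l := by rw [sqrt_mul_self h, hl]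
  rw [Derivation.leibniz, smul_eq_mul, ← two_mul, mul_assoc] at h1
  have h2 : (2 : EvenForms T) * euler η.sqrt = η.sqrt * l :=
    hu.mul_left_cancel (by linear_combination h1)
  have h3 : euler η.sqrt = (1 / 2 : ℂ) • ((2 : EvenForms T) * euler η.sqrt) := by
    rw [two_mul, ← two_smul ℂ, smul_smul]; norm_num
  rw [h3, h2, mul_smul_comm]

end EvenForms

open EvenForms

variable {ι : Type*} [Fintype ι] [DecidableEq ι]

theorem isHomogeneous_matrix_pow {R : Matrix ι ι (EvenForms T)}
    (hR : ∀ i j, IsHomogeneous 1 (R i j)) (k : ℕ) (i j : ι) : IsHomogeneous k ((R ^ k) i j) := by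
  induction k generalizing i j with
  | zero =>
    rw [pow_zero, Matrix.one_apply]
    split_ifs
    · simpa using IsHomogeneous.of_algebraMap (T := T) 1
    · exact .zero 0
  | succ k ih =>
    rw [pow_succ, Matrix.mul_apply]
    exact .sum fun l _ => (ih i l).mul (hR l j)

theorem exists_matrix_pow_eq_zero {R : Matrix ι ι (EvenForms T)}
    (hR : ∀ i j, IsHomogeneous 1 (R i j)) : ∃ N, R ^ N = 0 := by
  obtain ⟨N, hN⟩ := exists_forall_isHomogeneous_eq_zero T
  exact ⟨N, Matrix.ext fun i j => hN N le_rfl _ (isHomogeneous_matrix_pow hR N i j)⟩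

theorem scalarPart_det_evalNilpotent (f : ℂ⟦X⟧) {R : Matrix ι ι (EvenForms T)}
    (hR : ∀ i j, IsHomogeneous 1 (R i j)) :
    (evalNilpotent f R).det.scalarPart = coeff 0 f ^ Fintype.card ι := by
  have h0 : (scalarHom (T := T)).mapMatrix R = 0 := by
    ext i j
    exact (hR i j).scalarPart_eq_zero
  rw [← scalarHom_apply, AlgHom.map_det,
    map_evalNilpotent _ _ (exists_matrix_pow_eq_zero hR), h0, evalNilpotent_zero, Matrix.det_smul,
    Matrix.det_one, mul_one]

theorem map_euler_of_isHomogeneous {R : Matrix ι ι (EvenForms T)}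
    (hR : ∀ i j, IsHomogeneous 1 (R i j)) : R.map euler = R := by
  ext i j
  rw [Matrix.map_apply, (hR i j).euler_eq, Nat.cast_one, one_smul]

/-- The constant terms of the logarithmic derivatives of the characteristic forms: a power series
`l` in the Chern roots, evaluated on `½ U`, in terms of the traces of the even powers of `U`. -/
theorem trace_evalNilpotent_half {A : Type*} [CommRing A] [Algebra ℂ A] {U : Matrix ι ι A} {K : ℕ}
    (hK : U ^ (2 * K) = 0) {l : ℂ⟦X⟧} (h0 : coeff 0 l = 0)
    (hl : ∀ k, coeff (2 * k + 1) l = 0) :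
    (evalNilpotent l ((1 / 2 : ℂ) • U)).trace = ∑ k ∈ Finset.range K,
      (coeff (2 * k + 2) l * (1 / 2) ^ (2 * k + 2)) • (U ^ (2 * k + 2)).trace := by
  have hZ : ((1 / 2 : ℂ) • U) ^ (2 * K + 1) = 0 := by
    rw [smul_pow, pow_succ U, hK, zero_mul, smul_zero]
  rw [evalNilpotent_eq_sum _ hZ, Finset.sum_range_succ', h0, zero_smul, add_zero, Matrix.trace_sum,
    sum_range_two_mul_of_even_eq_zero]
  · refine Finset.sum_congr rfl fun k _ => ?_
    rw [smul_pow, smul_smul, Matrix.trace_smul]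
  · intro k
    rw [hl, zero_smul, Matrix.trace_zero]

variable {R : Matrix ι ι (EvenForms T)}

/-- The logarithmic derivative of `L̂` supplies exactly the constant terms of the Eisenstein series
`eisensteinCoeff₁` that are missing from the logarithmic derivative of `ch(Θ₁)`. -/
theorem euler_lHatForm (hR : ∀ i j, IsHomogeneous 1 (R i j)) {K : ℕ}
    (hK : ((Complex.I / (2 * Real.pi)) • R) ^ (2 * K) = 0) :
    euler (lHatForm R) = lHatForm R * ∑ k ∈ Finset.range K,
      eisensteinCoeff₁ k 0 • (((Complex.I / (2 * Real.pi)) • R) ^ (2 * k + 2)).trace := by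
  have hZ (i j) : IsHomogeneous 1 (((Complex.I / (4 * Real.pi)) • R) i j) := (hR i j).smul _
  have hs := scalarPart_det_evalNilpotent ((2 : ℂ) • (coshSeries * sinhDivSeries⁻¹)) hZ
  have hc : coeff 0 (coshSeries * sinhDivSeries⁻¹) = 1 := by
    have := coeff_cothSeries 0
    rw [cothSeries] at this
    rw [this]; simp
  rw [map_smul, hc, smul_eq_mul, mul_one] at hs
  set l : ℂ⟦X⟧ := 1 + rescale (2 : ℂ) cothSeries - 2 * cothSeries with hl
  have hcoeff (k : ℕ) : coeff k l = (if k = 0 then 1 else 0) + (2 ^ k - 2) * coeff k cothSeries := by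
    rw [hl, map_sub, map_add, coeff_one, coeff_rescale, two_mul, map_add]
    ring
  have hf : X * d⁄dX ℂ ((2 : ℂ) • (coshSeries * sinhDivSeries⁻¹)) =
      ((2 : ℂ) • (coshSeries * sinhDivSeries⁻¹)) * l := by
    rw [Derivation.map_smul, mul_smul_comm, smul_mul_assoc]
    congr 1
    exact X_mul_derivative_cothSeries
  have h1 := Derivation.map_det_evalNilpotent euler (map_euler_of_isHomogeneous hZ)
    (exists_matrix_pow_eq_zero hZ) hf
  have hhalf : (Complex.I / (4 * Real.pi)) • R =
      (1 / 2 : ℂ) • ((Complex.I / (2 * Real.pi)) • R) := by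
    rw [smul_smul]; congr 1; ring
  rw [lHatForm, euler_sqrt (by rw [hs]; exact pow_ne_zero _ two_ne_zero) h1]
  congr 1
  rw [hhalf, trace_evalNilpotent_half hK, Finset.smul_sum]
  · refine Finset.sum_congr rfl fun k _ => ?_
    rw [smul_smul, hcoeff, coeff_cothSeries, if_neg (by omega), if_pos ⟨k + 1, by ring⟩]
    congr 1
    simp only [eisensteinCoeff₁, doubleIndex, dvd_zero, if_true, Nat.zero_div, eisensteinCoeff]
    rw [show 2 * k + 2 = 2 * k + 1 + 1 by ring, Nat.factorial_succ]
    have h2 : ((2 * k + 1).factorial : ℂ) ≠ 0 := Nat.cast_ne_zero.mpr (Nat.factorial_ne_zero _)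
    have h3 : (k : ℂ) + 1 ≠ 0 := Nat.cast_add_one_ne_zero k
    have h4 : (2 * k + 1 + 1 : ℂ) ≠ 0 := by
      rw [show (2 * k + 1 + 1 : ℂ) = 2 * (k + 1) by ring]
      exact mul_ne_zero two_ne_zero h3
    push_cast
    rw [one_div, inv_pow]
    field_simp
    ring
  · rw [hcoeff, coeff_cothSeries]; norm_num
  · intro k
    rw [hcoeff, coeff_cothSeries, if_neg (by omega), if_neg (by
      rw [Nat.not_even_iff_odd]; exact odd_two_mul_add_one k)]
    simp

/-- The logarithmic derivative of `Â` supplies the constant terms of `eisensteinCoeff₂`. -/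
theorem euler_aHatForm (hR : ∀ i j, IsHomogeneous 1 (R i j)) {K : ℕ}
    (hK : ((Complex.I / (2 * Real.pi)) • R) ^ (2 * K) = 0) :
    euler (aHatForm R) = aHatForm R * ∑ k ∈ Finset.range K,
      eisensteinCoeff₂ k 0 • (((Complex.I / (2 * Real.pi)) • R) ^ (2 * k + 2)).trace := by
  have hZ (i j) : IsHomogeneous 1 (((Complex.I / (4 * Real.pi)) • R) i j) := (hR i j).smul _
  have hs := scalarPart_det_evalNilpotent sinhDivSeries⁻¹ hZ
  have hc : coeff 0 sinhDivSeries⁻¹ = 1 := by simp [sinhDivSeries, coeff_zero_eq_constantCoeff,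
    PowerSeries.constantCoeff_inv]
  rw [hc, one_pow] at hs
  set l : ℂ⟦X⟧ := 1 - cothSeries with hl
  have hcoeff (k : ℕ) : coeff k l = (if k = 0 then 1 else 0) - coeff k cothSeries := by
    rw [hl, map_sub, coeff_one]
  have h1 := Derivation.map_det_evalNilpotent euler (map_euler_of_isHomogeneous hZ)
    (exists_matrix_pow_eq_zero hZ) X_mul_derivative_inv_sinhDiv
  have hhalf : (Complex.I / (4 * Real.pi)) • R =
      (1 / 2 : ℂ) • ((Complex.I / (2 * Real.pi)) • R) := by
    rw [smul_smul]; congr 1; ring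
  rw [aHatForm, euler_sqrt (by rw [hs]; exact one_ne_zero) h1]
  congr 1
  rw [hhalf, trace_evalNilpotent_half hK, Finset.smul_sum]
  · refine Finset.sum_congr rfl fun k _ => ?_
    rw [smul_smul, hcoeff, coeff_cothSeries, if_neg (by omega), if_pos ⟨k + 1, by ring⟩]
    congr 1
    rw [eisensteinCoeff₂, doubleIndex, if_pos (dvd_zero 2), Nat.zero_div, eisensteinCoeff,
      if_pos rfl, show 2 * k + 2 = 2 * k + 1 + 1 by ring, Nat.factorial_succ]
    have h2 : ((2 * k + 1).factorial : ℂ) ≠ 0 := Nat.cast_ne_zero.mpr (Nat.factorial_ne_zero _)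
    have h3 : (k : ℂ) + 1 ≠ 0 := Nat.cast_add_one_ne_zero k
    have h4 : (2 * k + 1 + 1 : ℂ) ≠ 0 := by
      rw [show (2 * k + 1 + 1 : ℂ) = 2 * (k + 1) by ring]
      exact mul_ne_zero two_ne_zero h3
    push_cast
    rw [one_div, inv_pow]
    field_simp
    ring
  · rw [hcoeff, coeff_cothSeries]; norm_num
  · intro k
    rw [hcoeff, coeff_cothSeries, if_neg (by omega), if_neg (by
      rw [Nat.not_even_iff_odd]; exact odd_two_mul_add_one k)]
    simp

/-- The degree-zero component of `L̂` is the source of the factor `2^{n/2}` in the transformation law. -/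
theorem scalarPart_lHatForm (hR : ∀ i j, IsHomogeneous 1 (R i j)) :
    (lHatForm R).scalarPart = ((2 : ℝ) ^ ((Fintype.card ι : ℝ) / 2) : ℝ) := by
  have hZ (i j) : IsHomogeneous 1 (((Complex.I / (4 * Real.pi)) • R) i j) := (hR i j).smul _
  have hs := scalarPart_det_evalNilpotent ((2 : ℂ) • (coshSeries * sinhDivSeries⁻¹)) hZ
  have hc : coeff 0 (coshSeries * sinhDivSeries⁻¹) = 1 := by
    have := coeff_cothSeries 0
    rw [cothSeries] at this
    rw [this]; simp
  rw [map_smul, hc, smul_eq_mul, mul_one] at hs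
  rw [lHatForm, scalarPart_sqrt (by rw [hs]; exact pow_ne_zero _ two_ne_zero), hs]
  have h1 : ((2 : ℂ) ^ Fintype.card ι) = (((2 : ℝ) ^ Fintype.card ι : ℝ) : ℂ) := by push_cast; rfl
  have h2 : (1 / 2 : ℂ) = ((1 / 2 : ℝ) : ℂ) := by push_cast; rfl
  rw [h1, h2, ← Complex.ofReal_cpow (by positivity), ← Real.rpow_natCast, ← Real.rpow_mul two_pos.le]
  congr 2
  ring

theorem scalarPart_aHatForm (hR : ∀ i j, IsHomogeneous 1 (R i j)) :
    (aHatForm R).scalarPart = 1 := by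
  have hZ (i j) : IsHomogeneous 1 (((Complex.I / (4 * Real.pi)) • R) i j) := (hR i j).smul _
  have hs := scalarPart_det_evalNilpotent sinhDivSeries⁻¹ hZ
  have hc : coeff 0 sinhDivSeries⁻¹ = 1 := by simp [sinhDivSeries, coeff_zero_eq_constantCoeff,
    PowerSeries.constantCoeff_inv]
  rw [hc, one_pow] at hs
  rw [aHatForm, scalarPart_sqrt (by rw [hs]; exact one_ne_zero), hs, Complex.one_cpow]

end CharacteristicForms

/-! ### The Euler derivation of the two characteristic series -/

section CharacteristicSeriesOfCurvature

open PowerSeries EvenForms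

section Substitution

variable {A : Type*} [CommRing A]

theorem coeff_subst_X_pow_of_lt {m n : ℕ} (h : n < m) (F : A⟦X⟧) :
    coeff n (F.subst (X ^ m : A⟦X⟧)) = if n = 0 then coeff 0 F else 0 := by
  rw [coeff_subst_X_pow (by omega)]
  by_cases hn : n = 0
  · simp [hn]
  · rw [if_neg hn, if_neg fun hd => hn (Nat.eq_zero_of_dvd_of_lt hd h)]

variable [Algebra ℂ A]

theorem coeff_subst_neg_X_pow_of_lt {m n : ℕ} (h : n < m) (F : A⟦X⟧) :
    coeff n (F.subst (-X ^ m : A⟦X⟧)) = if n = 0 then coeff 0 F else 0 := by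
  rw [coeff_subst_neg_X_pow (by omega)]
  by_cases hn : n = 0
  · simp [hn]
  · rw [if_neg hn, if_neg fun hd => hn (Nat.eq_zero_of_dvd_of_lt hd h)]

theorem coeff_mul_mk_sum (Φ : A⟦X⟧) {κ : Type*} (s : Finset κ) (c : κ → ℕ → ℂ) (p : κ → A) (N : ℕ) :
    coeff N (Φ * mk fun N => ∑ k ∈ s, c k N • p k) =
      ∑ ij ∈ Finset.HasAntidiagonal.antidiagonal N, ∑ k ∈ s, c k ij.2 • (coeff ij.1 Φ * p k) := by
  simp only [coeff_mul, coeff_mk, Finset.mul_sum, mul_smul_comm]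

variable (s : A →ₐ[ℂ] ℂ) {F : A⟦X⟧}

theorem map_subst_X_pow_eq_one {m : ℕ} (hm : m ≠ 0) (h : PowerSeries.map (s : A →+* ℂ) F = 1) :
    PowerSeries.map (s : A →+* ℂ) (F.subst (X ^ m : A⟦X⟧)) = 1 := by
  ext n
  have h1 (k : ℕ) : s (coeff k F) = coeff k (1 : ℂ⟦X⟧) := by rw [← h, coeff_map]; rfl
  rw [coeff_map, coeff_subst_X_pow hm]
  split_ifs with hd
  · rw [AlgHom.coe_toRingHom, Algebra.algebraMap_self, RingHom.id_apply, h1, coeff_one, coeff_one]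
    obtain ⟨d, rfl⟩ := hd
    rw [Nat.mul_div_cancel_left _ (Nat.pos_of_ne_zero hm)]
    simp [hm]
  · rw [map_zero, coeff_one, if_neg]
    rintro rfl
    exact hd (dvd_zero _)

theorem map_subst_neg_X_pow_eq_one {m : ℕ} (hm : m ≠ 0) (h : PowerSeries.map (s : A →+* ℂ) F = 1) :
    PowerSeries.map (s : A →+* ℂ) (F.subst (-X ^ m : A⟦X⟧)) = 1 := by
  ext n
  have h1 (k : ℕ) : s (coeff k F) = coeff k (1 : ℂ⟦X⟧) := by rw [← h, coeff_map]; rfl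
  rw [coeff_map, coeff_subst_neg_X_pow hm]
  split_ifs with hd
  · rw [AlgHom.coe_toRingHom, map_mul, h1, coeff_one, coeff_one]
    obtain ⟨d, rfl⟩ := hd
    rw [Nat.mul_div_cancel_left _ (Nat.pos_of_ne_zero hm)]
    by_cases hd : d = 0 <;> simp [hm, hd]
  · rw [map_zero, coeff_one, if_neg]
    rintro rfl
    exact hd (dvd_zero _)

theorem map_formalProd_eq_one {F : ℕ → A⟦X⟧} (h : ∀ j, PowerSeries.map (s : A →+* ℂ) (F j) = 1) :
    PowerSeries.map (s : A →+* ℂ) (formalProd F) = 1 := by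
  ext N
  rw [coeff_map, formalProd, coeff_mk, ← coeff_map, map_prod]
  simp [h]

end Substitution

variable {T : Type*} [AddCommGroup T] [Module ℝ T] [FiniteDimensional ℝ T]
variable {ι : Type*} [Fintype ι] [DecidableEq ι] {R : Matrix ι ι (EvenForms T)}

theorem map_euler_chernExp (hR : ∀ i j, IsHomogeneous 1 (R i j)) :
    (chernExp R).map euler = ((Complex.I / (2 * Real.pi)) • R) * chernExp R := by
  have hU (i j) : IsHomogeneous 1 (((Complex.I / (2 * Real.pi)) • R) i j) := (hR i j).smul _
  have hn := exists_matrix_pow_eq_zero hU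
  rw [chernExp, Derivation.map_evalNilpotent euler (map_euler_of_isHomogeneous hU) hn]
  rw [derivative_exp, evalNilpotent_mul _ _ hn, evalNilpotent_X hn]

theorem map_scalarHom_chernExp (hR : ∀ i j, IsHomogeneous 1 (R i j)) :
    (chernExp R).map scalarHom = 1 := by
  have hU (i j) : IsHomogeneous 1 (((Complex.I / (2 * Real.pi)) • R) i j) := (hR i j).smul _
  have h0 : (scalarHom (T := T)).mapMatrix ((Complex.I / (2 * Real.pi)) • R) = 0 := by
    ext i j
    exact (hU i j).scalarPart_eq_zero
  change (scalarHom (T := T)).mapMatrix (chernExp R) = 1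
  rw [chernExp, map_evalNilpotent _ _ (exists_matrix_pow_eq_zero hU), h0, evalNilpotent_zero]
  simp

theorem hasLogDeriv_chTheta₁ (hR : ∀ i j, IsHomogeneous 1 (R i j)) :
    HasLogDeriv euler (chTheta₁ R) (thetaLogDeriv₁ ((Complex.I / (2 * Real.pi)) • R)) := by
  have hE := map_euler_chernExp hR
  rw [chTheta₁, chSymReduced_eq (exists_matrix_pow_eq_zero hR),
    chExtReduced_eq (exists_matrix_pow_eq_zero hR)]
  refine HasLogDeriv.mul ?_ ?_
  all_goals
    refine HasLogDeriv.formalProd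
      (fun j => (hasLogDeriv_permSeriesReduced _ hE).subst_X_pow (by omega)) ?_ ?_
    · intro j n h
      rw [coeff_subst_X_pow_of_lt (by omega), coeff_zero_eq_constantCoeff_apply,
        constantCoeff_permSeriesReduced, coeff_one]
    · intro j n h
      rw [coeff_subst_X_pow_of_lt (by omega), coeff_zero_permLogDeriv, ite_self]

theorem hasLogDeriv_chTheta₂ (hR : ∀ i j, IsHomogeneous 1 (R i j)) :
    HasLogDeriv euler (chTheta₂ R) (thetaLogDeriv₂ ((Complex.I / (2 * Real.pi)) • R)) := by
  have hE := map_euler_chernExp hR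
  rw [chTheta₂, chSymReduced_eq (exists_matrix_pow_eq_zero hR),
    chExtReduced_eq (exists_matrix_pow_eq_zero hR)]
  refine HasLogDeriv.mul ?_ ?_
  · refine HasLogDeriv.formalProd
      (fun j => (hasLogDeriv_permSeriesReduced _ hE).subst_X_pow (by omega)) ?_ ?_
    · intro j n h
      rw [coeff_subst_X_pow_of_lt (by omega), coeff_zero_eq_constantCoeff_apply,
        constantCoeff_permSeriesReduced, coeff_one]
    · intro j n h
      rw [coeff_subst_X_pow_of_lt (by omega), coeff_zero_permLogDeriv, ite_self]
  · refine HasLogDeriv.formalProd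
      (fun j => (hasLogDeriv_permSeriesReduced _ hE).subst_neg_X_pow (by omega)) ?_ ?_
    · intro j n h
      rw [coeff_subst_neg_X_pow_of_lt (by omega), coeff_zero_eq_constantCoeff_apply,
        constantCoeff_permSeriesReduced, coeff_one]
    · intro j n h
      rw [coeff_subst_neg_X_pow_of_lt (by omega), coeff_zero_permLogDeriv, ite_self]

theorem map_scalarHom_chTheta₁ (hR : ∀ i j, IsHomogeneous 1 (R i j)) :
    PowerSeries.map (scalarHom (T := T) : EvenForms T →+* ℂ) (chTheta₁ R) = 1 := by
  have hE := map_scalarHom_chernExp hR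
  rw [chTheta₁, map_mul, chSymReduced_eq (exists_matrix_pow_eq_zero hR),
    chExtReduced_eq (exists_matrix_pow_eq_zero hR),
    map_formalProd_eq_one _ fun j =>
      map_subst_X_pow_eq_one _ (by omega) (map_permSeriesReduced _ _ hE),
    map_formalProd_eq_one _ fun j =>
      map_subst_X_pow_eq_one _ (by omega) (map_permSeriesReduced _ _ hE), mul_one]

theorem map_scalarHom_chTheta₂ (hR : ∀ i j, IsHomogeneous 1 (R i j)) :
    PowerSeries.map (scalarHom (T := T) : EvenForms T →+* ℂ) (chTheta₂ R) = 1 := by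
  have hE := map_scalarHom_chernExp hR
  rw [chTheta₂, map_mul, chSymReduced_eq (exists_matrix_pow_eq_zero hR),
    chExtReduced_eq (exists_matrix_pow_eq_zero hR),
    map_formalProd_eq_one _ fun j =>
      map_subst_X_pow_eq_one _ (by omega) (map_permSeriesReduced _ _ hE),
    map_formalProd_eq_one _ fun j =>
      map_subst_neg_X_pow_eq_one _ (by omega) (map_permSeriesReduced _ _ hE), mul_one]

/-- The logarithmic derivative of `L̂ · ch(Θ₁)`: its coefficients are those of the Eisenstein
series `eisensteinCoeff₁`, paired with the traces of the even powers of the curvature. -/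
theorem hasLogDeriv_lHatForm_mul_chTheta₁ (hR : ∀ i j, IsHomogeneous 1 (R i j)) {K : ℕ}
    (hK : ((Complex.I / (2 * Real.pi)) • R) ^ (2 * K) = 0)
    (hodd : ∀ k, (((Complex.I / (2 * Real.pi)) • R) ^ (2 * k + 1)).trace = 0) :
    HasLogDeriv euler (C (lHatForm R) * chTheta₁ R) (mk fun N => ∑ k ∈ Finset.range K,
      eisensteinCoeff₁ k N • (((Complex.I / (2 * Real.pi)) • R) ^ (2 * k + 2)).trace) := by
  convert (HasLogDeriv.const (euler_lHatForm hR hK)).mul (hasLogDeriv_chTheta₁ hR) using 1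
  ext N
  rw [coeff_mk, map_add, coeff_C]
  split_ifs with hN
  · rw [hN, coeff_zero_thetaLogDeriv₁, add_zero]
  · rw [coeff_thetaLogDeriv₁ hK hodd hN, zero_add]

/-- The logarithmic derivative of `Â · ch(Θ₂)`. -/
theorem hasLogDeriv_aHatForm_mul_chTheta₂ (hR : ∀ i j, IsHomogeneous 1 (R i j)) {K : ℕ}
    (hK : ((Complex.I / (2 * Real.pi)) • R) ^ (2 * K) = 0)
    (hodd : ∀ k, (((Complex.I / (2 * Real.pi)) • R) ^ (2 * k + 1)).trace = 0) :
    HasLogDeriv euler (C (aHatForm R) * chTheta₂ R) (mk fun N => ∑ k ∈ Finset.range K,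
      eisensteinCoeff₂ k N • (((Complex.I / (2 * Real.pi)) • R) ^ (2 * k + 2)).trace) := by
  convert (HasLogDeriv.const (euler_aHatForm hR hK)).mul (hasLogDeriv_chTheta₂ hR) using 1
  ext N
  rw [coeff_mk, map_add, coeff_C]
  split_ifs with hN
  · rw [hN, coeff_zero_thetaLogDeriv₂, add_zero]
  · rw [coeff_thetaLogDeriv₂ hK hodd hN, zero_add]

theorem part_zero_lHatForm_mul_chTheta₁ (hR : ∀ i j, IsHomogeneous 1 (R i j)) (N : ℕ) :
    part 0 (coeff N (C (lHatForm R) * chTheta₁ R)) =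
      (if N = 0 then (((2 : ℝ) ^ ((Fintype.card ι : ℝ) / 2) : ℝ) : ℂ) else 0) •
        (1 : EvenForms T) := by
  have h := congrArg (coeff N) (map_scalarHom_chTheta₁ hR)
  rw [coeff_map, AlgHom.coe_toRingHom, scalarHom_apply, coeff_one] at h
  rw [part_zero_eq, coeff_C_mul, scalarPart_mul, h, scalarPart_lHatForm hR,
    ← Algebra.algebraMap_eq_smul_one]
  split_ifs <;> simp

theorem part_zero_aHatForm_mul_chTheta₂ (hR : ∀ i j, IsHomogeneous 1 (R i j)) (N : ℕ) :
    part 0 (coeff N (C (aHatForm R) * chTheta₂ R)) =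
      (if N = 0 then (1 : ℂ) else 0) • (1 : EvenForms T) := by
  have h := congrArg (coeff N) (map_scalarHom_chTheta₂ hR)
  rw [coeff_map, AlgHom.coe_toRingHom, scalarHom_apply, coeff_one] at h
  rw [part_zero_eq, coeff_C_mul, scalarPart_mul, h, scalarPart_aHatForm hR, one_mul,
    ← Algebra.algebraMap_eq_smul_one]

theorem isHomogeneous_trace_pow (hR : ∀ i j, IsHomogeneous 1 (R i j)) (k : ℕ) :
    IsHomogeneous k (R ^ k).trace :=
  .sum fun i _ => isHomogeneous_matrix_pow hR k i i

/-- The recursion on the degree given by a logarithmic derivative with respect to the Euler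
derivation. -/
theorem HasLogDeriv.smul_part {Φ : (EvenForms T)⟦X⟧} {K : ℕ} {c : ℕ → ℕ → ℂ} {p : ℕ → EvenForms T}
    (hp : ∀ k, IsHomogeneous (2 * k + 2) (p k))
    (h : HasLogDeriv euler Φ (mk fun N => ∑ k ∈ Finset.range K, c k N • p k)) (w N : ℕ) :
    (w : ℂ) • part w (coeff N Φ) = ∑ k ∈ Finset.range K with 2 * k + 2 ≤ w,
      ∑ ij ∈ Finset.HasAntidiagonal.antidiagonal N,
        c k ij.2 • (part (w - (2 * k + 2)) (coeff ij.1 Φ) * p k) := by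
  have h1 := congrArg (fun F => part w (coeff N F)) h
  simp only [coeff_coeffDeriv, part_euler] at h1
  rw [h1, coeff_mul_mk_sum, part_sum, Finset.sum_comm]
  refine Finset.sum_congr rfl fun ij _ => ?_
  rw [part_sum, Finset.sum_filter]
  refine Finset.sum_congr rfl fun k _ => ?_
  rw [part_smul, part_mul]
  split_ifs with hk
  · congr 1
    rw [Finset.sum_eq_single (w - (2 * k + 2), 2 * k + 2)]
    · rw [(hp k).part_self]
    · intro rs hrs hne
      rw [(hp k).part_of_ne, mul_zero]
      intro h2
      have h3 := Finset.HasAntidiagonal.mem_antidiagonal.mp hrs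
      exact hne (Prod.ext (by simp; omega) h2)
    · intro h2
      exact absurd (Finset.HasAntidiagonal.mem_antidiagonal.mpr (by simp; omega)) h2
  · rw [Finset.sum_eq_zero, smul_zero]
    intro rs hrs
    have h3 := Finset.HasAntidiagonal.mem_antidiagonal.mp hrs
    rw [(hp k).part_of_ne (by omega), mul_zero]

end CharacteristicSeriesOfCurvature

/-! ### Pairs of modular forms exchanged by `S` -/

section ModularPairs

open ModularForm ModularGroup

/-- Two functions `f`, `g` on `ℍ`, the sums of the series `∑ a_N q^{N/2}` and `∑ b_N q^{N/2}`, whose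
transformation laws of weight `w` under the generators of `SL₂(ℤ)` are those of a modular form
`f` over `Γ₀(2)` together with its other conjugates `g = f|S` and `g|T`. Since `Γ₀(2)` has index three
in `SL₂(ℤ)`, these are all the conjugates of `f`. -/
structure IsModularPair (w : ℤ) (a b : ℕ → ℂ) (f g : ℍ → ℂ) : Prop where
  hasSum_left (τ : ℍ) : HasSum (fun N : ℕ => a N * Complex.exp (Real.pi * Complex.I * N * τ)) (f τ)
  hasSum_right (τ : ℍ) : HasSum (fun N : ℕ => b N * Complex.exp (Real.pi * Complex.I * N * τ)) (g τ)
  slash_T : f ∣[w] T = f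
  slash_S : f ∣[w] S = g
  slash_S' : g ∣[w] S = f
  slash_T_S : (g ∣[w] T) ∣[w] S = g ∣[w] T

theorem slash_T_apply (w : ℤ) (f : ℍ → ℂ) (τ : ℍ) : (f ∣[w] T) τ = f (T • τ) := by
  rw [SL_slash_apply, ModularGroup.denom_apply]
  simp [T]

theorem slash_S_apply (w : ℤ) (f : ℍ → ℂ) (τ : ℍ) : (f ∣[w] S) τ = f (S • τ) * (τ : ℂ) ^ (-w) := by
  rw [SL_slash_apply, ModularGroup.denom_apply]
  simp [S]

theorem coe_T_smul (τ : ℍ) : ((T • τ : ℍ) : ℂ) = τ + 1 := by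
  rw [modular_T_smul, coe_vadd]
  push_cast
  ring

theorem coe_S_smul (τ : ℍ) : ((S • τ : ℍ) : ℂ) = -1 / τ := by
  rw [modular_S_smul, coe_mk, ← one_div, div_neg, neg_div]

section QSeries

variable {a : ℕ → ℂ} {f : ℍ → ℂ}

theorem norm_exp_pi_mul (N : ℕ) (z : ℂ) :
    ‖Complex.exp (Real.pi * Complex.I * N * z)‖ = Real.exp (-(Real.pi * N * z.im)) := by
  rw [Complex.norm_exp]
  congr 1
  simp

theorem mdifferentiable_of_hasSum
    (h : ∀ τ : ℍ, HasSum (fun N : ℕ => a N * Complex.exp (Real.pi * Complex.I * N * τ)) (f τ)) :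
    MDiff f := by
  rw [UpperHalfPlane.mdifferentiable_iff]
  intro z hz
  have hz' : 0 < z.im := hz
  have hy : 0 < (((z.im / 2 : ℝ) : ℂ) * Complex.I).im := by simpa using hz'
  have hs := (h ⟨_, hy⟩).summable.norm
  have ho : IsOpen {x : ℂ | z.im / 2 < x.im} := isOpen_lt continuous_const Complex.continuous_im
  have hd : DifferentiableOn ℂ
      (fun x => ∑' N : ℕ, a N * Complex.exp (Real.pi * Complex.I * N * x))
      {x : ℂ | z.im / 2 < x.im} := by
    refine Complex.differentiableOn_tsum_of_summable_norm hs (fun N => by fun_prop) ho fun N x hx => ?_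
    rw [norm_mul, norm_mul, norm_exp_pi_mul, norm_exp_pi_mul]
    refine mul_le_mul_of_nonneg_left (Real.exp_le_exp.mpr (neg_le_neg ?_)) (norm_nonneg _)
    have hx' : z.im / 2 ≤ x.im := le_of_lt hx
    simp only [Complex.mul_im, Complex.ofReal_re, Complex.I_im,
      Complex.ofReal_im, Complex.I_re, mul_one, mul_zero, add_zero]
    gcongr
  have hmem : {x : ℂ | z.im / 2 < x.im} ∈ nhds z := ho.mem_nhds (by simpa using hz')
  refine DifferentiableAt.differentiableWithinAt ((hd.differentiableAt hmem).congr_of_eventuallyEq ?_)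
  filter_upwards [hmem] with x hx
  have hx' : 0 < x.im := lt_trans (half_pos hz') hx
  rw [Function.comp_apply, ofComplex_apply_of_im_pos hx']
  exact (h ⟨x, hx'⟩).tsum_eq.symm

theorem isBoundedAtImInfty_of_hasSum
    (h : ∀ τ : ℍ, HasSum (fun N : ℕ => a N * Complex.exp (Real.pi * Complex.I * N * τ)) (f τ)) :
    IsBoundedAtImInfty f := by
  refine isBoundedAtImInfty_of_hasSum_qExpansion (h := 2) (c := a) two_pos fun τ => ?_
  convert h τ using 2 with N
  rw [smul_eq_mul, Function.Periodic.qParam, ← Complex.exp_nat_mul]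
  congr 2
  push_cast
  ring

theorem apply_T_smul_T_smul_of_hasSum
    (h : ∀ τ : ℍ, HasSum (fun N : ℕ => a N * Complex.exp (Real.pi * Complex.I * N * τ)) (f τ))
    (τ : ℍ) : f (T • T • τ) = f τ := by
  refine (h (T • T • τ)).unique ?_
  convert h τ using 3 with N
  rw [coe_T_smul, coe_T_smul, Complex.exp_eq_exp_iff_exists_int]
  refine ⟨N, ?_⟩
  push_cast
  ring

end QSeries

namespace IsModularPair

variable {w : ℤ} {a b : ℕ → ℂ} {f g : ℍ → ℂ}

theorem slash_T_T (h : IsModularPair w a b f g) : (g ∣[w] T) ∣[w] T = g := by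
  ext τ
  rw [slash_T_apply, slash_T_apply, apply_T_smul_T_smul_of_hasSum h.hasSum_right]

theorem add {a' b' : ℕ → ℂ} {f' g' : ℍ → ℂ} (h : IsModularPair w a b f g)
    (h' : IsModularPair w a' b' f' g') :
    IsModularPair w (a + a') (b + b') (f + f') (g + g') where
  hasSum_left τ := by simpa only [Pi.add_apply, add_mul] using (h.hasSum_left τ).add (h'.hasSum_left τ)
  hasSum_right τ := by
    simpa only [Pi.add_apply, add_mul] using (h.hasSum_right τ).add (h'.hasSum_right τ)
  slash_T := by rw [SlashAction.add_slash, h.slash_T, h'.slash_T]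
  slash_S := by rw [SlashAction.add_slash, h.slash_S, h'.slash_S]
  slash_S' := by rw [SlashAction.add_slash, h.slash_S', h'.slash_S']
  slash_T_S := by
    rw [SlashAction.add_slash, SlashAction.add_slash, h.slash_T_S, h'.slash_T_S]

theorem smul (c : ℂ) (h : IsModularPair w a b f g) :
    IsModularPair w (c • a) (c • b) (c • f) (c • g) where
  hasSum_left τ := by
    simpa only [Pi.smul_apply, smul_eq_mul, mul_assoc] using (h.hasSum_left τ).mul_left c
  hasSum_right τ := by
    simpa only [Pi.smul_apply, smul_eq_mul, mul_assoc] using (h.hasSum_right τ).mul_left c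
  slash_T := by rw [SL_smul_slash, h.slash_T]
  slash_S := by rw [SL_smul_slash, h.slash_S]
  slash_S' := by rw [SL_smul_slash, h.slash_S']
  slash_T_S := by rw [SL_smul_slash, SL_smul_slash, h.slash_T_S]

theorem zero (w : ℤ) : IsModularPair w 0 0 0 0 where
  hasSum_left τ := by simp [hasSum_zero]
  hasSum_right τ := by simp [hasSum_zero]
  slash_T := SlashAction.zero_slash _ _
  slash_S := SlashAction.zero_slash _ _
  slash_S' := SlashAction.zero_slash _ _
  slash_T_S := by rw [SlashAction.zero_slash, SlashAction.zero_slash]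

theorem hasSum_antidiagonal {a a' : ℕ → ℂ} {s s' : ℂ} {τ : ℍ}
    (h : HasSum (fun N : ℕ => a N * Complex.exp (Real.pi * Complex.I * N * τ)) s)
    (h' : HasSum (fun N : ℕ => a' N * Complex.exp (Real.pi * Complex.I * N * τ)) s') :
    HasSum (fun N : ℕ => (∑ ij ∈ Finset.HasAntidiagonal.antidiagonal N, a ij.1 * a' ij.2) *
      Complex.exp (Real.pi * Complex.I * N * τ)) (s * s') := by
  have h1 := (summable_norm_sum_mul_antidiagonal_of_summable_norm h.summable.norm
    h'.summable.norm).of_norm.hasSum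
  rw [← tsum_mul_tsum_eq_tsum_sum_antidiagonal_of_summable_norm h.summable.norm h'.summable.norm,
    h.tsum_eq, h'.tsum_eq] at h1
  convert! h1 using 2 with N
  rw [Finset.sum_mul]
  refine Finset.sum_congr rfl fun ij hij => ?_
  have h2 := Finset.HasAntidiagonal.mem_antidiagonal.mp hij
  rw [← h2, mul_mul_mul_comm, ← Complex.exp_add]
  congr 2
  push_cast
  ring

theorem mul {w' : ℤ} {a' b' : ℕ → ℂ} {f' g' : ℍ → ℂ} (h : IsModularPair w a b f g)
    (h' : IsModularPair w' a' b' f' g') :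
    IsModularPair (w + w')
      (fun N => ∑ ij ∈ Finset.HasAntidiagonal.antidiagonal N, a ij.1 * a' ij.2)
      (fun N => ∑ ij ∈ Finset.HasAntidiagonal.antidiagonal N, b ij.1 * b' ij.2)
      (f * f') (g * g') where
  hasSum_left τ := hasSum_antidiagonal (h.hasSum_left τ) (h'.hasSum_left τ)
  hasSum_right τ := hasSum_antidiagonal (h.hasSum_right τ) (h'.hasSum_right τ)
  slash_T := by rw [mul_slash_SL2, h.slash_T, h'.slash_T]
  slash_S := by rw [mul_slash_SL2, h.slash_S, h'.slash_S]
  slash_S' := by rw [mul_slash_SL2, h.slash_S', h'.slash_S']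
  slash_T_S := by rw [mul_slash_SL2, mul_slash_SL2, h.slash_T_S, h'.slash_T_S]

theorem one : IsModularPair 0 (fun N => if N = 0 then 1 else 0) (fun N => if N = 0 then 1 else 0)
    1 1 := by
  have h (τ : ℍ) : HasSum (fun N : ℕ => (if N = 0 then 1 else 0 : ℂ) *
      Complex.exp (Real.pi * Complex.I * N * τ)) ((1 : ℍ → ℂ) τ) := by
    change HasSum _ 1
    convert hasSum_ite_eq (0 : ℕ) (1 : ℂ) using 2 with N
    split_ifs with h <;> simp [h]
  refine ⟨h, h, ?_, ?_, ?_, ?_⟩ <;>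
  · ext τ
    simp only [slash_T_apply, slash_S_apply, Pi.one_apply, neg_zero, zpow_zero, mul_one]

open Classical in
/-- The conjugate of `f` by a matrix, which depends on the parities in its bottom row. -/
noncomputable def conjugate (w : ℤ) (f g : ℍ → ℂ) (γ : SL(2, ℤ)) : ℍ → ℂ :=
  if Even (γ 1 0) then f else if Even (γ 1 1) then g else g ∣[w] T

theorem mul_one_zero (γ δ : SL(2, ℤ)) : (γ * δ) 1 0 = γ 1 0 * δ 0 0 + γ 1 1 * δ 1 0 :=
  (Matrix.two_mul_expl γ.1 δ.1).2.2.1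

theorem mul_one_one (γ δ : SL(2, ℤ)) : (γ * δ) 1 1 = γ 1 0 * δ 0 1 + γ 1 1 * δ 1 1 :=
  (Matrix.two_mul_expl γ.1 δ.1).2.2.2

theorem S_apply : S 0 0 = 0 ∧ S 0 1 = -1 ∧ S 1 0 = 1 ∧ S 1 1 = 0 := ⟨rfl, rfl, rfl, rfl⟩

theorem T_apply : T 0 0 = 1 ∧ T 0 1 = 1 ∧ T 1 0 = 0 ∧ T 1 1 = 1 := ⟨rfl, rfl, rfl, rfl⟩

theorem not_even_and_even (γ : SL(2, ℤ)) (h : Even (γ 1 0)) : ¬ Even (γ 1 1) := by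
  intro h'
  have hd := γ.det_coe
  rw [Matrix.det_fin_two] at hd
  have h1 : Even ((1 : ℤ)) := by
    rw [← hd]
    exact (h'.mul_left _).sub (h.mul_left _)
  exact absurd h1 (by decide)

theorem conjugate_mul_S (h : IsModularPair w a b f g) (γ : SL(2, ℤ)) :
    conjugate w f g γ ∣[w] S = conjugate w f g (γ * S) := by
  have h0 : (γ * S) 1 0 = γ 1 1 := by
    rw [mul_one_zero, S_apply.1, S_apply.2.2.1]; ring
  have h1 : (γ * S) 1 1 = -γ 1 0 := by
    rw [mul_one_one, S_apply.2.1, S_apply.2.2.2]; ring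
  simp only [conjugate, h0, h1, even_neg]
  have := not_even_and_even γ
  by_cases hc : Even (γ 1 0) <;> by_cases hd : Even (γ 1 1)
  · exact absurd hd (this hc)
  · simp only [hc, hd, if_true, if_false]; exact h.slash_S
  · simp only [hc, hd, if_true, if_false]; exact h.slash_S'
  · simp only [hc, hd, if_false]; exact h.slash_T_S

theorem conjugate_mul_T (h : IsModularPair w a b f g) (γ : SL(2, ℤ)) :
    conjugate w f g γ ∣[w] T = conjugate w f g (γ * T) := by
  have h0 : (γ * T) 1 0 = γ 1 0 := by
    rw [mul_one_zero, T_apply.1, T_apply.2.2.1]; ring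
  have h1 : (γ * T) 1 1 = γ 1 0 + γ 1 1 := by
    rw [mul_one_one, T_apply.2.1, T_apply.2.2.2]; ring
  simp only [conjugate, h0, h1, Int.even_add]
  by_cases hc : Even (γ 1 0) <;> by_cases hd : Even (γ 1 1)
  · simp only [hc, if_true]; exact h.slash_T
  · simp only [hc, if_true]; exact h.slash_T
  · simp only [hc, hd, if_true, if_false, iff_true]
  · simp only [hc, hd, if_true, if_false]; exact h.slash_T_T

/-- Both generators permute the three conjugates in the way prescribed by the bottom row, so every
element of `SL₂(ℤ)` does. -/
theorem conjugate_slash (h : IsModularPair w a b f g) (γ δ : SL(2, ℤ)) :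
    conjugate w f g δ ∣[w] γ = conjugate w f g (δ * γ) := by
  have : γ ∈ Subgroup.closure {S, T} := by simp [SpecialLinearGroup.SL2Z_generators]
  induction this using Subgroup.closure_induction generalizing δ with
  | mem γ hγ =>
    rcases hγ with rfl | rfl
    · exact h.conjugate_mul_S δ
    · exact h.conjugate_mul_T δ
  | one => rw [SlashAction.slash_one, mul_one]
  | mul x y _ _ hx hy => rw [SlashAction.slash_mul, hx, hy, mul_assoc]
  | inv x _ hx =>
    have h1 := hx (δ * x⁻¹)
    rw [inv_mul_cancel_right] at h1
    rw [← h1, ← SlashAction.slash_mul, mul_inv_cancel, SlashAction.slash_one]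

theorem slash_left (h : IsModularPair w a b f g) (γ : SL(2, ℤ)) :
    f ∣[w] γ = conjugate w f g γ := by
  have h1 := h.conjugate_slash γ 1
  have h2 : conjugate w f g 1 = f := by simp [conjugate]
  rwa [h2, one_mul] at h1

theorem slash_right (h : IsModularPair w a b f g) (γ : SL(2, ℤ)) :
    g ∣[w] γ = conjugate w f g (S * γ) := by
  rw [← h.slash_S, ← SlashAction.slash_mul, h.slash_left]
  rw [h.slash_S]

theorem isBoundedAtImInfty_conjugate (h : IsModularPair w a b f g) (γ : SL(2, ℤ)) :
    IsBoundedAtImInfty (conjugate w f g γ) := by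
  rw [conjugate]
  split_ifs
  · exact isBoundedAtImInfty_of_hasSum h.hasSum_left
  · exact isBoundedAtImInfty_of_hasSum h.hasSum_right
  · exact (isBoundedAtImInfty_of_hasSum h.hasSum_right).slash w (g := (T : GL (Fin 2) ℝ))
      (by change ((T 1 0 : ℤ) : ℝ) = 0; rw [T_apply.2.2.1, Int.cast_zero])

/-- Holomorphy and boundedness at infinity follow from the `q`-series; the other cusps are reached
through the conjugates, which have `q`-series too. -/
theorem exists_modularForm_left (h : IsModularPair w a b f g) :
    ∃ F : ModularForm (CongruenceSubgroup.Gamma0 2 : Subgroup (GL (Fin 2) ℝ)) w, ∀ τ, F τ = f τ := by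
  refine ⟨{ toFun := f, slash_action_eq' := ?_, holo' := mdifferentiable_of_hasSum h.hasSum_left,
            bdd_at_cusps' := ?_ }, fun τ => rfl⟩
  · rintro _ ⟨γ, hγ, rfl⟩
    change f ∣[w] γ = f
    have : Even (γ 1 0) := by
      rw [even_iff_two_dvd]
      exact (ZMod.intCast_zmod_eq_zero_iff_dvd _ 2).mp (CongruenceSubgroup.Gamma0_mem.mp hγ)
    rw [h.slash_left, conjugate, if_pos this]
  · intro c hc
    refine (OnePoint.isBoundedAt_iff_forall_SL2Z (hc.mono ?_)).mpr fun γ _ => ?_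
    · rintro _ ⟨γ, -, rfl⟩
      exact ⟨γ, rfl⟩
    · rw [h.slash_left]
      exact h.isBoundedAtImInfty_conjugate γ

theorem exists_modularForm_right (h : IsModularPair w a b f g) :
    ∃ F : ModularForm (GammaUpper0Two : Subgroup (GL (Fin 2) ℝ)) w, ∀ τ, F τ = g τ := by
  refine ⟨{ toFun := g, slash_action_eq' := ?_, holo' := mdifferentiable_of_hasSum h.hasSum_right,
            bdd_at_cusps' := ?_ }, fun τ => rfl⟩
  · rintro _ ⟨γ, hγ, rfl⟩
    change g ∣[w] γ = g
    have hb : Even (γ 0 1) := by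
      rw [even_iff_two_dvd]
      exact (ZMod.intCast_zmod_eq_zero_iff_dvd _ 2).mp hγ
    have h1 : (S * γ) 1 1 = γ 0 1 := by
      rw [mul_one_one, S_apply.2.2.1, S_apply.2.2.2]; ring
    rw [← h1] at hb
    rw [h.slash_right, conjugate, if_neg fun hc => not_even_and_even _ hc hb, if_pos hb]
  · intro c hc
    refine (OnePoint.isBoundedAt_iff_forall_SL2Z (hc.mono ?_)).mpr fun γ _ => ?_
    · rintro _ ⟨γ, -, rfl⟩
      exact ⟨γ, rfl⟩
    · rw [h.slash_right]
      exact h.isBoundedAtImInfty_conjugate _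

theorem apply_S_smul (h : IsModularPair w a b f g) (τ : ℍ) : f (S • τ) = (τ : ℂ) ^ w * g τ := by
  rw [← h.slash_S, slash_S_apply, mul_left_comm, ← zpow_add₀ (ne_zero τ), add_neg_cancel, zpow_zero,
    mul_one]

end IsModularPair

end ModularPairs

/-! ### The Eisenstein pairs -/

section EisensteinPairs

open ModularForm ModularGroup EisensteinSeries

theorem bernoulli_ne_zero_of_even (k : ℕ) : (bernoulli (2 * k + 2) : ℂ) ≠ 0 := by
  have h1 := riemannZeta_two_mul_nat (k := k + 1) (by omega)
  have h2 : riemannZeta (2 * ((k + 1 : ℕ) : ℂ)) ≠ 0 := by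
    refine riemannZeta_ne_zero_of_one_le_re ?_
    norm_cast
    omega
  intro h0
  rw [h1, show 2 * (k + 1) = 2 * k + 2 by ring, h0] at h2
  simp at h2

/-- The Eisenstein series with coefficients `eisensteinCoeff k`, in the upper half plane, together
with its transformation law under `S`; the anomaly `c` occurs only in weight two. -/
theorem exists_eisenstein (k : ℕ) : ∃ (G : ℍ → ℂ) (c : ℂ), (k ≠ 0 → c = 0) ∧
    (∀ τ : ℍ, HasSum (fun N : ℕ => eisensteinCoeff k N *
      Complex.exp (2 * Real.pi * Complex.I * N * τ)) (G τ)) ∧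
    ∀ τ : ℍ, G (S • τ) = (τ : ℂ) ^ (2 * k + 2) * G τ + c * (τ : ℂ) ^ (2 * k + 1) := by
  have hB := bernoulli_ne_zero_of_even k
  have hk1 : (k : ℂ) + 1 ≠ 0 := Nat.cast_add_one_ne_zero k
  have hq (τ : ℍ) (N : ℕ) : Function.Periodic.qParam 1 (τ : ℂ) ^ N =
      Complex.exp (2 * Real.pi * Complex.I * N * τ) := by
    rw [Function.Periodic.qParam, ← Complex.exp_nat_mul]
    congr 1
    push_cast
    ring
  set b : ℂ := -(bernoulli (2 * k + 2) : ℂ) / (4 * (k + 1)) with hb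
  by_cases hk : k = 0
  · subst hk
    have hb' : b = -1 / 24 := by
      rw [hb, show 2 * 0 + 2 = 2 from rfl, bernoulli_two]; norm_num
    refine ⟨fun τ => b * E2 τ, b * (-(1 / (2 * riemannZeta 2)) * (2 * Real.pi * Complex.I)),
      fun h => absurd rfl h, fun τ => ?_, fun τ => ?_⟩
    · convert! (hasSum_qExpansion_E2 (z := τ)).mul_left b using 2 with N
      rw [← Complex.exp_nat_mul, eisensteinCoeff,
        show (N : ℂ) * (2 * Real.pi * Complex.I * τ) = 2 * Real.pi * Complex.I * N * τ by ring]
      split_ifs with hN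
      · rw [smul_eq_mul, one_mul]
      · rw [hb', smul_eq_mul]
        push_cast
        ring
    · have h1 := congrFun (E2_slash_action S) τ
      rw [slash_S_apply, Pi.sub_apply, Pi.smul_apply, D2_S, smul_eq_mul] at h1
      have hτ := ne_zero τ
      have h2 : E2 (S • τ) = (E2 τ - 1 / (2 * riemannZeta 2) * (2 * Real.pi * Complex.I / τ)) *
          (τ : ℂ) ^ 2 := by
        rw [← h1, zpow_neg, mul_assoc]
        norm_cast
        rw [inv_mul_cancel₀ (by exact_mod_cast pow_ne_zero 2 hτ), mul_one]
      beta_reduce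
      rw [h2]
      field_simp
      ring
  · have hw : 3 ≤ 2 * k + 2 := by omega
    refine ⟨fun τ => b * E hw τ, 0, fun _ => rfl, fun τ => ?_, fun τ => ?_⟩
    · convert! (ModularForm.hasSum_qExpansion (E hw) one_pos one_mem_strictPeriods_SL τ).mul_left b
        using 2 with N
      rw [hq, E_qExpansion_coeff hw ⟨k + 1, by ring⟩, eisensteinCoeff, ← mul_assoc]
      congr 1
      split_ifs with hN
      · rw [mul_one]
      · rw [hb, show 2 * k + 2 - 1 = 2 * k + 1 by omega]
        push_cast
        field_simp
        ring
    · have h1 := SlashInvariantForm.slash_action_eqn (E hw) (Matrix.SpecialLinearGroup.mapGL ℝ S)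
        ⟨S, rfl⟩
      change (E hw : ℍ → ℂ) ∣[((2 * k + 2 : ℕ) : ℤ)] S = E hw at h1
      have h2 := congrFun h1 τ
      rw [slash_S_apply, zpow_neg, zpow_natCast] at h2
      beta_reduce
      rw [← h2, zero_mul, add_zero]
      have hτ := pow_ne_zero (2 * k + 2) (ne_zero τ)
      field_simp

/-- The series of `exists_eisenstein` as a function of a complex variable. -/
theorem exists_eisenstein_complex (k : ℕ) : ∃ (G : ℂ → ℂ) (c : ℂ), (k ≠ 0 → c = 0) ∧
    (∀ z : ℂ, 0 < z.im → HasSum (fun N : ℕ => eisensteinCoeff k N *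
      Complex.exp (2 * Real.pi * Complex.I * N * z)) (G z)) ∧
    (∀ z : ℂ, 0 < z.im → G (z + 1) = G z) ∧
    ∀ z : ℂ, 0 < z.im → G (-1 / z) = z ^ (2 * k + 2) * G z + c * z ^ (2 * k + 1) := by
  obtain ⟨G, c, hc, hG, hS⟩ := exists_eisenstein k
  have h1 (z : ℂ) (hz : 0 < z.im) : HasSum (fun N : ℕ => eisensteinCoeff k N *
      Complex.exp (2 * Real.pi * Complex.I * N * z)) (G (ofComplex z)) := by
    rw [ofComplex_apply_of_im_pos hz]
    exact hG ⟨z, hz⟩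
  refine ⟨fun z => G (ofComplex z), c, hc, h1, fun z hz => ?_, fun z hz => ?_⟩
  · refine (h1 (z + 1) (by simpa using hz)).unique ?_
    convert h1 z hz using 3 with N
    rw [Complex.exp_eq_exp_iff_exists_int]
    refine ⟨N, ?_⟩
    push_cast
    ring
  · have h2 := hS ⟨z, hz⟩
    have h3 : ofComplex (-1 / z) = S • (⟨z, hz⟩ : ℍ) := by
      rw [← ofComplex_apply (S • (⟨z, hz⟩ : ℍ)), coe_S_smul]
    beta_reduce
    rw [h3, h2, ofComplex_apply_of_im_pos hz]

theorem im_neg_one_div_pos {z : ℂ} (hz : 0 < z.im) : 0 < (-1 / z).im := by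
  have h := (S • (⟨z, hz⟩ : ℍ)).im_pos
  rwa [← coe_im, coe_S_smul] at h

theorem hasSum_doubleIndex {a : ℕ → ℂ} {z s : ℂ}
    (h : HasSum (fun N : ℕ => a N * Complex.exp (2 * Real.pi * Complex.I * N * z)) s) :
    HasSum (fun N : ℕ => doubleIndex a N * Complex.exp (Real.pi * Complex.I * N * z)) s := by
  have hi : Function.Injective fun N : ℕ => 2 * N := fun x y hxy => by
    simpa using hxy
  refine (hi.hasSum_iff ?_).mp ?_
  · intro N hN
    have : ¬ 2 ∣ N := fun ⟨d, hd⟩ => hN ⟨d, hd.symm⟩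
    rw [doubleIndex, if_neg this, zero_mul]
  · convert h using 2 with N
    rw [Function.comp_apply, doubleIndex, if_pos (dvd_mul_right 2 N),
      Nat.mul_div_cancel_left _ two_pos]
    congr 2
    push_cast
    ring

/-- The series with coefficients `eisensteinCoeff₁ k` and `eisensteinCoeff₂ k` are modular of weight
`2k + 2`. In weight two the anomalies of the Eisenstein series cancel. -/
theorem exists_isModularPair_eisenstein (k : ℕ) : ∃ f g : ℍ → ℂ,
    IsModularPair ((2 * k + 2 : ℕ) : ℤ) (eisensteinCoeff₁ k) (eisensteinCoeff₂ k) f g := by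
  obtain ⟨G, c, hc, hG, hT, hS⟩ := exists_eisenstein_complex k
  set C : ℂ := ((2 * k + 1).factorial : ℂ)⁻¹ with hC
  have hdouble (τ : ℍ) : 0 < (2 * (τ : ℂ)).im := by simpa using τ.im_pos
  have hhalf (τ : ℍ) : 0 < ((τ : ℂ) / 2).im := by simpa using τ.im_pos
  have h1 (τ : ℍ) := hasSum_doubleIndex (hG τ τ.im_pos)
  have h2 (τ : ℍ) : HasSum (fun N : ℕ => doubleIndex (doubleIndex (eisensteinCoeff k)) N *
      Complex.exp (Real.pi * Complex.I * N * τ)) (G (2 * τ)) := by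
    refine hasSum_doubleIndex ?_
    convert hasSum_doubleIndex (hG (2 * τ) (hdouble τ)) using 4 with N
    ring
  have h3 (τ : ℍ) : HasSum (fun N : ℕ => eisensteinCoeff k N *
      Complex.exp (Real.pi * Complex.I * N * τ)) (G (τ / 2)) := by
    convert hG (τ / 2) (hhalf τ) using 4 with N
    ring
  have hSf : ((fun τ : ℍ => C * (2 * (G τ - 2 ^ (2 * k + 1) * G (2 * τ)))) : ℍ → ℂ)
      ∣[((2 * k + 2 : ℕ) : ℤ)] S = fun τ : ℍ => C * (2 * G τ - G (τ / 2)) := by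
    ext τ
    have hτ := ne_zero τ
    have e1 := hS τ τ.im_pos
    have e2 := hS _ (hhalf τ)
    rw [show -1 / ((τ : ℂ) / 2) = 2 * (-1 / τ) by field_simp] at e2
    rw [slash_S_apply, coe_S_smul, e1, e2, zpow_neg, zpow_natCast, div_pow, div_pow]
    field_simp
    ring
  refine ⟨fun τ => C * (2 * (G τ - 2 ^ (2 * k + 1) * G (2 * τ))),
    fun τ => C * (2 * G τ - G (τ / 2)), fun τ => ?_, fun τ => ?_, ?_, hSf, ?_, ?_⟩
  · convert! (((h1 τ).sub ((h2 τ).mul_left (2 ^ (2 * k + 1)))).mul_left 2).mul_left C using 2 with N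
    rw [eisensteinCoeff₁, ← hC]
    ring
  · convert! (((h1 τ).mul_left 2).sub (h3 τ)).mul_left C using 2 with N
    rw [eisensteinCoeff₂, ← hC]
    ring
  · ext τ
    rw [slash_T_apply, coe_T_smul, hT _ τ.im_pos, mul_add, mul_one, ← one_add_one_eq_two,
      ← add_assoc, one_add_one_eq_two, hT _ (by simpa using τ.im_pos), hT _ (hdouble τ)]
  · rw [← hSf, ← SlashAction.slash_mul]
    ext τ
    have h4 : (S * S : SL(2, ℤ)) = -1 := by
      ext i j
      fin_cases i <;> fin_cases j <;> rfl
    rw [h4, SL_slash_apply, ModularGroup.denom_apply, SL_neg_smul, one_smul]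
    have h5 : ((-1 : SL(2, ℤ)) 1 0 : ℤ) = 0 ∧ ((-1 : SL(2, ℤ)) 1 1 : ℤ) = -1 := ⟨rfl, rfl⟩
    rw [h5.1, h5.2]
    have h6 : Even (-((2 * k + 2 : ℕ) : ℤ)) := by
      rw [even_neg]
      exact ⟨(k + 1 : ℕ), by push_cast; ring⟩
    simp only [Int.cast_zero, Int.cast_neg, Int.cast_one, zero_mul, zero_add]
    rw [h6.neg_one_zpow, mul_one]
  · ext τ
    have hτ := ne_zero τ
    rw [slash_S_apply, slash_T_apply, slash_T_apply]
    simp only [coe_T_smul, coe_S_smul]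
    -- Invariance of `f|ST` under `S`: as `½ (Sτ + 1)` is the image of `u = ½ (τ + 1)` under `T S T² S`,
    -- the value of `G` there is known from the transformation laws of `G` alone.
    set u : ℂ := ((τ : ℂ) + 1) / 2 with hu
    have him : 0 < u.im := by simpa [hu] using τ.im_pos
    have hu0 : u ≠ 0 := fun h0 => by simp [h0] at him
    have hz : (τ : ℂ) = 2 * u - 1 := by rw [hu]; ring
    have hz0 : 2 * u - 1 ≠ 0 := hz ▸ hτ
    have him1 := im_neg_one_div_pos him
    have him2 : 0 < (-1 / u + 1 + 1).im := by simpa using him1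
    have e4 := hS _ him2
    rw [hT _ (by simpa using him1), hT _ him1, hS u him] at e4
    have hw0 : -1 / u + 1 + 1 = τ / u := by rw [hz]; field_simp; ring
    have hw1 : (-1 / (τ : ℂ) + 1) / 2 = -1 / (-1 / u + 1 + 1) + 1 := by
      rw [hw0, hz]; field_simp; ring
    clear_value u
    rw [hT _ (im_neg_one_div_pos τ.im_pos), hT _ τ.im_pos, hS τ τ.im_pos, hw1,
      hT _ (im_neg_one_div_pos him2), e4, hw0, zpow_neg, zpow_natCast, div_pow, div_pow]
    have hanomaly : 2 * (c * (τ : ℂ) ^ (2 * k + 1)) =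
        (τ : ℂ) ^ (2 * k + 2) / u ^ (2 * k + 2) * (c * u ^ (2 * k + 1)) +
          c * ((τ : ℂ) ^ (2 * k + 1) / u ^ (2 * k + 1)) := by
      by_cases hk : k = 0
      · subst hk
        rw [hz]
        field_simp
        ring
      · rw [hc hk]; ring
    rw [mul_inv_eq_iff_eq_mul₀ (pow_ne_zero _ hτ), mul_assoc]
    congr 1
    have e5 : (τ : ℂ) ^ (2 * k + 2) / u ^ (2 * k + 2) * (u ^ (2 * k + 2) * G u) =
        (τ : ℂ) ^ (2 * k + 2) * G u := by
      field_simp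
    linear_combination hanomaly - e5

end EisensteinPairs

/-! ### Modular pairs with values in the even forms -/

section ValuedPairs

/-- Modular pairs with values in an algebra, tested on linear functionals. -/
def IsModularPairValued {W : Type*} [Ring W] [Algebra ℂ W] (w : ℤ) (a b : ℕ → W)
    (P Q : ℍ → W) : Prop :=
  ∀ l : W →ₗ[ℂ] ℂ, IsModularPair w (l ∘ a) (l ∘ b) (l ∘ P) (l ∘ Q)

namespace IsModularPairValued

section

variable {W : Type*} [Ring W] [Algebra ℂ W] {w : ℤ} {a b : ℕ → W} {P Q : ℍ → W}

theorem sum {κ : Type*} (s : Finset κ) {a b : κ → ℕ → W} {P Q : κ → ℍ → W}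
    (h : ∀ k ∈ s, IsModularPairValued w (a k) (b k) (P k) (Q k)) :
    IsModularPairValued w (∑ k ∈ s, a k) (∑ k ∈ s, b k) (∑ k ∈ s, P k) (∑ k ∈ s, Q k) := by
  classical
  intro l
  induction s using Finset.induction_on with
  | empty =>
    simp only [Finset.sum_empty]
    convert IsModularPair.zero w using 1 <;> ext <;> simp
  | insert k s hk ih =>
    simp only [Finset.sum_insert hk]
    convert (h k (Finset.mem_insert_self k s) l).add
      (ih fun k hk => h k (Finset.mem_insert_of_mem hk)) using 1 <;> ext <;> simp

theorem smul (c : ℂ) (h : IsModularPairValued w a b P Q) :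
    IsModularPairValued w (c • a) (c • b) (c • P) (c • Q) := by
  intro l
  convert (h l).smul c using 1 <;> ext <;> simp

theorem map {W' : Type*} [Ring W'] [Algebra ℂ W'] (φ : W →ₐ[ℂ] W')
    (h : IsModularPairValued w a b P Q) : IsModularPairValued w (φ ∘ a) (φ ∘ b) (φ ∘ P) (φ ∘ Q) :=
  fun l => h (l ∘ₗ φ.toLinearMap)

theorem hasQSum_left (h : IsModularPairValued w a b P Q) (τ : ℍ) : HasQSum a τ (P τ) :=
  fun l => (h l).hasSum_left τ

theorem hasQSum_right (h : IsModularPairValued w a b P Q) (τ : ℍ) : HasQSum b τ (Q τ) :=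
  fun l => (h l).hasSum_right τ

theorem isModularFormValued_left (h : IsModularPairValued w a b P Q) :
    IsModularFormValued (CongruenceSubgroup.Gamma0 2) w P :=
  fun l => (h l).exists_modularForm_left

theorem isModularFormValued_right (h : IsModularPairValued w a b P Q) :
    IsModularFormValued GammaUpper0Two w Q :=
  fun l => (h l).exists_modularForm_right

theorem apply_S_smul (h : IsModularPairValued w a b P Q) (τ : ℍ) :
    P (ModularGroup.S • τ) = ((τ : ℂ) ^ w) • Q τ := by
  refine Module.forall_dual_apply_eq_zero_iff ℂ _ |>.mp (fun l => ?_) |> sub_eq_zero.mp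
  have := (h l).apply_S_smul τ
  rw [Function.comp_apply, Function.comp_apply] at this
  rw [map_sub, map_smul, this, smul_eq_mul, sub_self]

theorem const (x : W) : IsModularPairValued 0 (fun N => (if N = 0 then (1 : ℂ) else 0) • x)
    (fun N => (if N = 0 then (1 : ℂ) else 0) • x) (fun _ => x) (fun _ => x) := by
  intro l
  convert IsModularPair.one.smul (l x) using 1 <;> ext <;> simp [mul_comm, apply_ite l]

end

/-- The product of a pair of scalar modular forms with a vector-valued pair, multiplied by a constant
element `p`; the summands of the recursion on the degree have this form. -/
theorem mul {A : Type*} [CommRing A] [Algebra ℂ A] {w w' : ℤ} {a b : ℕ → A} {P Q : ℍ → A}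
    {c d : ℕ → ℂ} {f g : ℍ → ℂ} (h : IsModularPairValued w a b P Q)
    (h' : IsModularPair w' c d f g) (p : A) :
    IsModularPairValued (w + w')
      (fun N => ∑ ij ∈ Finset.HasAntidiagonal.antidiagonal N, c ij.2 • (a ij.1 * p))
      (fun N => ∑ ij ∈ Finset.HasAntidiagonal.antidiagonal N, d ij.2 • (b ij.1 * p))
      (fun τ => f τ • (P τ * p)) (fun τ => g τ • (Q τ * p)) := by
  intro l
  convert (h (l ∘ₗ LinearMap.mulRight ℂ p)).mul h' using 1 <;> ext <;> simp [mul_comm]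

end IsModularPairValued

open PowerSeries EvenForms

variable {T : Type*} [AddCommGroup T] [Module ℝ T] [FiniteDimensional ℝ T]

/-- Two series whose logarithmic derivatives are built from the two families of Eisenstein series,
and which have proportional components of degree zero, have modular components: by
`HasLogDeriv.smul_part` the component of degree `2w` is a combination of products of Eisenstein series
of weight `2k + 2` with components of degree `2w - 2(2k + 2)`. -/
theorem exists_isModularPairValued_part {Φ Ψ : (EvenForms T)⟦X⟧} {K : ℕ} {p : ℕ → EvenForms T}
    (hp : ∀ k, IsHomogeneous (2 * k + 2) (p k)) (x : ℂ)
    (hΦ : HasLogDeriv euler Φ (mk fun N => ∑ k ∈ Finset.range K, eisensteinCoeff₁ k N • p k))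
    (hΨ : HasLogDeriv euler Ψ (mk fun N => ∑ k ∈ Finset.range K, eisensteinCoeff₂ k N • p k))
    (hΦ0 : ∀ N, part 0 (coeff N Φ) = (if N = 0 then x else 0) • (1 : EvenForms T))
    (hΨ0 : ∀ N, part 0 (coeff N Ψ) = (if N = 0 then (1 : ℂ) else 0) • (1 : EvenForms T)) (w : ℕ) :
    ∃ P Q : ℍ → EvenForms T, IsModularPairValued (w : ℤ) (fun N => part w (coeff N Φ))
      (fun N => x • part w (coeff N Ψ)) P Q := by
  choose f g hfg using exists_isModularPair_eisenstein
  induction w using Nat.strong_induction_on with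
  | _ w ih =>
    rcases Nat.eq_zero_or_pos w with rfl | hw
    · refine ⟨fun _ => x • 1, fun _ => x • 1, ?_⟩
      rw [Nat.cast_zero]
      convert IsModularPairValued.const (x • (1 : EvenForms T)) using 1
      · funext N; rw [hΦ0]; split_ifs <;> simp
      · funext N; rw [hΨ0, smul_comm]
    · have hw0 : (w : ℂ) ≠ 0 := Nat.cast_ne_zero.mpr hw.ne'
      have ih' (k : ℕ) (hk : k ∈ (Finset.range K).filter fun k => 2 * k + 2 ≤ w) :
          ∃ P Q : ℍ → EvenForms T, IsModularPairValued (w : ℤ)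
            (fun N => ∑ ij ∈ Finset.HasAntidiagonal.antidiagonal N,
              eisensteinCoeff₁ k ij.2 • (part (w - (2 * k + 2)) (coeff ij.1 Φ) * p k))
            (fun N => ∑ ij ∈ Finset.HasAntidiagonal.antidiagonal N,
              eisensteinCoeff₂ k ij.2 • ((x • part (w - (2 * k + 2)) (coeff ij.1 Ψ)) * p k)) P Q := by
        have hk' := (Finset.mem_filter.mp hk).2
        obtain ⟨P, Q, h⟩ := ih (w - (2 * k + 2)) (by omega)
        have := h.mul (hfg k) (p k)
        rw [← Nat.cast_add, Nat.sub_add_cancel hk'] at this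
        exact ⟨_, _, this⟩
      choose! P Q hPQ using ih'
      have h := (IsModularPairValued.sum _ hPQ).smul ((w : ℂ)⁻¹)
      have h1 : (fun N => part w (coeff N Φ)) = (w : ℂ)⁻¹ •
          ∑ k ∈ Finset.range K with 2 * k + 2 ≤ w, fun N =>
            ∑ ij ∈ Finset.HasAntidiagonal.antidiagonal N,
              eisensteinCoeff₁ k ij.2 • (part (w - (2 * k + 2)) (coeff ij.1 Φ) * p k) := by
        funext N
        rw [Pi.smul_apply, Finset.sum_apply, ← hΦ.smul_part hp, smul_smul, inv_mul_cancel₀ hw0,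
          one_smul]
      have h2 : (fun N => x • part w (coeff N Ψ)) = (w : ℂ)⁻¹ •
          ∑ k ∈ Finset.range K with 2 * k + 2 ≤ w, fun N =>
            ∑ ij ∈ Finset.HasAntidiagonal.antidiagonal N,
              eisensteinCoeff₂ k ij.2 • ((x • part (w - (2 * k + 2)) (coeff ij.1 Ψ)) * p k) := by
        funext N
        rw [Pi.smul_apply, Finset.sum_apply]
        simp only [smul_mul_assoc, smul_comm _ x, ← Finset.smul_sum]
        rw [← hΨ.smul_part hp, smul_smul, smul_smul, inv_mul_cancel_right₀ hw0]
      rw [h1, h2]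
      exact ⟨_, _, h⟩

variable {ι : Type*} [Fintype ι] [DecidableEq ι]

/-- The components of `L̂ · ch(Θ₁)` and `Â · ch(Θ₂)` are modular, for a matrix of 2-forms whose
odd powers have trace zero. -/
theorem exists_modular_coeffs {R : Matrix ι ι (EvenForms T)} (hR : ∀ i j, IsHomogeneous 1 (R i j))
    (hodd : ∀ k, (R ^ (2 * k + 1)).trace = 0) (w : ℕ) :
    ∃ P Q : ℍ → Forms T,
      (∀ τ, HasQSum (P₁Coeff (2 * w) R) τ (P τ)) ∧ (∀ τ, HasQSum (P₂Coeff (2 * w) R) τ (Q τ)) ∧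
      IsModularFormValued (CongruenceSubgroup.Gamma0 2) w P ∧
      IsModularFormValued GammaUpper0Two w Q ∧
      ∀ τ : ℍ, P (ModularGroup.S • τ) =
        (((2 : ℝ) ^ ((Fintype.card ι : ℝ) / 2) : ℝ) * (τ : ℂ) ^ w) • Q τ := by
  set U : Matrix ι ι (EvenForms T) := (Complex.I / (2 * Real.pi)) • R with hU
  have hUh (i j) : IsHomogeneous 1 (U i j) := (hR i j).smul _
  obtain ⟨K, hK⟩ := exists_matrix_pow_eq_zero hUh
  have hK2 : U ^ (2 * K) = 0 := by rw [mul_comm, pow_mul, hK, zero_pow two_ne_zero]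
  have hUodd (k : ℕ) : (U ^ (2 * k + 1)).trace = 0 := by
    rw [hU, smul_pow, Matrix.trace_smul, hodd, smul_zero]
  set x : ℂ := (((2 : ℝ) ^ ((Fintype.card ι : ℝ) / 2) : ℝ) : ℂ) with hx
  have hx0 : x ≠ 0 := by
    rw [hx, Complex.ofReal_ne_zero]
    exact (Real.rpow_pos_of_pos two_pos _).ne'
  obtain ⟨P, Q, h⟩ := exists_isModularPairValued_part
    (fun k => isHomogeneous_trace_pow hUh (2 * k + 2)) x
    (hasLogDeriv_lHatForm_mul_chTheta₁ hR hK2 hUodd) (hasLogDeriv_aHatForm_mul_chTheta₂ hR hK2 hUodd)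
    (part_zero_lHatForm_mul_chTheta₁ hR) (part_zero_aHatForm_mul_chTheta₂ hR) w
  have h1 := h.map toForms
  have h2 := h1.smul x⁻¹
  have e1 : P₁Coeff (2 * w) R =
      toForms ∘ fun N => part w (coeff N (C (lHatForm R) * chTheta₁ R)) := by
    funext N
    rw [P₁Coeff, component_two_mul, Function.comp_apply, coeff_C_mul]
  have e2 : P₂Coeff (2 * w) R = x⁻¹ •
      (toForms ∘ fun N => x • part w (coeff N (C (aHatForm R) * chTheta₂ R))) := by
    funext N
    rw [P₂Coeff, component_two_mul, Pi.smul_apply, Function.comp_apply, map_smul, smul_smul,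
      inv_mul_cancel₀ hx0, one_smul, coeff_C_mul]
  refine ⟨_, _, fun τ => e1 ▸ h1.hasQSum_left τ, fun τ => e2 ▸ h2.hasQSum_right τ,
    h1.isModularFormValued_left, h2.isModularFormValued_right, fun τ => ?_⟩
  rw [h1.apply_S_smul, Pi.smul_apply, smul_smul, mul_right_comm, mul_inv_cancel₀ hx0, one_mul,
    zpow_natCast]

end ValuedPairs

/-! ### Second derivatives of functions along vector fields -/

section Commutator

open VectorField

variable {d : ℕ} {M : Type*} [TopologicalSpace M] [ChartedSpace (EuclideanSpace ℝ (Fin d)) M]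
  [IsManifold (𝓡 d) ∞ M]

/-- `U(Vf) - V(Uf) = [U, V]f`. In terms of Lie brackets this is the Jacobi identity for `U`, `V`
and `fW`, where `W` is any vector field that does not vanish at the point. -/
theorem mvfderiv_mvfderiv_sub {U V : (x : M) → TangentSpace (𝓡 d) x} {f : M → ℝ} {x : M}
    (hU : ContMDiffAt (𝓡 d) (𝓡 d).tangent ∞ (fun y => (⟨y, U y⟩ : TangentBundle (𝓡 d) M)) x)
    (hV : ContMDiffAt (𝓡 d) (𝓡 d).tangent ∞ (fun y => (⟨y, V y⟩ : TangentBundle (𝓡 d) M)) x)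
    (hf : ContMDiffAt (𝓡 d) 𝓘(ℝ, ℝ) ∞ f x)
    (hUf : MDifferentiableAt (𝓡 d) 𝓘(ℝ, ℝ) (fun y => mvfderiv (𝓡 d) f y (U y)) x)
    (hVf : MDifferentiableAt (𝓡 d) 𝓘(ℝ, ℝ) (fun y => mvfderiv (𝓡 d) f y (V y)) x) :
    mvfderiv (𝓡 d) (fun y => mvfderiv (𝓡 d) f y (V y)) x (U x)
      - mvfderiv (𝓡 d) (fun y => mvfderiv (𝓡 d) f y (U y)) x (V x)
      = mvfderiv (𝓡 d) f x (mlieBracket (𝓡 d) U V x) := by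
  rcases subsingleton_or_nontrivial (TangentSpace (𝓡 d) x) with h | h
  · rw [Subsingleton.elim (U x) 0, Subsingleton.elim (V x) 0,
      Subsingleton.elim (mlieBracket (𝓡 d) U V x) 0, map_zero, map_zero, map_zero, sub_zero]
  obtain ⟨w, hw⟩ := exists_ne (0 : TangentSpace (𝓡 d) x)
  have : IsManifold (𝓡 d) 1 M := .of_le (n := ∞) ENat.LEInfty.out
  have : IsManifold (𝓡 d) 2 M := .of_le (n := ∞) ENat.LEInfty.out
  have i3 : IsManifold (𝓡 d) 3 M := .of_le (n := ∞) ENat.LEInfty.out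
  have : IsManifold (𝓡 d) (minSmoothness ℝ 2) M := by simpa using ‹IsManifold (𝓡 d) 2 M›
  have : IsManifold (𝓡 d) (minSmoothness ℝ 3) M := by simpa using ‹IsManifold (𝓡 d) 3 M›
  set W : (y : M) → TangentSpace (𝓡 d) y := FiberBundle.extend (EuclideanSpace ℝ (Fin d)) w with hWdef
  have hWx : W x = w := FiberBundle.extend_apply_self ..
  have hW : ContMDiffAt (𝓡 d) (𝓡 d).tangent ∞ (fun y => (⟨y, W y⟩ : TangentBundle (𝓡 d) M)) x :=
    FiberBundle.contMDiffAt_extend (𝓡 d) (EuclideanSpace ℝ (Fin d)) w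
  clear_value W
  have hle2 : (2 : WithTop ℕ∞) ≤ ∞ := ENat.LEInfty.out
  have hle1 : (1 : WithTop ℕ∞) ≤ ∞ := ENat.LEInfty.out
  have hW1 := (contMDiffAt_iff_contMDiffAt_nhds (by simp)).1 (hW.of_le hle1)
  have hf1 := (contMDiffAt_iff_contMDiffAt_nhds (by simp)).1 (hf.of_le hle1)
  have hfd : MDifferentiableAt (𝓡 d) 𝓘(ℝ, ℝ) f x := hf.mdifferentiableAt (by simp)
  have hWd := hW.mdifferentiableAt (by simp)
  have bracket_smul (X : (y : M) → TangentSpace (𝓡 d) y) :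
      mlieBracket (𝓡 d) X (f • W) =ᶠ[nhds x]
        ((fun y => mvfderiv (𝓡 d) f y (X y)) • W + f • mlieBracket (𝓡 d) X W) := by
    filter_upwards [hW1, hf1] with y hWy hfy
    exact mlieBracket_smul_right (hfy.mdifferentiableAt one_ne_zero)
      (hWy.mdifferentiableAt one_ne_zero)
  have bracket_bracket {X X' : (y : M) → TangentSpace (𝓡 d) y}
      (hX' : ContMDiffAt (𝓡 d) (𝓡 d).tangent ∞
        (fun y => (⟨y, X' y⟩ : TangentBundle (𝓡 d) M)) x)
      (hXf : MDifferentiableAt (𝓡 d) 𝓘(ℝ, ℝ) (fun y => mvfderiv (𝓡 d) f y (X' y)) x) :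
      mlieBracket (𝓡 d) X (mlieBracket (𝓡 d) X' (f • W)) x =
        (mvfderiv (𝓡 d) (fun y => mvfderiv (𝓡 d) f y (X' y)) x (X x) • W x
          + mvfderiv (𝓡 d) f x (X' x) • mlieBracket (𝓡 d) X W x)
        + (mvfderiv (𝓡 d) f x (X x) • mlieBracket (𝓡 d) X' W x
          + f x • mlieBracket (𝓡 d) X (mlieBracket (𝓡 d) X' W) x) := by
    have hB : MDifferentiableAt (𝓡 d) (𝓡 d).tangent
        (fun y => (⟨y, mlieBracket (𝓡 d) X' W y⟩ : TangentBundle (𝓡 d) M)) x := by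
      have i3' : IsManifold (𝓡 d) (((2 : ℕ∞) : WithTop ℕ∞) + 1) M := by
        convert i3 using 1
        norm_num
      exact (ContMDiffAt.mlieBracket_vectorField (m := 1) (n := 2) (hX'.of_le hle2)
        (hW.of_le hle2) (by simp; norm_num)).mdifferentiableAt one_ne_zero
    rw [Filter.EventuallyEq.mlieBracket_vectorField_eq (Filter.EventuallyEq.refl _ X)
      (bracket_smul X'), mlieBracket_add_right, mlieBracket_smul_right hXf hWd,
      mlieBracket_smul_right hfd hB]
    · exact hXf.smul_section hWd
    · exact hfd.smul_section hB
  have jacobi := leibniz_identity_mlieBracket_apply (I := 𝓡 d) (U := U) (V := V) (W := f • W)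
    (x := x) (by simpa using hU.of_le hle2) (by simpa using hV.of_le hle2)
    (by simpa using (hf.smul_section hW).of_le hle2)
  rw [bracket_bracket hV hVf, bracket_bracket hU hUf, mlieBracket_smul_right hfd hWd,
    leibniz_identity_mlieBracket_apply (I := 𝓡 d) (U := U) (V := V) (W := W)
    (x := x) (by simpa using hU.of_le hle2) (by simpa using hV.of_le hle2)
    (by simpa using hW.of_le hle2)] at jacobi
  have key : (mvfderiv (𝓡 d) (fun y => mvfderiv (𝓡 d) f y (V y)) x (U x)
      - mvfderiv (𝓡 d) (fun y => mvfderiv (𝓡 d) f y (U y)) x (V x)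
      - mvfderiv (𝓡 d) f x (mlieBracket (𝓡 d) U V x)) • W x = 0 := by
    rw [← sub_eq_zero] at jacobi
    rw [← jacobi, hWx]
    module
  rw [hWx] at key
  exact sub_eq_zero.1 ((smul_eq_zero.1 key).resolve_right hw)

end Commutator

/-! ### The curvature of the vertical connection is skew -/

section VerticalConnection

open VectorField

variable {p d : ℕ}
  {Y : Type*} [TopologicalSpace Y] [ChartedSpace (EuclideanSpace ℝ (Fin p)) Y]
  [IsManifold (𝓡 p) ∞ Y]
  {M : Type*} [TopologicalSpace M] [ChartedSpace (EuclideanSpace ℝ (Fin d)) M]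
  [IsManifold (𝓡 d) ∞ M]

/-- The vector field `X` is smooth on the set `s`. Smoothness at a point would not do, as a covariant
derivative is only known to preserve smoothness on open sets. -/
abbrev IsSmoothFieldOn (X : (x : M) → TangentSpace (𝓡 d) x) (s : Set M) : Prop :=
  ContMDiffOn (𝓡 d) (𝓡 d).tangent ∞ (fun y => (⟨y, X y⟩ : TangentBundle (𝓡 d) M)) s

theorem exists_isSmoothFieldOn_extend {x : M} (v : TangentSpace (𝓡 d) x) :
    ∃ s ∈ nhds x, IsSmoothFieldOn (FiberBundle.extend (EuclideanSpace ℝ (Fin d)) v) s :=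
  FiberBundle.exists_contMDiffOn_extend (𝓡 d) (EuclideanSpace ℝ (Fin d)) v

theorem Filter.EventuallyEq.mvfderiv_eq {f g : M → ℝ} {x : M} (h : f =ᶠ[nhds x] g) :
    mvfderiv (𝓡 d) f x = mvfderiv (𝓡 d) g x := by
  ext v
  exact DFunLike.congr_fun (F := EuclideanSpace ℝ (Fin d) →L[ℝ] ℝ)
    (h.mfderiv_eq (I := 𝓡 d) (I' := 𝓘(ℝ, ℝ))) v

namespace FamilyGeometry

variable {pr : M → Y} (G : FamilyGeometry p d pr)
  {cov : CovariantDerivative (𝓡 d) (EuclideanSpace ℝ (Fin d)) (TangentSpace (𝓡 d) : M → Type _)}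

theorem mfderiv_apply_vert {x : M} (w : verticalSpace p d pr x) :
    mfderiv (𝓡 d) (𝓡 p) pr x (w : TangentSpace (𝓡 d) x) = 0 := w.2

theorem metric_apply_vert {x : M} (u : TangentSpace (𝓡 d) x) (w : verticalSpace p d pr x) :
    G.metric x u w = G.vertMetric x u w := by
  rw [metric, mfderiv_apply_vert, map_zero, zero_add]

theorem metric_vert_apply {x : M} (w : verticalSpace p d pr x) (u : TangentSpace (𝓡 d) x) :
    G.metric x w u = G.vertMetric x w u := by
  rw [metric, mfderiv_apply_vert, map_zero, zero_apply, zero_add]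

theorem vertMetric_projZ_left {x : M} (u w : TangentSpace (𝓡 d) x) :
    G.vertMetric x (G.projZ x u) w = G.vertMetric x u w := by
  have h : u - G.projZ x u ∈ G.hor x := by
    have := Submodule.projectionOnto_apply_eq_zero_iff (G.isCompl x) (x := u - G.projZ x u)
    rw [← this, map_sub, Submodule.projectionOnto_apply_left]
    exact sub_self _
  have h' := G.vertMetric_hor x _ w h
  rw [map_sub, sub_apply, sub_eq_zero] at h'
  exact h'.symm

theorem vertMetric_projZ_right {x : M} (u w : TangentSpace (𝓡 d) x) :
    G.vertMetric x u (G.projZ x w) = G.vertMetric x u w := by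
  rw [G.vertMetric_symm, vertMetric_projZ_left, G.vertMetric_symm]

/-- `∇^Z` is compatible with `g^Z`. -/
theorem mvfderiv_vertMetric (hL : IsLeviCivita G.metric cov)
    {A B : (x : M) → verticalSpace p d pr x} {x : M}
    (hA : MDifferentiableAt (𝓡 d) (𝓡 d).tangent
      (fun y => (⟨y, A y⟩ : TangentBundle (𝓡 d) M)) x)
    (hB : MDifferentiableAt (𝓡 d) (𝓡 d).tangent
      (fun y => (⟨y, B y⟩ : TangentBundle (𝓡 d) M)) x) (v : TangentSpace (𝓡 d) x) :
    mvfderiv (𝓡 d) (fun y => G.vertMetric y (A y) (B y)) x v =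
      G.vertMetric x (G.connZ cov A x v) (B x) + G.vertMetric x (A x) (G.connZ cov B x v) := by
  have h := hL.metric (fun y => (A y : TangentSpace (𝓡 d) y)) (fun y => B y) x hA hB v
  simp only [metric_apply_vert, metric_vert_apply] at h
  rw [h, connZ, connZ, vertMetric_projZ_left, vertMetric_projZ_right]

theorem isSmoothFieldOn_projZ {X : (x : M) → TangentSpace (𝓡 d) x} {s : Set M}
    (hX : IsSmoothFieldOn X s) :
    IsSmoothFieldOn (fun y => (G.projZ y (X y) : TangentSpace (𝓡 d) y)) s :=
  ContMDiffOn.clm_bundle_apply (F₁ := EuclideanSpace ℝ (Fin d)) (F₂ := EuclideanSpace ℝ (Fin d))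
    (E₁ := (TangentSpace (𝓡 d) : M → Type _)) (E₂ := (TangentSpace (𝓡 d) : M → Type _))
    (b := id) G.contMDiff_hor.contMDiffOn hX

theorem contMDiffOn_vertMetric {A B : (x : M) → TangentSpace (𝓡 d) x} {s : Set M}
    (hA : IsSmoothFieldOn A s) (hB : IsSmoothFieldOn B s) :
    ContMDiffOn (𝓡 d) 𝓘(ℝ, ℝ) ∞ (fun y => G.vertMetric y (A y) (B y)) s := by
  have h := ContMDiffOn.clm_bundle_apply₂ (F₁ := EuclideanSpace ℝ (Fin d))
    (F₂ := EuclideanSpace ℝ (Fin d)) (F₃ := ℝ)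
    (E₁ := (TangentSpace (𝓡 d) : M → Type _)) (E₂ := (TangentSpace (𝓡 d) : M → Type _))
    (E₃ := Bundle.Trivial M ℝ)
    (b := id) G.contMDiff_vertMetric.contMDiffOn hA hB
  intro y hy
  have := h y hy
  rw [contMDiffWithinAt_totalSpace] at this
  exact this.2

theorem isSmoothFieldOn_connZ (hL : IsLeviCivita G.metric cov)
    {A : (x : M) → verticalSpace p d pr x} {V : (x : M) → TangentSpace (𝓡 d) x} {s : Set M}
    (hs : IsOpen s) (hA : IsSmoothFieldOn (fun y => (A y : TangentSpace (𝓡 d) y)) s)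
    (hV : IsSmoothFieldOn V s) :
    IsSmoothFieldOn (fun y => (G.connZ cov A y (V y) : TangentSpace (𝓡 d) y)) s := by
  refine G.isSmoothFieldOn_projZ (X := fun y => cov (fun y => (A y : TangentSpace (𝓡 d) y)) y (V y)) ?_
  exact ContMDiffOn.clm_bundle_apply (F₁ := EuclideanSpace ℝ (Fin d))
    (F₂ := EuclideanSpace ℝ (Fin d))
    (E₁ := (TangentSpace (𝓡 d) : M → Type _)) (E₂ := (TangentSpace (𝓡 d) : M → Type _))
    (b := id) ((hL.smooth s hs).contMDiff hA) hV

/-- Differentiating `g^Z(A, B)` along `V` and then along `U` produces `g^Z(∇_U ∇_V A, B)`,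
`g^Z(A, ∇_U ∇_V B)` and two terms that are symmetric in `U` and `V` together. -/
theorem mvfderiv_mvfderiv_vertMetric (hL : IsLeviCivita G.metric cov)
    {A B : (x : M) → verticalSpace p d pr x} {V : (x : M) → TangentSpace (𝓡 d) x} {s : Set M}
    (hs : IsOpen s) (hA : IsSmoothFieldOn (fun y => (A y : TangentSpace (𝓡 d) y)) s)
    (hB : IsSmoothFieldOn (fun y => (B y : TangentSpace (𝓡 d) y)) s)
    (hV : IsSmoothFieldOn V s) {x : M} (hx : x ∈ s) (u : TangentSpace (𝓡 d) x) :
    MDifferentiableAt (𝓡 d) 𝓘(ℝ, ℝ)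
      (fun y => mvfderiv (𝓡 d) (fun y => G.vertMetric y (A y) (B y)) y (V y)) x ∧
    mvfderiv (𝓡 d)
      (fun y => mvfderiv (𝓡 d) (fun y => G.vertMetric y (A y) (B y)) y (V y)) x u =
      (G.vertMetric x (G.connZ cov (fun y => G.connZ cov A y (V y)) x u) (B x)
        + G.vertMetric x (G.connZ cov A x (V x)) (G.connZ cov B x u))
      + (G.vertMetric x (G.connZ cov A x u) (G.connZ cov B x (V x))
        + G.vertMetric x (A x) (G.connZ cov (fun y => G.connZ cov B y (V y)) x u)) := by
  have hVA := G.isSmoothFieldOn_connZ hL hs hA hV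
  have hVB := G.isSmoothFieldOn_connZ hL hs hB hV
  have at_x {X : (x : M) → TangentSpace (𝓡 d) x} (h : IsSmoothFieldOn X s) {y : M} (hy : y ∈ s) :=
    (h.contMDiffAt (hs.mem_nhds hy)).mdifferentiableAt (by simp)
  have heq : (fun y => mvfderiv (𝓡 d) (fun y => G.vertMetric y (A y) (B y)) y (V y)) =ᶠ[nhds x]
      ((fun y => G.vertMetric y (G.connZ cov A y (V y)) (B y))
        + fun y => G.vertMetric y (A y) (G.connZ cov B y (V y))) := by
    filter_upwards [hs.mem_nhds hx] with y hy
    exact G.mvfderiv_vertMetric hL (at_x hA hy) (at_x hB hy) (V y)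
  have h1 : MDifferentiableAt (𝓡 d) 𝓘(ℝ, ℝ)
      (fun y => G.vertMetric y (G.connZ cov A y (V y)) (B y)) x :=
    ((G.contMDiffOn_vertMetric hVA hB).contMDiffAt (hs.mem_nhds hx)).mdifferentiableAt (by simp)
  have h2 : MDifferentiableAt (𝓡 d) 𝓘(ℝ, ℝ)
      (fun y => G.vertMetric y (A y) (G.connZ cov B y (V y))) x :=
    ((G.contMDiffOn_vertMetric hA hVB).contMDiffAt (hs.mem_nhds hx)).mdifferentiableAt (by simp)
  refine ⟨(h1.add h2).congr_of_eventuallyEq heq, ?_⟩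
  rw [heq.mvfderiv_eq, mvfderiv_add h1 h2, add_apply,
    G.mvfderiv_vertMetric hL (at_x hVA hx) (at_x hB hx),
    G.mvfderiv_vertMetric hL (at_x hA hx) (at_x hVB hx)]

/-- Skewness of the curvature operator, for sections and vector fields: the symmetric terms of
`mvfderiv_mvfderiv_vertMetric` cancel, and `U(Vh) - V(Uh) = [U, V]h` for `h = g^Z(A, B)`. -/
theorem vertMetric_curvature (hL : IsLeviCivita G.metric cov)
    {A B : (x : M) → verticalSpace p d pr x} {U V : (x : M) → TangentSpace (𝓡 d) x} {s : Set M}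
    (hs : IsOpen s) (hA : IsSmoothFieldOn (fun y => (A y : TangentSpace (𝓡 d) y)) s)
    (hB : IsSmoothFieldOn (fun y => (B y : TangentSpace (𝓡 d) y)) s)
    (hU : IsSmoothFieldOn U s) (hV : IsSmoothFieldOn V s) {x : M} (hx : x ∈ s) :
    G.vertMetric x ↑(G.connZ cov (fun y => G.connZ cov A y (V y)) x (U x)
        - G.connZ cov (fun y => G.connZ cov A y (U y)) x (V x)
        - G.connZ cov A x (mlieBracket (𝓡 d) U V x)) (B x)
      + G.vertMetric x (A x) ↑(G.connZ cov (fun y => G.connZ cov B y (V y)) x (U x)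
        - G.connZ cov (fun y => G.connZ cov B y (U y)) x (V x)
        - G.connZ cov B x (mlieBracket (𝓡 d) U V x)) = 0 := by
  have hn := hs.mem_nhds hx
  obtain ⟨hV1, hV2⟩ := G.mvfderiv_mvfderiv_vertMetric hL hs hA hB hV hx (U x)
  obtain ⟨hU1, hU2⟩ := G.mvfderiv_mvfderiv_vertMetric hL hs hA hB hU hx (V x)
  have h := mvfderiv_mvfderiv_sub (hU.contMDiffAt hn) (hV.contMDiffAt hn)
    ((G.contMDiffOn_vertMetric hA hB).contMDiffAt hn) hU1 hV1
  rw [hV2, hU2, G.mvfderiv_vertMetric hL ((hA.contMDiffAt hn).mdifferentiableAt (by simp))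
    ((hB.contMDiffAt hn).mdifferentiableAt (by simp))] at h
  simp only [Submodule.coe_sub, map_sub, sub_apply]
  linarith

/-- The curvature of `∇^Z` takes values in the skew endomorphisms of `(TZ, g^Z)`. -/
theorem curvZ_skew (hL : IsLeviCivita G.metric cov) (x : M) (u v : TangentSpace (𝓡 d) x)
    (w w' : verticalSpace p d pr x) :
    G.vertMetric x (G.curvZ cov x u v w) w' + G.vertMetric x w (G.curvZ cov x u v w') = 0 := by
  obtain ⟨sU, hsU, hU⟩ := exists_isSmoothFieldOn_extend u
  obtain ⟨sV, hsV, hV⟩ := exists_isSmoothFieldOn_extend v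
  obtain ⟨sA, hsA, hA⟩ := exists_isSmoothFieldOn_extend (w : TangentSpace (𝓡 d) x)
  obtain ⟨sB, hsB, hB⟩ := exists_isSmoothFieldOn_extend (w' : TangentSpace (𝓡 d) x)
  obtain ⟨s, hss, hs, hxs⟩ := mem_nhds_iff.1
    (Filter.inter_mem (Filter.inter_mem hsU hsV) (Filter.inter_mem hsA hsB))
  replace hU := hU.mono fun y hy => (hss hy).1.1
  replace hV := hV.mono fun y hy => (hss hy).1.2
  replace hA := G.isSmoothFieldOn_projZ (hA.mono fun y hy => (hss hy).2.1)
  replace hB := G.isSmoothFieldOn_projZ (hB.mono fun y hy => (hss hy).2.2)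
  have hAx : G.projZ x (FiberBundle.extend (EuclideanSpace ℝ (Fin d)) (w : TangentSpace (𝓡 d) x) x)
      = w := by
    rw [FiberBundle.extend_apply_self]
    exact Submodule.projectionOnto_apply_left (G.isCompl x) w
  have hBx : G.projZ x (FiberBundle.extend (EuclideanSpace ℝ (Fin d)) (w' : TangentSpace (𝓡 d) x) x)
      = w' := by
    rw [FiberBundle.extend_apply_self]
    exact Submodule.projectionOnto_apply_left (G.isCompl x) w'
  have h := G.vertMetric_curvature hL hs hA hB hU hV hxs
  rwa [hAx, hBx, FiberBundle.extend_apply_self, FiberBundle.extend_apply_self] at h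

end FamilyGeometry

end VerticalConnection

/-! ### The rank of the vertical tangent bundle -/

section VerticalRank

variable {p n d : ℕ}
  {Y : Type*} [TopologicalSpace Y] [ChartedSpace (EuclideanSpace ℝ (Fin p)) Y]
  [IsManifold (𝓡 p) ∞ Y]
  {Z : Type*} [TopologicalSpace Z] [ChartedSpace (EuclideanSpace ℝ (Fin n)) Z]
  [IsManifold (𝓡 n) ∞ Z]
  {M : Type*} [TopologicalSpace M] [ChartedSpace (EuclideanSpace ℝ (Fin d)) M]
  [IsManifold (𝓡 d) ∞ M]

/-- In a local trivialization the vertical space is the tangent space of the second factor. -/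
theorem IsSmoothFiberBundle.finrank_verticalSpace {pr : M → Y}
    (h : IsSmoothFiberBundle p n d Z pr) (x : M) :
    Module.finrank ℝ (verticalSpace p d pr x) = n := by
  obtain ⟨U, φ, hU, hxU, hsource, htarget, hφ, hsmooth, hsmooth'⟩ := h (pr x)
  have hx : x ∈ φ.source := by rw [hsource]; exact hxU
  have hdiff : φ.MDifferentiable (𝓡 d) ((𝓡 p).prod (𝓡 n)) :=
    ⟨hsmooth.mdifferentiableOn (by simp), hsmooth'.mdifferentiableOn (by simp)⟩
  have := IsManifold.of_le (I := 𝓡 d) (M := M) (m := 1) (n := ∞) ENat.LEInfty.out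
  have := IsManifold.of_le (I := 𝓡 p) (M := Y) (m := 1) (n := ∞) ENat.LEInfty.out
  have := IsManifold.of_le (I := 𝓡 n) (M := Z) (m := 1) (n := ∞) ENat.LEInfty.out
  have heq : pr =ᶠ[nhds x] (Prod.fst ∘ φ) := by
    filter_upwards [φ.open_source.mem_nhds hx] with y hy
    exact (hφ y hy).symm
  have hd : mfderiv (𝓡 d) (𝓡 p) pr x =
      (ContinuousLinearMap.fst ℝ (EuclideanSpace ℝ (Fin p)) (EuclideanSpace ℝ (Fin n))).comp
        (hdiff.mfderiv hx : TangentSpace (𝓡 d) x →L[ℝ] TangentSpace ((𝓡 p).prod (𝓡 n)) (φ x)) := by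
    rw [heq.mfderiv_eq, mfderiv_comp (I' := (𝓡 p).prod (𝓡 n)) x mdifferentiableAt_fst
      (hdiff.mdifferentiableAt hx), mfderiv_fst]
    rfl
  have e : verticalSpace p d pr x ≃ₗ[ℝ] LinearMap.ker
      (LinearMap.fst ℝ (EuclideanSpace ℝ (Fin p)) (EuclideanSpace ℝ (Fin n))) := by
    let f : TangentSpace (𝓡 d) x ≃ₗ[ℝ] EuclideanSpace ℝ (Fin p) × EuclideanSpace ℝ (Fin n) :=
      (hdiff.mfderiv hx).toLinearEquiv
    have hker : verticalSpace p d pr x = (LinearMap.ker (LinearMap.fst ℝ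
        (EuclideanSpace ℝ (Fin p)) (EuclideanSpace ℝ (Fin n)))).comap (f : _ →ₗ[ℝ] _) := by
      rw [verticalSpace, hd]
      rfl
    exact (LinearEquiv.ofEq _ _ hker).trans (f.ofSubmodule' _)
  rw [e.finrank_eq, LinearMap.ker_fst, LinearMap.finrank_range_of_inj LinearMap.inr_injective,
    finrank_euclideanSpace_fin]

end VerticalRank

/-! ### The matrix of the vertical curvature -/

/-- A matrix that is skew with respect to an invertible bilinear form is conjugate to the
negative of its transpose, so its odd powers are traceless. -/
theorem Matrix.trace_pow_odd_eq_zero_of_skew {ι A : Type*} [Fintype ι] [DecidableEq ι] [CommRing A]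
    [Algebra ℂ A] {g R : Matrix ι ι A} (hg : IsUnit g.det) (hR : g * R = -(R.transpose * g))
    (k : ℕ) :
    (R ^ (2 * k + 1)).trace = 0 := by
  have hpow (j : ℕ) : g * R ^ j = (-R.transpose) ^ j * g := by
    induction j with
    | zero => simp
    | succ j ih => rw [pow_succ, ← mul_assoc, ih, mul_assoc, hR, pow_succ, mul_assoc, neg_mul]
  have h : R ^ (2 * k + 1) = g⁻¹ * ((-R.transpose) ^ (2 * k + 1) * g) := by
    rw [← hpow, ← mul_assoc, Matrix.nonsing_inv_mul _ hg, one_mul]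
  have ht : (R ^ (2 * k + 1)).trace = -(R ^ (2 * k + 1)).trace := by
    conv_lhs => rw [h, Matrix.trace_mul_comm, mul_assoc, Matrix.mul_nonsing_inv _ hg, mul_one,
      Odd.neg_pow ⟨k, rfl⟩, ← Matrix.transpose_pow, Matrix.trace_neg, Matrix.trace_transpose]
  have h2 : (2 : ℂ) • (R ^ (2 * k + 1)).trace = 0 := by
    rw [two_smul]
    nth_rewrite 1 [ht]
    exact neg_add_cancel _
  exact (smul_eq_zero_iff_right (two_ne_zero' ℂ)).1 h2


namespace EvenForms

variable {T : Type*} [AddCommGroup T] [Module ℝ T] [FiniteDimensional ℝ T]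

theorem ofTwoForm_zero : ofTwoForm (fun _ _ : T => (0 : ℝ)) = 0 := by
  simp [ofTwoForm]
  rfl

theorem ofTwoForm_add (η θ : T → T → ℝ) :
    ofTwoForm (fun u v => η u v + θ u v) = ofTwoForm η + ofTwoForm θ := by
  simp only [ofTwoForm, Complex.ofReal_add, add_smul, Finset.sum_add_distrib, smul_add]
  rfl

theorem ofTwoForm_const_mul (c : ℝ) (η : T → T → ℝ) :
    ofTwoForm (fun u v => c * η u v) = (c : ℂ) • ofTwoForm η := by
  simp only [ofTwoForm, Complex.ofReal_mul, mul_smul, ← Finset.smul_sum]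
  rw [smul_comm]
  rfl

theorem ofTwoForm_sum_mul {ι : Type*} (s : Finset ι) (c : ι → ℝ) (η : ι → T → T → ℝ) :
    ofTwoForm (fun u v => ∑ k ∈ s, c k * η k u v) = ∑ k ∈ s, (c k : ℂ) • ofTwoForm (η k) := by
  classical
  induction s using Finset.induction_on with
  | empty => simp [ofTwoForm_zero]
  | insert a s ha ih =>
    simp only [Finset.sum_insert ha, ofTwoForm_add, ofTwoForm_const_mul, ih]

end EvenForms

section CurvatureMatrix

variable {p d : ℕ}
  {Y : Type*} [TopologicalSpace Y] [ChartedSpace (EuclideanSpace ℝ (Fin p)) Y]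
  [IsManifold (𝓡 p) ∞ Y]
  {M : Type*} [TopologicalSpace M] [ChartedSpace (EuclideanSpace ℝ (Fin d)) M]
  [IsManifold (𝓡 d) ∞ M]

namespace FamilyGeometry

variable {pr : M → Y} (G : FamilyGeometry p d pr)
  {cov : CovariantDerivative (𝓡 d) (EuclideanSpace ℝ (Fin d)) (TangentSpace (𝓡 d) : M → Type _)}

/-- The Gram matrix of `g^Z` in the basis in which the curvature matrix is taken. -/
noncomputable def gramMatrix (x : M) :
    Matrix (Fin (Module.finrank ℝ (verticalSpace p d pr x)))
      (Fin (Module.finrank ℝ (verticalSpace p d pr x))) ℝ :=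
  Matrix.of fun i j => G.vertMetric x (Module.finBasis ℝ (verticalSpace p d pr x) i)
    (Module.finBasis ℝ (verticalSpace p d pr x) j)

theorem vertMetric_eq_sum_left (x : M) (w : verticalSpace p d pr x) (j) :
    G.vertMetric x w (Module.finBasis ℝ (verticalSpace p d pr x) j) =
      ∑ k, G.gramMatrix x k j * (Module.finBasis ℝ (verticalSpace p d pr x)).repr w k := by
  conv_lhs => rw [← (Module.finBasis ℝ (verticalSpace p d pr x)).sum_repr w]
  simp only [Submodule.coe_sum, Submodule.coe_smul, map_sum, map_smul, sum_apply, smul_apply,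
    smul_eq_mul, gramMatrix, Matrix.of_apply]
  exact Finset.sum_congr rfl fun k _ => mul_comm _ _

theorem vertMetric_eq_sum_right (x : M) (w : verticalSpace p d pr x) (i) :
    G.vertMetric x (Module.finBasis ℝ (verticalSpace p d pr x) i) w =
      ∑ k, G.gramMatrix x i k * (Module.finBasis ℝ (verticalSpace p d pr x)).repr w k := by
  rw [G.vertMetric_symm, vertMetric_eq_sum_left]
  exact Finset.sum_congr rfl fun k _ => by
    rw [gramMatrix, Matrix.of_apply, Matrix.of_apply, G.vertMetric_symm]

theorem det_gramMatrix_ne_zero (x : M) : (G.gramMatrix x).det ≠ 0 := by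
  intro h
  obtain ⟨c, hc, h0⟩ := Matrix.exists_mulVec_eq_zero_iff.2 h
  set b := Module.finBasis ℝ (verticalSpace p d pr x) with hb
  set w := b.equivFun.symm c with hw
  have hwc (k) : b.repr w k = c k := by
    rw [← b.equivFun_apply, hw, LinearEquiv.apply_symm_apply]
  have hw0 : (w : TangentSpace (𝓡 d) x) ≠ 0 := by
    rw [Ne, Submodule.coe_eq_zero, hw, LinearEquiv.map_eq_zero_iff]
    exact hc
  have hvanish (i) : G.vertMetric x (b i) w = 0 := by
    rw [hb, vertMetric_eq_sum_right]
    simp only [← hb, hwc]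
    exact congrFun h0 i
  have hww : G.vertMetric x w w = 0 := by
    nth_rewrite 1 [← b.sum_repr w]
    simp only [Submodule.coe_sum, Submodule.coe_smul, map_sum, map_smul, sum_apply, smul_apply,
      hvanish, smul_zero, Finset.sum_const_zero]
  exact (G.vertMetric_pos x w w.2 hw0).ne' hww

/-- Skewness of `R^Z` in matrix form. -/
theorem gramMatrix_mul_curvatureMatrix (hL : IsLeviCivita G.metric cov) (x : M) :
    (G.gramMatrix x).map (fun c => algebraMap ℂ (EvenForms (TangentSpace (𝓡 d) x)) c)
        * G.curvatureMatrix cov x =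
      -((G.curvatureMatrix cov x).transpose
        * (G.gramMatrix x).map (fun c => algebraMap ℂ (EvenForms (TangentSpace (𝓡 d) x)) c)) := by
  rw [eq_neg_iff_add_eq_zero]
  ext i j
  simp only [Matrix.add_apply, Matrix.mul_apply, Matrix.map_apply, Matrix.transpose_apply,
    curvatureMatrix, Matrix.of_apply, ← Algebra.smul_def, Matrix.zero_apply]
  have h (a b : EvenForms (TangentSpace (𝓡 d) x)) : a * b = b * a := mul_comm a b
  simp only [h _ (algebraMap ℂ _ _), ← Algebra.smul_def, ← EvenForms.ofTwoForm_sum_mul,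
    ← vertMetric_eq_sum_left, ← vertMetric_eq_sum_right, ← EvenForms.ofTwoForm_add]
  convert EvenForms.ofTwoForm_zero using 4 with u v
  rw [add_comm]
  exact G.curvZ_skew hL x u v _ _

/-- The odd Chern character forms of a real bundle with metric connection vanish. -/
theorem trace_curvatureMatrix_pow_odd (hL : IsLeviCivita G.metric cov) (x : M) (k : ℕ) :
    (G.curvatureMatrix cov x ^ (2 * k + 1)).trace = 0 := by
  refine Matrix.trace_pow_odd_eq_zero_of_skew ?_ (G.gramMatrix_mul_curvatureMatrix hL x) k
  have : ((G.gramMatrix x).map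
      (fun c : ℝ => algebraMap ℂ (EvenForms (TangentSpace (𝓡 d) x)) c)).det =
      algebraMap ℂ (EvenForms (TangentSpace (𝓡 d) x)) ((G.gramMatrix x).det : ℂ) :=
    (((algebraMap ℂ (EvenForms (TangentSpace (𝓡 d) x))).comp Complex.ofRealHom).map_det
      (G.gramMatrix x)).symm
  rw [this]
  exact (IsUnit.mk0 _ (Complex.ofReal_ne_zero.2 (G.det_gramMatrix_ne_zero x))).map _

end FamilyGeometry

end CurvatureMatrix

theorem proposition3p1 {p n d m : ℕ}
    (hn : n = 8 * m + 1 ∨ n = 8 * m + 2 ∨ n = 8 * m + 3)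
    {Y : Type*} [TopologicalSpace Y] [T2Space Y] [SecondCountableTopology Y] [ConnectedSpace Y]
    [ChartedSpace (EuclideanSpace ℝ (Fin p)) Y] [IsManifold (𝓡 p) ∞ Y]
    {Z : Type*} [TopologicalSpace Z] [T2Space Z] [CompactSpace Z]
    [ChartedSpace (EuclideanSpace ℝ (Fin n)) Z] [IsManifold (𝓡 n) ∞ Z]
    {M : Type*} [TopologicalSpace M] [T2Space M] [SecondCountableTopology M]
    [ChartedSpace (EuclideanSpace ℝ (Fin d)) M] [IsManifold (𝓡 d) ∞ M]
    (pr : M → Y) (hpr : IsSmoothFiberBundle p n d Z pr) (G : FamilyGeometry p d pr)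
    (nablaL : CovariantDerivative (𝓡 d) (EuclideanSpace ℝ (Fin d))
      (TangentSpace (𝓡 d) : M → Type _))
    (hL : IsLeviCivita G.metric nablaL) :
    ∃ P₁ P₂ : ℍ → (x : M) → Forms (TangentSpace (𝓡 d) x),
      ∀ x : M,
        (∀ τ, HasQSum (P₁Coeff (8 * m + 4) (G.curvatureMatrix nablaL x)) τ (P₁ τ x)) ∧
        (∀ τ, HasQSum (P₂Coeff (8 * m + 4) (G.curvatureMatrix nablaL x)) τ (P₂ τ x)) ∧
        IsModularFormValued (CongruenceSubgroup.Gamma0 2) (4 * m + 2) (fun τ => P₁ τ x) ∧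
        IsModularFormValued GammaUpper0Two (4 * m + 2) (fun τ => P₂ τ x) ∧
        ∀ τ : ℍ, P₁ (ModularGroup.S • τ) x =
          (((2 : ℝ) ^ ((n : ℝ) / 2) : ℝ) * (τ : ℂ) ^ (4 * m + 2)) • P₂ τ x := by
  have hhom (x : M) (i j) : EvenForms.IsHomogeneous 1 (G.curvatureMatrix nablaL x i j) := by
    rw [FamilyGeometry.curvatureMatrix, Matrix.of_apply]
    exact EvenForms.isHomogeneous_ofTwoForm _
  have h (x : M) := exists_modular_coeffs (hhom x)
    (fun k => G.trace_curvatureMatrix_pow_odd hL x k) (4 * m + 2)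
  choose P₁ P₂ h₁ h₂ h₃ h₄ h₅ using h
  have hk : 2 * (4 * m + 2) = 8 * m + 4 := by ring
  have hw : ((4 * m + 2 : ℕ) : ℤ) = 4 * m + 2 := by push_cast; ring
  simp only [hk, hw, Fintype.card_fin, hpr.finrank_verticalSpace] at h₁ h₂ h₃ h₄ h₅
  exact ⟨fun τ x => P₁ x τ, fun τ x => P₂ x τ, fun x => ⟨h₁ x, h₂ x, h₃ x, h₄ x, h₅ x⟩⟩
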